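/- **Setting.** Let $(M,g)$ be an oriented smooth Lorentz $4$-manifold with Levi-Civita connection $\nabla$, Christoffel symbols $\Gamma^c_{ab}$ (with $\nabla_a t^c=\partial_a t^c+\Gamma^c_{ab}t^b$) and volume form $\eta=\sqrt{|g|}\,d^4x$. Let $Y\to M$ be the bundle of tensors of a type given by a smooth finite-dimensional representation $\rho$ of $GL(4,\mathbb R)$ (for instance a $GL(4,\mathbb R)$-invariant subbundle of a finite sum of mixed tensor bundles), with associated Lie algebra representation $d\rho$. Let $E\to M$ be a smooth real vector bundle of finite rank, possibly with a fibre structure given by a covering family of adapted local frames and a matrix Lie algebra $\mathfrak l$, so that the endomorphisms of the fibres with matrices in $\mathfrak l$ form a Lie algebra bundle $L\subset\operatorname{End}E$ and the linear connections of $E$ with coefficients in $\mathfrak l$ form an affine bundle $C$ modelled on $T^*M\otimes L$. A field is a pair $(\phi,\kappa)$ of a smooth section $\phi$ of $E\otimes Y$ and a smooth section $\kappa$ of $C$. Its covariant prolongation is $\mathfrak d(\phi,\kappa)=(\phi,\nabla\phi,\mathrm d_\kappa\kappa)$, where, in coordinates and in an adapted frame, $$\nabla_a\phi^i=\partial_a\phi^i-\kappa_a{}^i{}_j\phi^j+\Gamma^c_{ab}\,d\rho(e_c{}^b)\phi^i,\qquad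 (\mathrm d_\kappa\kappa)_{ab}=\partial_a\kappa_b-\partial_b\kappa_a-[\kappa_a,\kappa_b],$$ $e_c{}^b$ being the matrix whose only non-zero entry is a $1$ in row $c$, column $b$. Let $\Lambda=\lambda\,\eta$ be a natural Lagrangian density on the covariant prolongation bundle: $\lambda=\lambda(g,y,z,w)$ is a smooth real function of the metric and of the arguments $y,z,w$ that stand for $\phi,\nabla\phi,\mathrm d_\kappa\kappa$; it depends explicitly on the spacetime coordinates only through $g$, that is, in each adapted frame it is expressed by one and the same function of the components at all points and in all positively oriented frames of the tangent spaces. The field $(\phi,\kappa)$ is *critical* if $\int_M\frac{d}{d\varepsilon}\big|_{0}\,\Lambda\circ\mathfrak d(\phi+\varepsilon\,\delta\phi,\kappa+\varepsilon\,\delta\kappa)=0$ for all smooth compactly supported sections $\delta\phi$ of $E\otimes Y$ and $\delta\kappa$ of $T^*M\otimes L$. Along a field, put $B^{ab}{}_c=\frac{\partial\lambda}{\partial z_a^{iA}}\,(d\rho(e_c{}^b)\phi)^{iA}$, let $S^{ab}$ be the symmetric part of $-\tfrac12\nabla_c\bigl(B^{cab}+B^{acb}-B^{abc}\bigr)$ (indices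 raised by $g$), and let the *stress-energy tensor* be $$\mathcal T^{ab}=\frac{\partial\lambda}{\partial g_{ab}}+\tfrac12\,\lambda\,g^{ab}+S^{ab}.$$ **Theorem.** For every field $(\phi,\kappa)$, the tensor $\mathcal T$ is symmetric and expresses the response of the Lagrangian to deformations of the metric: if the metric varies by a symmetric tensor field $\delta g$ with compact support in the domain of an adapted coordinate system and frame, the fields being fixed and the Levi-Civita connection varying accordingly, then $\delta\int\Lambda=\int\mathcal T^{ab}\,\delta g_{ab}\,\eta$. The stress-energy tensor is divergence-free on shell: if $(\phi,\kappa)$ is critical, then $$\nabla_a\mathcal T^{ab}=0\qquad\text{everywhere on }M .$$ -/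

import Mathlib

open Bundle MeasureTheory
open scoped Manifold ContDiff TensorProduct

noncomputable section

namespace CovariantFields

/-- The coordinate space of a four-dimensional manifold. -/
abbrev V4 : Type := EuclideanSpace ℝ (Fin 4)

/-- The standard basis vectors of the coordinate space. -/
def stdVec (a : Fin 4) : V4 := EuclideanSpace.single a (1 : ℝ)

/-- The elementary endomorphism of the coordinate space with matrix entry 1 in row `c`,
column `b`: it sends `v` to `v b` times the `c`-th basis vector. -/
def elemEnd (c b : Fin 4) : V4 →L[ℝ] V4 :=
  (EuclideanSpace.proj b : V4 →L[ℝ] ℝ).smulRight (stdVec c)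

/-- The partial derivative in the direction of the `a`-th coordinate. -/
def pd {X : Type*} [NormedAddCommGroup X] [NormedSpace ℝ X]
    (a : Fin 4) (f : V4 → X) (p : V4) : X := fderiv ℝ f p (stdVec a)

/-! ### Spacetime: orientation and Lorentz metric -/

section Spacetime

variable (M : Type*) [TopologicalSpace M] [ChartedSpace V4 M] [IsManifold (𝓡 4) ∞ M]

/-- An orientation of a four-manifold, given by an atlas of smooth charts whose coordinate
changes have positive Jacobian determinant. -/
structure OrientedAtlas where
  charts : Set (OpenPartialHomeomorph M V4)
  smooth : charts ⊆ IsManifold.maximalAtlas (𝓡 4) ∞ M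
  cover : ∀ x : M, ∃ c ∈ charts, x ∈ c.source
  oriented : ∀ c ∈ charts, ∀ c' ∈ charts, ∀ p ∈ (c.symm.trans c').source,
    0 < LinearMap.det (fderiv ℝ (c.symm.trans c') p : V4 →ₗ[ℝ] V4)

variable {M}

/-- The coordinate frame of the chart `c` at the point of coordinates `p`, as the linear map from
the coordinate space to the tangent space. -/
def coordFrame (c : OpenPartialHomeomorph M V4) (p : V4) :
    V4 →L[ℝ] TangentSpace (𝓡 4) (c.symm p) :=
  mfderiv (𝓡 4) (𝓡 4) c.symm p

/-- The coordinate vector field of the chart `c`. -/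
def coordVec (c : OpenPartialHomeomorph M V4) (p : V4) (a : Fin 4) :
    TangentSpace (𝓡 4) (c.symm p) :=
  coordFrame c p (stdVec a)

/-- The components of the Minkowski metric. -/
def minkowski (a b : Fin 4) : ℝ := if a = b then (if a = 0 then 1 else -1) else 0

/-- Components of a symmetric bilinear form of Lorentzian signature,
with either sign convention, `(+,-,-,-)` or `(-,+,+,+)`. -/
def IsLorentz (G : Fin 4 → Fin 4 → ℝ) : Prop :=
  ∃ P : Matrix (Fin 4) (Fin 4) ℝ, IsUnit P.det ∧ ∃ σ : ℝ, (σ = 1 ∨ σ = -1) ∧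
    P.transpose * Matrix.of G * P = σ • Matrix.of minkowski

/-- Components in the chart `c` of a field of bilinear forms. -/
def metricComp (g : ∀ x : M, TangentSpace (𝓡 4) x →L[ℝ] TangentSpace (𝓡 4) x →L[ℝ] ℝ)
    (c : OpenPartialHomeomorph M V4) (p : V4) (a b : Fin 4) : ℝ :=
  g (c.symm p) (coordVec c p a) (coordVec c p b)

/-- A smooth Lorentz metric on an oriented four-manifold. -/
structure LorentzMetric (O : OrientedAtlas M) where
  val : ∀ x : M, TangentSpace (𝓡 4) x →L[ℝ] TangentSpace (𝓡 4) x →L[ℝ] ℝ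
  symm : ∀ x v w, val x v w = val x w v
  lorentz : ∀ c ∈ O.charts, ∀ p ∈ c.target, IsLorentz (metricComp val c p)
  smooth : ∀ c ∈ O.charts, ContDiffOn ℝ ∞ (metricComp val c) c.target

end Spacetime

/-! ### Spacetime indices -/

section SpacetimeIndices

variable (W : Type*) [NormedAddCommGroup W] [NormedSpace ℝ W]

/-- A tensor type: a smooth representation of the general linear group of the coordinate space on
the vector space `W` of the possible components. Examples are the mixed tensors of any finite
collection of valences and their invariant subspaces. (The value of `toFun` at non-invertible maps
is irrelevant.) -/
structure TensorType where
  toFun : (V4 →L[ℝ] V4) → (W →L[ℝ] W)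
  map_one : toFun (ContinuousLinearMap.id ℝ V4) = ContinuousLinearMap.id ℝ W
  map_mul : ∀ A B : V4 ≃L[ℝ] V4,
    toFun ((A : V4 →L[ℝ] V4).comp (B : V4 →L[ℝ] V4)) = (toFun A).comp (toFun B)
  smooth : ContDiffOn ℝ ∞ toFun {A | ∃ B : V4 ≃L[ℝ] V4, (B : V4 →L[ℝ] V4) = A}

variable {W}

/-- The associated representation of the Lie algebra of all endomorphisms. -/
def TensorType.inf (ρ : TensorType W) (X : V4 →L[ℝ] V4) : W →L[ℝ] W :=
  fderiv ℝ ρ.toFun (ContinuousLinearMap.id ℝ V4) X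

variable {M : Type*} [TopologicalSpace M] [ChartedSpace V4 M]

/-- The fibre at `x` of the bundle `Y` of tensors of type `ρ`: a tensor assigns to each frame `f` of
the tangent space its components in that frame, which change by the representation `ρ` under a
change of frame. (Frames are the bijective linear maps; on other maps the value is fixed
to be zero.) -/
def tensorFiber (ρ : TensorType W) (x : M) :
    Submodule ℝ ((V4 →L[ℝ] TangentSpace (𝓡 4) x) → W) where
  carrier := {t | (∀ (f : V4 →L[ℝ] TangentSpace (𝓡 4) x) (A : V4 ≃L[ℝ] V4),
      t (f.comp (A : V4 →L[ℝ] V4)) = ρ.toFun (A.symm : V4 →L[ℝ] V4) (t f)) ∧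
    ∀ f : V4 →L[ℝ] TangentSpace (𝓡 4) x, ¬ Function.Bijective f → t f = 0}
  add_mem' := by
    rintro s t ⟨hs, hs0⟩ ⟨ht, ht0⟩
    refine ⟨fun f A => ?_, fun f hf => ?_⟩
    · simp [hs f A, ht f A]
    · simp [hs0 f hf, ht0 f hf]
  zero_mem' := ⟨fun f A => by simp, fun f _ => rfl⟩
  smul_mem' := by
    rintro r t ⟨ht, ht0⟩
    refine ⟨fun f A => ?_, fun f hf => ?_⟩
    · simp [ht f A]
    · simp [ht0 f hf]

/-- The components of a tensor in a frame. -/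
def tensorEval (ρ : TensorType W) (x : M) (f : V4 →L[ℝ] TangentSpace (𝓡 4) x) :
    tensorFiber ρ x →ₗ[ℝ] W :=
  (LinearMap.proj f).comp (tensorFiber ρ x).subtype

end SpacetimeIndices

/-! ### The vector bundle with its fibre structure -/

section Gauge

variable {M : Type*} [TopologicalSpace M] [ChartedSpace V4 M] [IsManifold (𝓡 4) ∞ M]
variable (n : ℕ) (E : M → Type*) [∀ x, AddCommGroup (E x)] [∀ x, Module ℝ (E x)]
  [∀ x, TopologicalSpace (E x)] [TopologicalSpace (TotalSpace (Fin n → ℝ) E)]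
  [FiberBundle (Fin n → ℝ) E]

/-- A gauge: a smooth local frame of the vector bundle `E` over an open set. -/
structure Gauge where
  dom : Set M
  isOpen_dom : IsOpen dom
  frame : Fin n → ∀ x : M, E x
  isFrame : IsLocalFrameOn (𝓡 4) (Fin n → ℝ) ∞ frame dom

variable {n E}

/-- The components of elements of `E` in a gauge. -/
def Gauge.coeff (s : Gauge n E) (i : Fin n) (x : M) : E x →ₗ[ℝ] ℝ := s.isFrame.coeff i x

/-- The transition matrix between two gauges: `s' j = ∑ i, t i j • s i`. -/
def Gauge.trans (s s' : Gauge n E) (x : M) : Matrix (Fin n) (Fin n) ℝ :=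
  Matrix.of fun i j => s.coeff i x (s'.frame j x)

/-- The derivative of the transition matrix along a tangent vector. -/
def Gauge.dtrans (s s' : Gauge n E) (x : M) (v : TangentSpace (𝓡 4) x) :
    Matrix (Fin n) (Fin n) ℝ :=
  Matrix.of fun i j => (mfderiv (𝓡 4) 𝓘(ℝ, ℝ) (fun y : M => s.trans s' y i j) x v : ℝ)

variable (n E)

/-- The fibre structure of `E`, in terms of a family of adapted gauges covering the base and
of a Lie algebra `alg` of matrices. The bundle `L` of endomorphisms of the fibres of `E` whose
matrices in the adapted gauges are in `alg` is well-defined by `adjoint`; the bundle `C` of the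
linear connections of `E` whose coefficients in the adapted gauges are in `alg` is well-defined
by `adjoint` and `maurerCartan`. In the absence of any added fibre structure `alg` is the algebra
of all matrices, for which the last two conditions hold for all gauges. -/
structure GaugeStructure where
  alg : Submodule ℝ (Matrix (Fin n) (Fin n) ℝ)
  lie_mem : ∀ X ∈ alg, ∀ Y ∈ alg, X * Y - Y * X ∈ alg
  gauges : Set (Gauge n E)
  cover : ∀ x : M, ∃ s ∈ gauges, x ∈ s.dom
  adjoint : ∀ s ∈ gauges, ∀ s' ∈ gauges, ∀ x ∈ s.dom ∩ s'.dom, ∀ X ∈ alg,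
    s.trans s' x * X * (s.trans s' x)⁻¹ ∈ alg
  maurerCartan : ∀ s ∈ gauges, ∀ s' ∈ gauges, ∀ x ∈ s.dom ∩ s'.dom,
    ∀ v : TangentSpace (𝓡 4) x, s.dtrans s' x v * (s.trans s' x)⁻¹ ∈ alg

end Gauge

/-! ### The covariant prolongation and natural Lagrangians -/

/-- The arguments of a Lagrangian at a point, in components: those of the metric `g`, and the fibre
coordinates `y^{iA}`, `z_a^{iA}`, `z_{ab}^i_j` of the covariant prolongation bundle. The latter three
stand for the matter field, its covariant differential and the covariant differential (up to sign,
the curvature) of the gauge field. -/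
abbrev Prolong (n : ℕ) (W : Type*) : Type _ :=
  (Fin 4 → Fin 4 → ℝ) × (Fin n → W) × (Fin 4 → Fin n → W) ×
    (Fin 4 → Fin 4 → Fin n → Fin n → ℝ)

/-- The admissible arguments: the metric is Lorentzian, and the curvature-type argument is a
2-form with values in the Lie algebra of the fibre structure. -/
def admissible {n : ℕ} (W : Type*) (alg : Submodule ℝ (Matrix (Fin n) (Fin n) ℝ)) :
    Set (Prolong n W) :=
  {q | IsLorentz q.1 ∧ (∀ a b i j, q.2.2.2 a b i j = -q.2.2.2 b a i j) ∧
    ∀ a b, Matrix.of (q.2.2.2 a b) ∈ alg}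

section Lagrangian

variable {W : Type*} [NormedAddCommGroup W] [NormedSpace ℝ W] {n : ℕ}

/-- The components in the new frame of tangent vectors obtained from the old one by `A`
(the new `a`-th vector is the sum over `b` of `A b a` times the old `b`-th one). -/
def frameChange (ρ : TensorType W) (A : V4 ≃L[ℝ] V4) (q : Prolong n W) : Prolong n W :=
  (fun a b => ∑ c, ∑ d, A (stdVec a) c * A (stdVec b) d * q.1 c d,
   fun i => ρ.toFun (A.symm : V4 →L[ℝ] V4) (q.2.1 i),
   fun a i => ∑ c, A (stdVec a) c • ρ.toFun (A.symm : V4 →L[ℝ] V4) (q.2.2.1 c i),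
   fun a b i j => ∑ c, ∑ d, A (stdVec a) c * A (stdVec b) d * q.2.2.2 c d i j)

/-- The components in the new gauge obtained from the old one by the transition matrix `t`. -/
def gaugeChange (t : Matrix (Fin n) (Fin n) ℝ) (q : Prolong n W) : Prolong n W :=
  (q.1,
   fun i => ∑ j, t⁻¹ i j • q.2.1 j,
   fun a i => ∑ j, t⁻¹ i j • q.2.2.1 a j,
   fun a b i j => (t⁻¹ * Matrix.of (q.2.2.2 a b) * t) i j)

variable {M : Type*} [TopologicalSpace M] [ChartedSpace V4 M] [IsManifold (𝓡 4) ∞ M]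
variable {E : M → Type*} [∀ x, AddCommGroup (E x)] [∀ x, Module ℝ (E x)]
  [∀ x, TopologicalSpace (E x)] [TopologicalSpace (TotalSpace (Fin n → ℝ) E)]
  [FiberBundle (Fin n → ℝ) E]

/-- A Lagrangian density `λ η` on the covariant prolongation bundle (`η` being the volume form of
the metric) whose scalar factor `λ` depends explicitly on the spacetime coordinates only through
the metric (the derivatives of the metric enter through the covariant differential of the matter
field). It is a smooth real function of the metric and of the covariant prolongation of the
fields, given by its expressions `expr s` in the adapted gauges `s`: in a given gauge the same
function `expr s` expresses it in all positively oriented frames of the tangent spaces at all points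
(`frame_inv`), and the expressions in different gauges agree (`gauge_compat`). -/
structure NaturalLagrangian (ρ : TensorType W) (S : GaugeStructure n E) where
  expr : Gauge n E → Prolong n W → ℝ
  smooth : ∀ s ∈ S.gauges, ContDiffOn ℝ ∞ (expr s) (admissible W S.alg)
  frame_inv : ∀ s ∈ S.gauges, ∀ A : V4 ≃L[ℝ] V4, 0 < LinearMap.det (A : V4 →ₗ[ℝ] V4) →
    ∀ q ∈ admissible W S.alg, expr s (frameChange ρ A q) = expr s q
  gauge_compat : ∀ s ∈ S.gauges, ∀ s' ∈ S.gauges, ∀ x ∈ s.dom ∩ s'.dom,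
    ∀ q ∈ admissible W S.alg, expr s' (gaugeChange (s.trans s' x) q) = expr s q

end Lagrangian

/-! ### Fields -/

section Fields

variable {W : Type*} [NormedAddCommGroup W] [NormedSpace ℝ W] {n : ℕ}
variable {M : Type*} [TopologicalSpace M] [ChartedSpace V4 M] [IsManifold (𝓡 4) ∞ M]
variable {E : M → Type*} [∀ x, AddCommGroup (E x)] [∀ x, Module ℝ (E x)]
  [∀ x, TopologicalSpace (E x)] [∀ x, IsTopologicalAddGroup (E x)]
  [∀ x, ContinuousSMul ℝ (E x)] [TopologicalSpace (TotalSpace (Fin n → ℝ) E)]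
  [FiberBundle (Fin n → ℝ) E]

/-- The coordinates of the points which are both in the chart `c` and in the gauge `s`. -/
def localDom (c : OpenPartialHomeomorph M V4) (s : Gauge n E) : Set V4 :=
  {p | p ∈ c.target ∧ c.symm p ∈ s.dom}

/-- The components `φ^{iA}` of a section of the tensor product of `E` and `Y`; for each `i`, they are
collected in an element of `W`. -/
def matterComp (ρ : TensorType W) (φ : ∀ x : M, E x ⊗[ℝ] tensorFiber ρ x)
    (c : OpenPartialHomeomorph M V4) (s : Gauge n E) (p : V4) (i : Fin n) : W :=
  TensorProduct.lid ℝ W (TensorProduct.map (s.coeff i (c.symm p))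
    (tensorEval ρ (c.symm p) (coordFrame c p)) (φ (c.symm p)))

/-- The coefficients `κ_a^i_j` of a linear connection of `E`, with the sign convention
`∇_a s_j = - ∑ i, κ_a^i_j s_i`, that is `∇_a φ^i = ∂_a φ^i - ∑ j, κ_a^i_j φ^j`. -/
def connComp (κ : CovariantDerivative (𝓡 4) (Fin n → ℝ) E)
    (c : OpenPartialHomeomorph M V4) (s : Gauge n E) (p : V4) (a : Fin 4) (i j : Fin n) : ℝ :=
  -s.coeff i (c.symm p) (κ (s.frame j) (c.symm p) (coordVec c p a))

/-- A smooth field: a section `φ` of the tensor product of `E` and `Y` (matter field), and a linear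
connection `κ` of `E` which preserves the fibre structure, i.e. a section of `C` (gauge field). -/
structure FieldPair (O : OrientedAtlas M) (ρ : TensorType W) (S : GaugeStructure n E) where
  matter : ∀ x : M, E x ⊗[ℝ] tensorFiber ρ x
  conn : CovariantDerivative (𝓡 4) (Fin n → ℝ) E
  smooth_matter : ∀ c ∈ O.charts, ∀ s ∈ S.gauges,
    ContDiffOn ℝ ∞ (matterComp ρ matter c s) (localDom c s)
  smooth_conn : ∀ c ∈ O.charts, ∀ s ∈ S.gauges,
    ContDiffOn ℝ ∞ (connComp conn c s) (localDom c s)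
  conn_mem : ∀ c ∈ O.charts, ∀ s ∈ S.gauges, ∀ p ∈ localDom c s, ∀ a,
    Matrix.of (connComp conn c s p a) ∈ S.alg

end Fields

/-! ### Coordinate expressions

In this section `G`, `φ`, `κ` are the components of the metric, of the matter field and of the gauge
field as functions of the coordinates, and `ℓ` is the expression of a Lagrangian. -/

section Coordinates

variable {W : Type*} [NormedAddCommGroup W] [NormedSpace ℝ W] {n : ℕ}

/-- The inverse metric `g^{ab}`. -/
def invMetric (G : Fin 4 → Fin 4 → ℝ) (a b : Fin 4) : ℝ := (Matrix.of G)⁻¹ a b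

/-- The density `√|det g|` of the volume form. -/
def volDensity (G : Fin 4 → Fin 4 → ℝ) : ℝ := Real.sqrt |(Matrix.of G).det|

/-- The Christoffel symbols of the Levi-Civita connection, with the sign convention
`∇_a t^c = ∂_a t^c + ∑ b, christoffel c a b * t^b`. -/
def christoffel (G : V4 → Fin 4 → Fin 4 → ℝ) (p : V4) (c a b : Fin 4) : ℝ :=
  (1 / 2) * ∑ d, invMetric (G p) c d *
    (pd a (fun q => G q b d) p + pd b (fun q => G q a d) p - pd d (fun q => G q a b) p)

/-- The covariant differential of the matter field with respect to the tensor product of the gauge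
field and of the spacetime connection. -/
def covDiff (ρ : TensorType W) (G : V4 → Fin 4 → Fin 4 → ℝ) (φ : V4 → Fin n → W)
    (κ : V4 → Fin 4 → Fin n → Fin n → ℝ) (p : V4) (a : Fin 4) (i : Fin n) : W :=
  pd a (fun q => φ q i) p - ∑ j, κ p a i j • φ p j
    + ∑ b, ∑ c, christoffel G p c a b • ρ.inf (elemEnd c b) (φ p i)

/-- The components `∂_a κ_b - ∂_b κ_a - [κ_a, κ_b]` of the covariant differential of the
gauge field, as coordinates on the covariant prolongation bundle. -/
def curv (κ : V4 → Fin 4 → Fin n → Fin n → ℝ) (p : V4) (a b : Fin 4) (i j : Fin n) : ℝ :=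
  pd a (fun q => κ q b i j) p - pd b (fun q => κ q a i j) p
    - ∑ h, (κ p a i h * κ p b h j - κ p b i h * κ p a h j)

/-- The covariant prolongation of the fields, together with the metric. -/
def prolong (ρ : TensorType W) (G : V4 → Fin 4 → Fin 4 → ℝ) (φ : V4 → Fin n → W)
    (κ : V4 → Fin 4 → Fin n → Fin n → ℝ) (p : V4) : Prolong n W :=
  (G p, φ p, covDiff ρ G φ κ p, curv κ p)

/-- The Lagrangian density evaluated through the fields, as a multiple of the coordinate volume
form. -/
def lagDensity (ρ : TensorType W) (ℓ : Prolong n W → ℝ) (G : V4 → Fin 4 → Fin 4 → ℝ)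
    (φ : V4 → Fin n → W) (κ : V4 → Fin 4 → Fin n → Fin n → ℝ) (p : V4) : ℝ :=
  ℓ (prolong ρ G φ κ p) * volDensity (G p)

/-- The derivative of `ℓ` with respect to the components of the metric: the symmetric array for which
`∑ a b, metricDeriv ℓ q a b * h a b` is the derivative of `ℓ` along any symmetric `h`. -/
def metricDeriv (ℓ : Prolong n W → ℝ) (q : Prolong n W) (a b : Fin 4) : ℝ :=
  deriv (fun ε : ℝ => ℓ (fun c d => q.1 c d + ε * ((1 / 2) *
    ((if c = a ∧ d = b then 1 else 0) + (if c = b ∧ d = a then 1 else 0))), q.2)) 0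

/-- The contraction of the momentum `Π^a_{iA} = ∂ℓ/∂z_a^{iA}` with the matter field acted upon by
`elemEnd c b` on its spacetime indices. Thus, if the Christoffel symbols vary by `δΓ^c_{ab}`, then
through the covariant differential of the matter field `ℓ` varies by
`∑ a b c, spinMomentum a b c * δΓ^c_{ab}`. -/
def spinMomentum (ρ : TensorType W) (ℓ : Prolong n W → ℝ) (G : V4 → Fin 4 → Fin 4 → ℝ)
    (φ : V4 → Fin n → W) (κ : V4 → Fin 4 → Fin n → Fin n → ℝ) (p : V4) (a b c : Fin 4) : ℝ :=
  deriv (fun ε : ℝ => ℓ (G p, φ p, fun a' i => covDiff ρ G φ κ p a' i +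
    (if a' = a then ε • ρ.inf (elemEnd c b) (φ p i) else 0), curv κ p)) 0

/-- The spin momentum with all indices raised. -/
def spinMomentumUp (ρ : TensorType W) (ℓ : Prolong n W → ℝ) (G : V4 → Fin 4 → Fin 4 → ℝ)
    (φ : V4 → Fin n → W) (κ : V4 → Fin 4 → Fin n → Fin n → ℝ) (p : V4) (a b d : Fin 4) : ℝ :=
  ∑ c, spinMomentum ρ ℓ G φ κ p a b c * invMetric (G p) c d

/-- The covariant divergence on the first index of a contravariant tensor of rank 3. -/
def divergence₃ (G : V4 → Fin 4 → Fin 4 → ℝ) (X : V4 → Fin 4 → Fin 4 → Fin 4 → ℝ)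
    (p : V4) (a b : Fin 4) : ℝ :=
  ∑ c, (pd c (fun q => X q c a b) p + ∑ d, (christoffel G p c c d * X p d a b
    + christoffel G p a c d * X p c d b + christoffel G p b c d * X p c a d))

/-- The covariant divergence `∇_a T^{ab}` of a contravariant tensor of rank 2. -/
def divergence₂ (G : V4 → Fin 4 → Fin 4 → ℝ) (T : V4 → Fin 4 → Fin 4 → ℝ)
    (p : V4) (b : Fin 4) : ℝ :=
  ∑ a, (pd a (fun q => T q a b) p + ∑ c, (christoffel G p a a c * T p c b
    + christoffel G p b a c * T p a c))

/-- The symmetric tensor `S^{ab}` arising from the dependence of the Lagrangian on the derivatives of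
the metric through the spacetime connection. If `B` is the spin momentum and the metric varies by
`h`, the Christoffel symbols vary by `δΓ^c_{ab} = ½ g^{cd} (∇_a h_{bd} + ∇_b h_{ad} - ∇_d h_{ab})`, and
`B^{ab}_c δΓ^c_{ab} = S^{ab} h_{ab} + a divergence`, where `S^{ab}` is the symmetric part
of `-½ ∇_c (B^{cab} + B^{acb} - B^{abc})`. -/
def connTerm (ρ : TensorType W) (ℓ : Prolong n W → ℝ) (G : V4 → Fin 4 → Fin 4 → ℝ)
    (φ : V4 → Fin n → W) (κ : V4 → Fin 4 → Fin n → Fin n → ℝ) (p : V4) (a b : Fin 4) : ℝ :=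
  let B := spinMomentumUp ρ ℓ G φ κ
  let D := divergence₃ G (fun q c a' b' => B q c a' b' + B q a' c b' - B q a' b' c) p
  (-1 / 4) * (D a b + D b a)

/-- The stress-energy tensor `T^{ab} = ∂ℓ/∂g_{ab} + ½ ℓ g^{ab} + S^{ab}`, evaluated through
the covariant prolongation of the fields. -/
def stressEnergy (ρ : TensorType W) (ℓ : Prolong n W → ℝ) (G : V4 → Fin 4 → Fin 4 → ℝ)
    (φ : V4 → Fin n → W) (κ : V4 → Fin 4 → Fin n → Fin n → ℝ) (p : V4) (a b : Fin 4) : ℝ :=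
  metricDeriv ℓ (prolong ρ G φ κ p) a b
    + (1 / 2) * ℓ (prolong ρ G φ κ p) * invMetric (G p) a b
    + connTerm ρ ℓ G φ κ p a b

/-- `T` is, on the set `D` of the coordinate space, the symmetric tensor which expresses the response
of the Lagrangian to the deformations of the metric: for all smooth symmetric `h` with compact support
in `D`, the variation of the integrated Lagrangian density, the fields `φ` and `κ` being fixed and the
spacetime connection varying with the metric, is the integral of `T^{ab} h_{ab} √|g|`. -/
def IsMetricResponse (ρ : TensorType W) (ℓ : Prolong n W → ℝ) (G : V4 → Fin 4 → Fin 4 → ℝ)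
    (φ : V4 → Fin n → W) (κ : V4 → Fin 4 → Fin n → Fin n → ℝ) (D : Set V4)
    (T : V4 → Fin 4 → Fin 4 → ℝ) : Prop :=
  (∀ p ∈ D, ∀ a b, T p a b = T p b a) ∧
  ∀ h : V4 → Fin 4 → Fin 4 → ℝ, ContDiff ℝ ∞ h → HasCompactSupport h → tsupport h ⊆ D →
    (∀ p a b, h p a b = h p b a) →
    ∫ p, deriv (fun ε : ℝ => lagDensity ρ ℓ (G + ε • h) φ κ p) 0 =
      ∫ p, (∑ a, ∑ b, T p a b * h p a b) * volDensity (G p)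

end Coordinates

/-! ### Critical fields -/

section Critical

variable {W : Type*} [NormedAddCommGroup W] [NormedSpace ℝ W] {n : ℕ}
variable {M : Type*} [TopologicalSpace M] [ChartedSpace V4 M] [IsManifold (𝓡 4) ∞ M]
variable {E : M → Type*} [∀ x, AddCommGroup (E x)] [∀ x, Module ℝ (E x)]
  [∀ x, TopologicalSpace (E x)] [∀ x, IsTopologicalAddGroup (E x)]
  [∀ x, ContinuousSMul ℝ (E x)] [TopologicalSpace (TotalSpace (Fin n → ℝ) E)]
  [FiberBundle (Fin n → ℝ) E]

/-- The field is critical: the first variation of the integrated Lagrangian density vanishes for all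
smooth compactly supported vertical variations `(δφ, δκ)`, where `δκ` is a 1-form with values in `L`.
It is enough to consider variations supported in the domain of a chart and of a gauge, for which the
integral can be written in coordinates. -/
def IsCritical {O : OrientedAtlas M} (g : LorentzMetric O) {ρ : TensorType W}
    {S : GaugeStructure n E} (Λ : NaturalLagrangian ρ S) (F : FieldPair O ρ S) : Prop :=
  ∀ c ∈ O.charts, ∀ s ∈ S.gauges,
    ∀ (δφ : V4 → Fin n → W) (δκ : V4 → Fin 4 → Fin n → Fin n → ℝ),
      ContDiff ℝ ∞ δφ → ContDiff ℝ ∞ δκ → HasCompactSupport δφ → HasCompactSupport δκ →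
      tsupport δφ ⊆ localDom c s → tsupport δκ ⊆ localDom c s →
      (∀ p a, Matrix.of (δκ p a) ∈ S.alg) →
      ∫ p, deriv (fun ε : ℝ => lagDensity ρ (Λ.expr s) (metricComp g.val c)
        (matterComp ρ F.matter c s + ε • δφ) (connComp F.conn c s + ε • δκ) p) 0 = 0

/-- The components, in the chart `c` and in the gauge `s`, of the stress-energy tensor evaluated
through the field. -/
def stressEnergyTensor {O : OrientedAtlas M} (g : LorentzMetric O) {ρ : TensorType W}
    {S : GaugeStructure n E} (Λ : NaturalLagrangian ρ S) (F : FieldPair O ρ S)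
    (c : OpenPartialHomeomorph M V4) (s : Gauge n E) : V4 → Fin 4 → Fin 4 → ℝ :=
  stressEnergy ρ (Λ.expr s) (metricComp g.val c) (matterComp ρ F.matter c s)
    (connComp F.conn c s)

end Critical

end CovariantFields

end

open CovariantFields

/-! Conservation is Noether's second theorem for diffeomorphisms, carried out in one chart and one
adapted gauge. Let ξ be a compactly supported vector field, and vary metric, matter field and gauge
field by their Lie derivatives along ξ, the gauge indices being treated as inert labels of a fixed
gauge. Covariant differential and curvature are natural operations, so the covariant prolongation
varies by its own Lie derivative: a transport term ξ^d ∂_d plus the infinitesimal frame change with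
matrix ∂ξ (`SmoothFields.dProlong_lie`). The Lagrangian has the same expression in all positively
oriented frames, hence its differential kills the frame change (`fderiv_infFrame`). The transport
term joins the variation of the volume density to form the divergence of ξ λ √|g|
(`SmoothFields.variation_lie`), whose integral vanishes.

By linearity the total variation is a metric part plus a field part. The field part is zero for a
critical field, because the Lie derivatives are admissible variations. The metric part is the
integral of T^{ab} (L_ξ g)_{ab} √|g|, which up to a divergence is -2 (∇_a T^{ab}) ξ_b √|g|
(`SmoothFields.contraction_lieMetric`). So ∇_a T^{ab} is orthogonal to every ξ, and the fundamental
lemma of the calculus of variations makes it vanish (`SmoothFields.divergence_eq_zero`).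

The response to the metric (`SmoothFields.isMetricResponse`) is the chain rule. The metric enters
explicitly, through the volume density and through the Christoffel symbols; the variation of the
latter is a tensor built from ∇h, and moving the derivative off h by the Leibniz rule yields S^{ab}
and a divergence (`SmoothFields.deriv_lagDensity_metric`).

A technical point precedes the calculus: the Lagrangian is smooth only on the admissible arguments,
which have empty interior in general. They are relatively open in a linear subspace, since
Lorentzian signature is an open condition on symmetric arrays (`eventually_isLorentz`). Composition
with a projection onto that subspace therefore gives a function `L`, smooth near the admissible
arguments, which has the same derivatives in all the directions that occur
(`exists_smooth_extension`). -/

namespace CovariantFields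

/-! ### Calculus of partial derivatives -/

section Calculus

variable {X Y : Type*} [NormedAddCommGroup X] [NormedSpace ℝ X]
  [NormedAddCommGroup Y] [NormedSpace ℝ Y]

theorem two_le_infty : minSmoothness ℝ 2 ≤ (∞ : WithTop ℕ∞) := by
  rw [minSmoothness_of_isRCLikeNormedField]; exact WithTop.coe_le_coe.2 le_top

theorem SmoothAt.diff {f : X → Y} {p : X} (hf : ContDiffAt ℝ ∞ f p) : DifferentiableAt ℝ f p :=
  hf.differentiableAt (by simp)

theorem SmoothAt.pd {f : V4 → X} {p : V4} (hf : ContDiffAt ℝ ∞ f p) (a : Fin 4) :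
    ContDiffAt ℝ ∞ (pd a f) p :=
  (hf.fderiv_right (m := ∞) (by simp)).clm_apply contDiffAt_const

theorem pd_congr {f g : V4 → X} {p : V4} (h : f =ᶠ[nhds p] g) (a : Fin 4) :
    pd a f p = pd a g p := by
  simp only [pd, h.fderiv_eq]

theorem pd_congr_of_isOpen {f g : V4 → X} {D : Set V4} (hD : IsOpen D) {p : V4} (hp : p ∈ D)
    (h : ∀ q ∈ D, f q = g q) (a : Fin 4) : pd a f p = pd a g p :=
  pd_congr (Filter.eventuallyEq_of_mem (hD.mem_nhds hp) h) a

theorem pd_comm {f : V4 → X} {p : V4} (hf : ContDiffAt ℝ ∞ f p) (a b : Fin 4) :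
    pd a (fun q => pd b f q) p = pd b (fun q => pd a f q) p := by
  have h1 : ∀ v w : V4, fderiv ℝ (fun q => fderiv ℝ f q v) p w = fderiv ℝ (fderiv ℝ f) p w v := by
    intro v w
    rw [fderiv_clm_apply (SmoothAt.diff (hf.fderiv_right (m := ∞) (by simp)))
      (differentiableAt_const v)]
    simp
  have := hf.isSymmSndFDerivAt two_le_infty
  simp only [pd, h1]
  exact this.eq _ _

theorem pd_add {f g : V4 → X} {p : V4} (hf : DifferentiableAt ℝ f p)
    (hg : DifferentiableAt ℝ g p) (a : Fin 4) :
    pd a (fun q => f q + g q) p = pd a f p + pd a g p := by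
  simp [pd, fderiv_fun_add hf hg]

theorem pd_sub {f g : V4 → X} {p : V4} (hf : DifferentiableAt ℝ f p)
    (hg : DifferentiableAt ℝ g p) (a : Fin 4) :
    pd a (fun q => f q - g q) p = pd a f p - pd a g p := by
  simp [pd, fderiv_fun_sub hf hg]

theorem pd_sum {ι : Type*} {s : Finset ι} {f : ι → V4 → X} {p : V4}
    (hf : ∀ i ∈ s, DifferentiableAt ℝ (f i) p) (a : Fin 4) :
    pd a (fun q => ∑ i ∈ s, f i q) p = ∑ i ∈ s, pd a (f i) p := by
  simp [pd, fderiv_fun_sum hf]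

theorem pd_smul {f : V4 → ℝ} {g : V4 → X} {p : V4} (hf : DifferentiableAt ℝ f p)
    (hg : DifferentiableAt ℝ g p) (a : Fin 4) :
    pd a (fun q => f q • g q) p = pd a f p • g p + f p • pd a g p := by
  simp [pd, fderiv_fun_smul hf hg, add_comm]

theorem pd_mul {f g : V4 → ℝ} {p : V4} (hf : DifferentiableAt ℝ f p)
    (hg : DifferentiableAt ℝ g p) (a : Fin 4) :
    pd a (fun q => f q * g q) p = pd a f p * g p + f p * pd a g p := by
  simpa using pd_smul hf hg a

theorem pd_const_mul {f : V4 → ℝ} {p : V4} (hf : DifferentiableAt ℝ f p) (r : ℝ) (a : Fin 4) :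
    pd a (fun q => r * f q) p = r * pd a f p := by
  simp [pd, fderiv_const_mul hf]

theorem pd_const_smul {f : V4 → X} {p : V4} (r : ℝ) (hf : DifferentiableAt ℝ f p) (a : Fin 4) :
    pd a (fun q => r • f q) p = r • pd a f p := by
  simp [pd, fderiv_fun_const_smul hf]

theorem pd_clm (T : X →L[ℝ] Y) {f : V4 → X} {p : V4} (hf : DifferentiableAt ℝ f p) (a : Fin 4) :
    pd a (fun q => T (f q)) p = T (pd a f p) := by
  have := (T.hasFDerivAt.comp p hf.hasFDerivAt).fderiv
  simp only [pd]
  rw [show (fun q => T (f q)) = T ∘ f from rfl, this]; rfl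

theorem pd_apply {ι : Type*} [Fintype ι] {F : ι → Type*} [∀ i, NormedAddCommGroup (F i)]
    [∀ i, NormedSpace ℝ (F i)] {f : V4 → ∀ i, F i} {p : V4} (hf : DifferentiableAt ℝ f p)
    (a : Fin 4) (i : ι) : pd a (fun q => f q i) p = pd a f p i :=
  pd_clm (ContinuousLinearMap.proj i) hf a

theorem pd_zero (a : Fin 4) (p : V4) : pd a (fun _ : V4 => (0 : X)) p = 0 := by
  simp [pd]

/-- The integral of a partial derivative of a compactly supported function vanishes. -/
theorem integral_pd_eq_zero {f : V4 → ℝ} (hf : ContDiff ℝ ∞ f) (hc : HasCompactSupport f)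
    (a : Fin 4) : ∫ p, pd a f p = 0 := by
  have hcont : Continuous (fun p => fderiv ℝ f p (stdVec a)) :=
    (hf.continuous_fderiv (by simp)).clm_apply continuous_const
  -- Integration by parts against the constant function 1: only the products have to be integrable,
  -- and these have compact support.
  have h := integral_mul_fderiv_eq_neg_fderiv_mul_of_integrable (𝕜 := ℝ) (μ := (volume : Measure V4))
    (f := fun _ : V4 => (1 : ℝ)) (g := f) (v := stdVec a) (by simp)
    (by
      simp only [one_mul]
      exact hcont.integrable_of_hasCompactSupport (hc.fderiv_apply ℝ _))
    (by simpa using hf.continuous.integrable_of_hasCompactSupport hc)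
    (fun x _ => differentiableAt_const _) (fun x _ => hf.differentiable (by simp) x)
  simpa [pd] using h

/-- A function which is smooth on an open set containing its closed support is smooth. -/
theorem contDiff_of_tsupport_subset {f : V4 → X} {D : Set V4}
    (hf : ∀ p ∈ D, ContDiffAt ℝ ∞ f p) (hs : tsupport f ⊆ D) : ContDiff ℝ ∞ f :=
  contDiff_iff_contDiffAt.2 fun x => by
    by_cases hx : x ∈ tsupport f
    · exact hf x (hs hx)
    · exact contDiffAt_const.congr_of_eventuallyEq (notMem_tsupport_iff_eventuallyEq.1 hx)

theorem tsupport_subset_of_eq_zero {X Z : Type*} [Zero X] [Zero Z] {f : V4 → X} {g : V4 → Z}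
    (h : ∀ p, p ∉ tsupport g → f p = 0) : tsupport f ⊆ tsupport g :=
  closure_minimal (fun p hp => by by_contra hn; exact hp (h p hn)) (isClosed_tsupport g)

theorem hasCompactSupport_of_eq_zero {X Z : Type*} [Zero X] [Zero Z] {f : V4 → X} {g : V4 → Z}
    (hg : HasCompactSupport g) (h : ∀ p, p ∉ tsupport g → f p = 0) : HasCompactSupport f :=
  HasCompactSupport.of_support_subset_isCompact hg
    (fun p hp => by by_contra hn; exact hp (h p hn))

theorem integrable_of_smooth {Z : Type*} [Zero Z] {f : V4 → ℝ} {g : V4 → Z} {D : Set V4}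
    (hf : ∀ p ∈ D, ContDiffAt ℝ ∞ f p) (hg : HasCompactSupport g) (hgD : tsupport g ⊆ D)
    (h : ∀ p, p ∉ tsupport g → f p = 0) : Integrable f :=
  (contDiff_of_tsupport_subset hf
    ((tsupport_subset_of_eq_zero h).trans hgD)).continuous.integrable_of_hasCompactSupport
    (hasCompactSupport_of_eq_zero hg h)

theorem eventually_eq_zero_of_notMem_tsupport {Z : Type*} [Zero Z] {g : V4 → Z} {p : V4}
    (hp : p ∉ tsupport g) : g =ᶠ[nhds p] fun _ => 0 :=
  notMem_tsupport_iff_eventuallyEq.1 hp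

theorem pd_eq_zero_of_notMem_tsupport {f : V4 → X} {p : V4} (hp : p ∉ tsupport f) (a : Fin 4) :
    pd a f p = 0 := by
  rw [pd_congr (eventually_eq_zero_of_notMem_tsupport hp), pd_zero]

theorem hasDerivAt_line {f : X → Y} {x : X} (hf : DifferentiableAt ℝ f x) (v : X) :
    HasDerivAt (fun ε : ℝ => f (x + ε • v)) (fderiv ℝ f x v) 0 := by
  have := hf.hasFDerivAt.hasLineDerivAt v
  exact this

end Calculus

/-! ### Derivatives of the inverse metric and of the volume density -/

section Metric

theorem contDiff_matrix_det {m : Type*} [Fintype m] [DecidableEq m] :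
    ContDiff ℝ ∞ (fun G : m → m → ℝ => (Matrix.of G).det) := by
  simp only [Matrix.det_apply, Matrix.of_apply]
  fun_prop

theorem contDiff_adjugate (a b : Fin 4) :
    ContDiff ℝ ∞ (fun G : Fin 4 → Fin 4 → ℝ => (Matrix.of G).adjugate a b) := by
  simp only [Matrix.adjugate_apply, Matrix.det_apply, Matrix.updateRow_apply, Matrix.of_apply]
  refine ContDiff.sum fun σ _ => ContDiff.const_smul _ (contDiff_prod fun i _ => ?_)
  split_ifs
  · exact contDiff_const
  · fun_prop

/-- Cramer's rule: the entries of the inverse are polynomials divided by the non-vanishing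
determinant. -/
theorem contDiffAt_invMetric {G : Fin 4 → Fin 4 → ℝ} (hG : (Matrix.of G).det ≠ 0) :
    ContDiffAt ℝ ∞ invMetric G := by
  rw [contDiffAt_pi]; intro a
  rw [contDiffAt_pi]; intro b
  have : (fun G : Fin 4 → Fin 4 → ℝ => invMetric G a b) =
      fun G => ((Matrix.of G).det)⁻¹ * (Matrix.of G).adjugate a b := by
    funext G; simp [invMetric, Matrix.inv_def]
  rw [this]
  exact (contDiff_matrix_det.contDiffAt.inv hG).mul (contDiff_adjugate a b).contDiffAt

theorem contDiffAt_volDensity {G : Fin 4 → Fin 4 → ℝ} (hG : (Matrix.of G).det ≠ 0) :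
    ContDiffAt ℝ ∞ volDensity G := by
  have h1 : ContDiffAt ℝ ∞ (fun G : Fin 4 → Fin 4 → ℝ => |(Matrix.of G).det|) G :=
    (contDiffAt_abs hG).comp G contDiff_matrix_det.contDiffAt
  exact h1.sqrt (by simpa using hG)

theorem volDensity_pos {G : Fin 4 → Fin 4 → ℝ} (hG : (Matrix.of G).det ≠ 0) : 0 < volDensity G :=
  Real.sqrt_pos.2 (abs_pos.2 hG)

theorem mul_invMetric {G : Fin 4 → Fin 4 → ℝ} (hG : (Matrix.of G).det ≠ 0) (a c : Fin 4) :
    ∑ b, G a b * invMetric G b c = if a = c then 1 else 0 := by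
  have := congrFun (congrFun (Matrix.mul_nonsing_inv (Matrix.of G) (isUnit_iff_ne_zero.2 hG)) a) c
  simpa [Matrix.mul_apply, Matrix.one_apply, invMetric] using this

theorem invMetric_mul {G : Fin 4 → Fin 4 → ℝ} (hG : (Matrix.of G).det ≠ 0) (a c : Fin 4) :
    ∑ b, invMetric G a b * G b c = if a = c then 1 else 0 := by
  have := congrFun (congrFun (Matrix.nonsing_inv_mul (Matrix.of G) (isUnit_iff_ne_zero.2 hG)) a) c
  simpa [Matrix.mul_apply, Matrix.one_apply, invMetric] using this

theorem invMetric_symm {G : Fin 4 → Fin 4 → ℝ} (hs : ∀ a b, G a b = G b a) (a b : Fin 4) :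
    invMetric G a b = invMetric G b a := by
  have h : (Matrix.of G).transpose = Matrix.of G := by ext i j; exact hs j i
  have := congrFun (congrFun (Matrix.transpose_nonsing_inv (Matrix.of G)) b) a
  rw [h] at this
  exact this

theorem eventually_det_ne_zero {G : Fin 4 → Fin 4 → ℝ} (hG : (Matrix.of G).det ≠ 0) :
    ∀ᶠ G' in nhds G, (Matrix.of G').det ≠ 0 :=
  (contDiff_matrix_det.continuous.continuousAt (x := G)).eventually_ne hG

/-- Differentiating G G⁻¹ = 1 along the line G + ε h, which consists of invertible matrices for
small ε, gives h G⁻¹ + G d = 0; multiplication by G⁻¹ on the left isolates d. -/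
theorem fderiv_invMetric {G : Fin 4 → Fin 4 → ℝ} (hG : (Matrix.of G).det ≠ 0)
    (h : Fin 4 → Fin 4 → ℝ) (a b : Fin 4) :
    fderiv ℝ invMetric G h a b
      = -∑ c, ∑ d, invMetric G a c * h c d * invMetric G d b := by
  set d := fderiv ℝ invMetric G h with hd
  have hl := hasDerivAt_line (SmoothAt.diff (contDiffAt_invMetric hG)) h
  have hl' : ∀ a b, HasDerivAt (fun ε : ℝ => invMetric (G + ε • h) a b) (d a b) 0 := fun a b =>
    (hasDerivAt_pi.1 ((hasDerivAt_pi.1 hl) a)) b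
  have key : ∀ x y, ∑ z, (h x z * invMetric G z y + G x z * d z y) = 0 := by
    intro x y
    have h1 : HasDerivAt (fun ε : ℝ => ∑ z, (G x z + ε * h x z) * invMetric (G + ε • h) z y)
        (∑ z, (h x z * invMetric G z y + G x z * d z y)) 0 := by
      refine HasDerivAt.fun_sum fun z _ => ?_
      have h2 : HasDerivAt (fun ε : ℝ => G x z + ε * h x z) (h x z) 0 := by
        simpa using ((hasDerivAt_id (0 : ℝ)).mul_const (h x z)).const_add (G x z)
      have h3 := h2.mul (hl' z y)
      simp only [zero_mul, add_zero, zero_smul] at h3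
      exact h3
    have h3 : (fun ε : ℝ => ∑ z, (G x z + ε * h x z) * invMetric (G + ε • h) z y)
        =ᶠ[nhds 0] fun _ => if x = y then 1 else 0 := by
      have hc : Filter.Tendsto (fun ε : ℝ => G + ε • h) (nhds 0) (nhds G) := by
        have : ContinuousAt (fun ε : ℝ => G + ε • h) 0 := by fun_prop
        simpa [ContinuousAt] using this
      filter_upwards [hc.eventually (eventually_det_ne_zero hG)] with ε hε
      simpa using mul_invMetric hε x y
    exact h1.unique ((hasDerivAt_const _ _).congr_of_eventuallyEq h3)
  have hm : Matrix.of h * (Matrix.of G)⁻¹ + Matrix.of G * Matrix.of d = 0 := by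
    ext x y
    have := key x y
    rw [Finset.sum_add_distrib] at this
    simpa [Matrix.mul_apply, invMetric] using this
  have hm2 : Matrix.of d = -((Matrix.of G)⁻¹ * Matrix.of h * (Matrix.of G)⁻¹) := by
    have := congrArg (fun Z => (Matrix.of G)⁻¹ * Z) hm
    simp only [Matrix.mul_add, Matrix.mul_zero] at this
    rw [← Matrix.mul_assoc (Matrix.of G)⁻¹ (Matrix.of G),
      Matrix.nonsing_inv_mul _ (isUnit_iff_ne_zero.2 hG), Matrix.one_mul] at this
    rw [eq_neg_iff_add_eq_zero, add_comm, Matrix.mul_assoc]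
    exact this
  have := congrFun (congrFun hm2 a) b
  simp only [Matrix.of_apply, Matrix.neg_apply, Matrix.mul_apply, Finset.sum_mul] at this
  rw [this, Finset.sum_comm]
  rfl

/-- Jacobi's formula: det (G + ε h) = det G · det (1 + ε G⁻¹h), and the linear coefficient of the
second factor is a trace. -/
theorem fderiv_det {G : Fin 4 → Fin 4 → ℝ} (hG : (Matrix.of G).det ≠ 0)
    (h : Fin 4 → Fin 4 → ℝ) :
    fderiv ℝ (fun G : Fin 4 → Fin 4 → ℝ => (Matrix.of G).det) G h
      = (Matrix.of G).det * ∑ a, ∑ b, invMetric G a b * h b a := by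
  have h1 := hasDerivAt_line (SmoothAt.diff (contDiff_matrix_det.contDiffAt (x := G))) h
  have h2 : (fun ε : ℝ => (Matrix.of (G + ε • h)).det) = fun ε => (Matrix.of G).det *
      (1 + ε • ((Matrix.of G)⁻¹ * Matrix.of h)).det := by
    funext ε
    rw [← Matrix.det_mul, Matrix.mul_add, Matrix.mul_one, Matrix.mul_smul, ← Matrix.mul_assoc,
      Matrix.mul_nonsing_inv _ (isUnit_iff_ne_zero.2 hG), Matrix.one_mul]
    rfl
  have h3 : HasDerivAt (fun ε : ℝ => (1 + ε • ((Matrix.of G)⁻¹ * Matrix.of h)).det)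
      ((Matrix.of G)⁻¹ * Matrix.of h).trace 0 := by
    -- The determinant is 1 + ε · trace plus ε² times a polynomial in ε; the last summand has zero
    -- derivative at 0.
    have he : (fun ε : ℝ => (1 + ε • ((Matrix.of G)⁻¹ * Matrix.of h)).det) = _ :=
      funext fun ε => Matrix.det_one_add_smul ε _
    rw [he]
    have ha : HasDerivAt (fun ε : ℝ => 1 + ((Matrix.of G)⁻¹ * Matrix.of h).trace * ε)
        ((Matrix.of G)⁻¹ * Matrix.of h).trace 0 := by
      simpa using ((hasDerivAt_id (0 : ℝ)).const_mul _).const_add 1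
    have hb := (Polynomial.hasDerivAt
      (1 + (Polynomial.X : Polynomial ℝ) •
        ((Matrix.of G)⁻¹ * Matrix.of h).map (Polynomial.C : ℝ →+* Polynomial ℝ)).det.divX.divX
      (0 : ℝ)).mul (hasDerivAt_pow 2 (0 : ℝ))
    exact (ha.add hb).congr_deriv (by simp)
  rw [h2] at h1
  rw [h1.unique (h3.const_mul _)]
  simp [Matrix.trace, Matrix.mul_apply, invMetric]

/-- Differentiating the square of the density, which is |det G|, and dividing by the positive
density avoids fixing the sign of the determinant. -/
theorem fderiv_volDensity {G : Fin 4 → Fin 4 → ℝ} (hG : (Matrix.of G).det ≠ 0)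
    (h : Fin 4 → Fin 4 → ℝ) :
    fderiv ℝ volDensity G h
      = (1 / 2) * (∑ a, ∑ b, invMetric G a b * h b a) * volDensity G := by
  have hv := hasDerivAt_line (SmoothAt.diff (contDiffAt_volDensity hG)) h
  have hd := hasDerivAt_line (SmoothAt.diff (contDiff_matrix_det.contDiffAt (x := G))) h
  rw [fderiv_det hG] at hd
  have h2 : (fun ε : ℝ => volDensity (G + ε • h) * volDensity (G + ε • h)) =
      fun ε : ℝ => |(Matrix.of (G + ε • h)).det| := by
    funext ε; exact Real.mul_self_sqrt (abs_nonneg _)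
  have h3 := hv.mul hv
  have hd0 : (Matrix.of (G + (0 : ℝ) • h)).det ≠ 0 := by simpa using hG
  have h4 := (hasDerivAt_abs hd0).comp (0 : ℝ) hd
  have h5 := h3.unique (h4.congr_of_eventuallyEq (Filter.Eventually.of_forall fun ε =>
    congrFun h2 ε))
  simp only [zero_smul, add_zero] at h5
  have hs : (SignType.sign (Matrix.of G).det : ℝ) * (Matrix.of G).det
      = volDensity G * volDensity G := by
    rw [sign_mul_self]; exact (Real.mul_self_sqrt (abs_nonneg _)).symm
  rw [← mul_assoc, hs] at h5
  have hp := volDensity_pos hG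
  have : volDensity G * (2 * fderiv ℝ volDensity G h) = volDensity G *
      ((∑ a, ∑ b, invMetric G a b * h b a) * volDensity G) := by linarith
  have := mul_left_cancel₀ hp.ne' this
  linarith

end Metric

/-! ### Lorentzian forms -/

section Lorentz

theorem minkowski_transpose : (Matrix.of minkowski).transpose = Matrix.of minkowski := by
  ext i j; fin_cases i <;> fin_cases j <;> simp [minkowski]

theorem minkowski_mul_self : Matrix.of minkowski * Matrix.of minkowski = 1 := by
  ext i j
  fin_cases i <;> fin_cases j <;> simp [minkowski, Matrix.mul_apply]

theorem IsLorentz.det_ne_zero {G : Fin 4 → Fin 4 → ℝ} (hG : IsLorentz G) :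
    (Matrix.of G).det ≠ 0 := by
  obtain ⟨P, hP, σ, hσ, h⟩ := hG
  intro h0
  have hm : (Matrix.of minkowski).det * (Matrix.of minkowski).det = 1 := by
    rw [← Matrix.det_mul, minkowski_mul_self, Matrix.det_one]
  have := congrArg Matrix.det h
  rw [Matrix.det_mul, Matrix.det_mul, h0, Matrix.det_smul] at this
  have h2 : (0 : ℝ) = σ ^ 4 * (Matrix.of minkowski).det := by simpa using this
  rcases hσ with rfl | rfl <;>
    · have h3 : (Matrix.of minkowski).det = 0 := by linarith
      rw [h3] at hm
      norm_num at hm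

theorem IsLorentz.symm {G : Fin 4 → Fin 4 → ℝ} (hG : IsLorentz G) (a b : Fin 4) :
    G a b = G b a := by
  obtain ⟨P, hP, σ, hσ, h⟩ := hG
  have e : Matrix.of G = P⁻¹.transpose * (σ • Matrix.of minkowski) * P⁻¹ := by
    rw [← h, Matrix.transpose_nonsing_inv, Matrix.mul_assoc, Matrix.mul_assoc, Matrix.mul_assoc,
      Matrix.mul_nonsing_inv _ hP, Matrix.mul_one, ← Matrix.mul_assoc,
      Matrix.nonsing_inv_mul _ (by simpa using hP), Matrix.one_mul]
  have ht : (Matrix.of G).transpose = Matrix.of G := by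
    rw [e]
    simp only [Matrix.transpose_mul, Matrix.transpose_transpose, Matrix.transpose_smul,
      minkowski_transpose, Matrix.mul_assoc]
  exact (congrFun (congrFun ht b) a)

/-- The map `(A, B) ↦ Aᵀ η A + B - Bᵀ`. -/
def congrMap (x : (Fin 4 → Fin 4 → ℝ) × (Fin 4 → Fin 4 → ℝ)) : Fin 4 → Fin 4 → ℝ :=
  fun a b => ((Matrix.of x.1).transpose * Matrix.of minkowski * Matrix.of x.1) a b
    + (x.2 a b - x.2 b a)

theorem contDiff_congrMap : ContDiff ℝ ∞ congrMap := by
  refine contDiff_pi.2 fun a => contDiff_pi.2 fun b => ?_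
  simp only [congrMap, Matrix.mul_apply, Matrix.transpose_apply, Matrix.of_apply]
  fun_prop

theorem congrMap_one :
    congrMap ((1 : Matrix (Fin 4) (Fin 4) ℝ), 0) = minkowski := by
  funext a b
  have h1 : Matrix.of (1 : Matrix (Fin 4) (Fin 4) ℝ) = 1 := rfl
  simp [congrMap, h1]

/-- The derivative at (1, 0) is (H, B) ↦ Hᵀη + ηH + B - Bᵀ. Since η² = 1, the symmetric part S of
the target is reached by H = ½ηS and the antisymmetric part by B = ½K. The summand B - Bᵀ is there
to make the map a submersion onto all arrays, not merely onto the symmetric ones. -/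
theorem range_fderiv_congrMap :
    (fderiv ℝ congrMap ((1 : Matrix (Fin 4) (Fin 4) ℝ), 0)).range = ⊤ := by
  rw [LinearMap.range_eq_top]
  intro K
  let S : Matrix (Fin 4) (Fin 4) ℝ :=
    (1 / 2 : ℝ) • (Matrix.of K + (Matrix.of K).transpose)
  have hS : S.transpose = S := by
    rw [Matrix.transpose_smul, Matrix.transpose_add, Matrix.transpose_transpose, add_comm]
  let H : Matrix (Fin 4) (Fin 4) ℝ := (1 / 2 : ℝ) • (Matrix.of minkowski * S)
  let B : Fin 4 → Fin 4 → ℝ := (1 / 2 : ℝ) • K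
  refine ⟨(H, B), ?_⟩
  have h1 := hasDerivAt_line (SmoothAt.diff (contDiff_congrMap.contDiffAt
    (x := (((1 : Matrix (Fin 4) (Fin 4) ℝ), 0) : (Fin 4 → Fin 4 → ℝ) × (Fin 4 → Fin 4 → ℝ)))))
    ((H, B) : (Fin 4 → Fin 4 → ℝ) × (Fin 4 → Fin 4 → ℝ))
  have hHt : H.transpose * Matrix.of minkowski = (1 / 2 : ℝ) • S := by
    simp only [H, Matrix.transpose_smul, Matrix.transpose_mul, minkowski_transpose, hS,
      Matrix.smul_mul, Matrix.mul_assoc, minkowski_mul_self, Matrix.mul_one]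
  have hH : Matrix.of minkowski * H = (1 / 2 : ℝ) • S := by
    simp only [H, Matrix.mul_smul, ← Matrix.mul_assoc, minkowski_mul_self, Matrix.one_mul]
  have h2 : HasDerivAt (fun ε : ℝ => congrMap ((((1 : Matrix (Fin 4) (Fin 4) ℝ), 0) :
      (Fin 4 → Fin 4 → ℝ) × (Fin 4 → Fin 4 → ℝ)) + ε • ((H, B) : (Fin 4 → Fin 4 → ℝ) × _)))
      K 0 := by
    have he : ∀ (ε : ℝ) a b, congrMap ((((1 : Matrix (Fin 4) (Fin 4) ℝ), 0) :
      (Fin 4 → Fin 4 → ℝ) × (Fin 4 → Fin 4 → ℝ)) + ε • ((H, B) : (Fin 4 → Fin 4 → ℝ) × _)) a b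
        = minkowski a b + ε * K a b
          + ε ^ 2 * (H.transpose * Matrix.of minkowski * H) a b := by
      intro ε a b
      have hx : Matrix.of ((((1 : Matrix (Fin 4) (Fin 4) ℝ), 0) :
        (Fin 4 → Fin 4 → ℝ) × (Fin 4 → Fin 4 → ℝ)) + ε • ((H, B) : (Fin 4 → Fin 4 → ℝ) × _)).1
          = 1 + ε • H := rfl
      have hm : (1 + ε • H).transpose * Matrix.of minkowski * (1 + ε • H)
          = Matrix.of minkowski + ε • S + ε ^ 2 • (H.transpose * Matrix.of minkowski * H) := by
        simp only [Matrix.transpose_add, Matrix.transpose_one, Matrix.transpose_smul,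
          Matrix.add_mul, Matrix.one_mul, Matrix.mul_add, Matrix.mul_one, Matrix.smul_mul,
          Matrix.mul_smul, hHt, hH]
        module
      simp only [congrMap]
      rw [hx, hm]
      simp [S, B]
      ring
    refine hasDerivAt_pi.2 fun a => hasDerivAt_pi.2 fun b => ?_
    simp only [he]
    have h3 := (((hasDerivAt_id (0 : ℝ)).mul_const (K a b)).const_add (minkowski a b)).add
      ((hasDerivAt_pow 2 (0 : ℝ)).mul_const ((H.transpose * Matrix.of minkowski * H) a b))
    exact h3.congr_deriv (by simp)
  exact h1.unique h2

/-- The map `T`, congruence by `P` followed by multiplication by σ, carries G₀ to η. As `congrMap`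
is a submersion at (1, 0), every array near η is AᵀηA plus an antisymmetric one, with A invertible.
For a symmetric array the antisymmetric summand drops out, so it is congruent to η. -/
theorem eventually_isLorentz {G₀ : Fin 4 → Fin 4 → ℝ} (h₀ : IsLorentz G₀) :
    ∀ᶠ G in nhds G₀, (∀ a b, G a b = G b a) → IsLorentz G := by
  obtain ⟨P, hP, σ, hσ, h⟩ := h₀
  have hσ2 : σ * σ = 1 := by rcases hσ with rfl | rfl <;> norm_num
  have hst : HasStrictFDerivAt congrMap (fderiv ℝ congrMap ((1 : Matrix (Fin 4) (Fin 4) ℝ), 0))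
      ((1 : Matrix (Fin 4) (Fin 4) ℝ), 0) :=
    contDiff_congrMap.contDiffAt.hasStrictFDerivAt (by simp)
  have hmap := hst.map_nhds_eq_of_surj range_fderiv_congrMap
  rw [congrMap_one] at hmap
  have hdet : {x : (Fin 4 → Fin 4 → ℝ) × (Fin 4 → Fin 4 → ℝ) | (Matrix.of x.1).det ≠ 0} ∈
      nhds ((((1 : Matrix (Fin 4) (Fin 4) ℝ), 0)) : (Fin 4 → Fin 4 → ℝ) × _) := by
    have hc : ContinuousAt (fun x : (Fin 4 → Fin 4 → ℝ) × (Fin 4 → Fin 4 → ℝ) =>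
        (Matrix.of x.1).det) ((1 : Matrix (Fin 4) (Fin 4) ℝ), 0) :=
      (contDiff_matrix_det.continuous.comp continuous_fst).continuousAt
    refine hc.eventually_ne ?_
    change (1 : Matrix (Fin 4) (Fin 4) ℝ).det ≠ 0
    simp
  have him := Filter.image_mem_map (m := congrMap) hdet
  rw [hmap] at him
  let T : (Fin 4 → Fin 4 → ℝ) → (Fin 4 → Fin 4 → ℝ) := fun G a b =>
    σ * (P.transpose * Matrix.of G * P) a b
  have hT : Continuous T := by
    refine continuous_pi fun a => continuous_pi fun b => ?_
    simp only [T, Matrix.mul_apply, Matrix.transpose_apply, Matrix.of_apply]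
    fun_prop
  have hT0 : T G₀ = minkowski := by
    funext a b
    simp only [T, h, Matrix.smul_apply, smul_eq_mul, ← mul_assoc, hσ2, one_mul, Matrix.of_apply]
  have hev := hT.continuousAt (x := G₀)
  rw [ContinuousAt, hT0] at hev
  filter_upwards [hev.eventually him] with G hG hs
  obtain ⟨⟨A, B⟩, hA, hAB⟩ := hG
  have hA' : IsUnit (Matrix.of A).det := isUnit_iff_ne_zero.2 hA
  have hGt : (Matrix.of G).transpose = Matrix.of G := by ext i j; exact hs j i
  have hTt : ∀ a b, T G a b = T G b a := by
    intro a b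
    have : (P.transpose * Matrix.of G * P).transpose = P.transpose * Matrix.of G * P := by
      simp [Matrix.transpose_mul, hGt, Matrix.mul_assoc]
    simp only [T]
    conv_lhs => rw [← this, Matrix.transpose_apply]
  have hAt : ((Matrix.of A).transpose * Matrix.of minkowski * Matrix.of A).transpose
      = (Matrix.of A).transpose * Matrix.of minkowski * Matrix.of A := by
    simp [Matrix.transpose_mul, minkowski_transpose, Matrix.mul_assoc]
  -- Averaging the (a, b) and (b, a) entries removes B - Bᵀ.
  have e1 : σ • (P.transpose * Matrix.of G * P)
      = (Matrix.of A).transpose * Matrix.of minkowski * Matrix.of A := by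
    ext a b
    have h1 := congrFun (congrFun hAB a) b
    have h2 := congrFun (congrFun hAB b) a
    have h3 := hTt a b
    have h4 := congrFun (congrFun hAt b) a
    simp only [congrMap] at h1 h2
    rw [Matrix.transpose_apply] at h4
    change T G a b = _
    linarith
  have e2 : P.transpose * Matrix.of G * P
      = σ • ((Matrix.of A).transpose * Matrix.of minkowski * Matrix.of A) := by
    rw [← e1, smul_smul, hσ2, one_smul]
  refine ⟨P * (Matrix.of A)⁻¹, ?_, σ, hσ, ?_⟩
  · rw [Matrix.det_mul]
    exact hP.mul (by simpa using hA')
  · rw [Matrix.transpose_mul]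
    calc (Matrix.of A)⁻¹.transpose * P.transpose * Matrix.of G * (P * (Matrix.of A)⁻¹)
        = (Matrix.of A)⁻¹.transpose * (P.transpose * Matrix.of G * P) * (Matrix.of A)⁻¹ := by
          simp only [Matrix.mul_assoc]
      _ = σ • (((Matrix.of A)⁻¹.transpose * (Matrix.of A).transpose) * Matrix.of minkowski *
            (Matrix.of A * (Matrix.of A)⁻¹)) := by
          rw [e2]; simp only [Matrix.mul_assoc, Matrix.smul_mul, Matrix.mul_smul]
      _ = σ • Matrix.of minkowski := by
          rw [← Matrix.transpose_mul, Matrix.mul_nonsing_inv _ hA']; simp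

end Lorentz

/-! ### Infinitesimal representations -/

section Representation

/-- The endomorphism of the coordinate space with a given matrix. -/
noncomputable def matEnd (m : Fin 4 → Fin 4 → ℝ) : V4 →L[ℝ] V4 :=
  ∑ c, ∑ b, m c b • elemEnd c b

theorem elemEnd_apply (c b : Fin 4) (v : V4) : elemEnd c b v = v b • stdVec c := rfl

theorem stdVec_apply (a b : Fin 4) : stdVec a b = if b = a then 1 else 0 := by
  simp [stdVec]

theorem matEnd_apply (m : Fin 4 → Fin 4 → ℝ) (v : V4) (c : Fin 4) :
    matEnd m v c = ∑ b, m c b * v b := by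
  simp only [matEnd, sum_apply, smul_apply, elemEnd_apply]
  simp [stdVec_apply, Finset.sum_ite_eq]

theorem matEnd_stdVec (m : Fin 4 → Fin 4 → ℝ) (a c : Fin 4) : matEnd m (stdVec a) c = m c a := by
  simp [matEnd_apply, stdVec_apply]

theorem matEnd_comp (m m' : Fin 4 → Fin 4 → ℝ) :
    (matEnd m).comp (matEnd m') = matEnd (fun c b => ∑ d, m c d * m' d b) := by
  ext v c
  simp only [ContinuousLinearMap.comp_apply, matEnd_apply, Finset.mul_sum, Finset.sum_mul]
  rw [Finset.sum_comm]
  simp only [mul_assoc]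

variable {W : Type*} [NormedAddCommGroup W] [NormedSpace ℝ W] (ρ : TensorType W)

/-- The infinitesimal action of a matrix on the components of the tensors of type `ρ`. -/
noncomputable def TensorType.act (m : Fin 4 → Fin 4 → ℝ) : W →L[ℝ] W := ρ.inf (matEnd m)

theorem TensorType.act_eq_sum (m : Fin 4 → Fin 4 → ℝ) :
    ρ.act m = ∑ c, ∑ b, m c b • ρ.inf (elemEnd c b) := by
  simp [act, inf, matEnd, map_sum, map_smul]

theorem TensorType.act_apply (m : Fin 4 → Fin 4 → ℝ) (w : W) :
    ρ.act m w = ∑ c, ∑ b, m c b • ρ.inf (elemEnd c b) w := by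
  simp [act_eq_sum]

theorem eventually_invertible (B : V4 ≃L[ℝ] V4) :
    ∀ᶠ A in nhds (B : V4 →L[ℝ] V4), ∃ C : V4 ≃L[ℝ] V4, (C : V4 →L[ℝ] V4) = A :=
  ContinuousLinearEquiv.nhds B

/-- The representation is smooth only within the invertible maps; these form an open set, so it is
differentiable at the identity in the full sense. -/
theorem TensorType.hasFDerivAt_one :
    HasFDerivAt ρ.toFun (fderiv ℝ ρ.toFun (ContinuousLinearMap.id ℝ V4))
      (ContinuousLinearMap.id ℝ V4) := by
  refine DifferentiableAt.hasFDerivAt ?_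
  refine ((ρ.smooth _ ⟨ContinuousLinearEquiv.refl ℝ V4, rfl⟩).contDiffAt ?_).differentiableAt
    (by simp)
  exact eventually_invertible (ContinuousLinearEquiv.refl ℝ V4)

theorem TensorType.hasDerivAt_line (X : V4 →L[ℝ] V4) :
    HasDerivAt (fun t : ℝ => ρ.toFun (ContinuousLinearMap.id ℝ V4 + t • X)) (ρ.inf X) 0 :=
  CovariantFields.hasDerivAt_line ρ.hasFDerivAt_one.differentiableAt X

theorem id_add_zero_smul (X : V4 →L[ℝ] V4) :
    ContinuousLinearMap.id ℝ V4 + (0 : ℝ) • X = ContinuousLinearMap.id ℝ V4 := by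
  ext v; simp

theorem eventually_line_invertible (X : V4 →L[ℝ] V4) :
    ∀ᶠ t : ℝ in nhds 0, ∃ C : V4 ≃L[ℝ] V4,
      (C : V4 →L[ℝ] V4) = ContinuousLinearMap.id ℝ V4 + t • X := by
  have hc : ContinuousAt (fun t : ℝ => ContinuousLinearMap.id ℝ V4 + t • X) 0 := by fun_prop
  have : Filter.Tendsto (fun t : ℝ => ContinuousLinearMap.id ℝ V4 + t • X) (nhds 0)
      (nhds ((ContinuousLinearEquiv.refl ℝ V4 : V4 ≃L[ℝ] V4) : V4 →L[ℝ] V4)) := by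
    rw [ContinuousAt, id_add_zero_smul] at hc
    exact hc
  exact this.eventually (eventually_invertible _)

theorem hasDerivAt_ringInverse_line {R : Type*} [NormedRing R] [HasSummableGeomSeries R]
    [NormedAlgebra ℝ R] (X : R) :
    HasDerivAt (fun t : ℝ => Ring.inverse ((1 : R) + t • X)) (-X) 0 := by
  have h1 : HasDerivAt (fun t : ℝ => Ring.inverse (((1 : Rˣ) : R) + t • X)) _ 0 :=
    (hasFDerivAt_ringInverse (𝕜 := ℝ) (R := R) 1).hasLineDerivAt X
  refine h1.congr_deriv ?_
  change -(((1⁻¹ : Rˣ) : R) * X * ((1⁻¹ : Rˣ) : R)) = -X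
  rw [inv_one, Units.val_one, one_mul, mul_one]

theorem hasDerivAt_inverse_line (X : V4 →L[ℝ] V4) :
    HasDerivAt (fun t : ℝ => (ContinuousLinearMap.id ℝ V4 + t • X).inverse) (-X) 0 := by
  have h2 : (fun t : ℝ => (ContinuousLinearMap.id ℝ V4 + t • X).inverse)
      = fun t : ℝ => Ring.inverse ((1 : V4 →L[ℝ] V4) + t • X) := by
    funext t; rw [ContinuousLinearMap.ringInverse_eq_inverse]; rfl
  rw [h2]
  exact hasDerivAt_ringInverse_line X

/-- Derivative at t = 0 of ρ(B(1 + tY)B⁻¹) ρ(B) = ρ(B) ρ(1 + tY). Multiplicativity is available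
because both arguments on the line are invertible for small t. -/
theorem TensorType.inf_conj (B : V4 ≃L[ℝ] V4) (Y : V4 →L[ℝ] V4) :
    (ρ.inf ((B : V4 →L[ℝ] V4).comp (Y.comp (B.symm : V4 →L[ℝ] V4)))).comp
      (ρ.toFun (B : V4 →L[ℝ] V4)) = (ρ.toFun (B : V4 →L[ℝ] V4)).comp (ρ.inf Y) := by
  have h1 := (ρ.hasDerivAt_line
    ((B : V4 →L[ℝ] V4).comp (Y.comp (B.symm : V4 →L[ℝ] V4)))).clm_comp
      (hasDerivAt_const (0 : ℝ) (ρ.toFun (B : V4 →L[ℝ] V4)))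
  have h2 := (hasDerivAt_const (0 : ℝ) (ρ.toFun (B : V4 →L[ℝ] V4))).clm_comp
    (ρ.hasDerivAt_line Y)
  have he : (fun t : ℝ => (ρ.toFun (ContinuousLinearMap.id ℝ V4 +
      t • (B : V4 →L[ℝ] V4).comp (Y.comp (B.symm : V4 →L[ℝ] V4)))).comp
        (ρ.toFun (B : V4 →L[ℝ] V4))) =ᶠ[nhds 0]
      fun t : ℝ => (ρ.toFun (B : V4 →L[ℝ] V4)).comp
        (ρ.toFun (ContinuousLinearMap.id ℝ V4 + t • Y)) := by
    filter_upwards [eventually_line_invertible Y, eventually_line_invertible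
      ((B : V4 →L[ℝ] V4).comp (Y.comp (B.symm : V4 →L[ℝ] V4)))] with t ⟨C, hC⟩ ⟨C', hC'⟩
    rw [← hC, ← hC', ← ρ.map_mul, ← ρ.map_mul, hC, hC']
    congr 1
    ext v i
    simp
  have := h1.unique (h2.congr_of_eventuallyEq he)
  simpa using this

/-- Derivative at t = 0 of the equivariance `TensorType.inf_conj` for B = 1 + tX: the conjugate B Y
B⁻¹ has derivative XY - YX, while the factors ρ(B) contribute the two products. -/
theorem TensorType.inf_lie (X Y : V4 →L[ℝ] V4) :
    ρ.inf (X.comp Y - Y.comp X) + (ρ.inf Y).comp (ρ.inf X) = (ρ.inf X).comp (ρ.inf Y) := by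
  have hX : HasDerivAt (fun t : ℝ => ContinuousLinearMap.id ℝ V4 + t • X) X 0 := by
    simpa using ((hasDerivAt_id (0 : ℝ)).smul_const X).const_add (ContinuousLinearMap.id ℝ V4)
  have h0 := hX.clm_comp ((hasDerivAt_const (0 : ℝ) Y).clm_comp (hasDerivAt_inverse_line X))
  have h1 := (((fderiv ℝ ρ.toFun (ContinuousLinearMap.id ℝ V4)).hasFDerivAt.comp_hasDerivAt
    (0 : ℝ) h0).clm_comp (ρ.hasDerivAt_line X))
  have h2 := (ρ.hasDerivAt_line X).clm_comp (hasDerivAt_const (0 : ℝ) (ρ.inf Y))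
  have h3 := h2.unique (h1.congr_of_eventuallyEq ?_)
  · simp only [id_add_zero_smul, ContinuousLinearMap.inverse_id, add_zero, ρ.map_one,
      ContinuousLinearMap.comp_id, ContinuousLinearMap.id_comp, Function.comp,
      ContinuousLinearMap.comp_zero,
      ContinuousLinearMap.comp_neg, zero_sub, ← sub_eq_add_neg] at h3
    exact h3.symm
  · filter_upwards [eventually_line_invertible X] with t ⟨C, hC⟩
    have := ρ.inf_conj C Y
    simp only [Function.comp]
    rw [← hC, ContinuousLinearMap.inverse_equiv]
    exact this.symm

theorem TensorType.act_lie (m m' : Fin 4 → Fin 4 → ℝ) (w : W) :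
    ρ.act (fun c b => ∑ d, (m c d * m' d b - m' c d * m d b)) w
      = ρ.act m (ρ.act m' w) - ρ.act m' (ρ.act m w) := by
  have h := congrArg (fun T : W →L[ℝ] W => T w) (ρ.inf_lie (matEnd m) (matEnd m'))
  have e : matEnd (fun c b => ∑ d, (m c d * m' d b - m' c d * m d b))
      = (matEnd m).comp (matEnd m') - (matEnd m').comp (matEnd m) := by
    rw [matEnd_comp, matEnd_comp]
    ext v i
    simp [matEnd_apply, Finset.sum_sub_distrib, sub_mul]
  simp only [act, e]
  rw [eq_sub_iff_add_eq]
  exact h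

end Representation

/-! ### Smooth extension of the Lagrangian and infinitesimal frame invariance -/

section Extension

variable {W : Type*} [NormedAddCommGroup W] [NormedSpace ℝ W] {n : ℕ}

/-- The arguments of a Lagrangian whose metric part is symmetric and whose curvature part is a
2-form with values in the Lie algebra. -/
def prolongSpace (W : Type*) [NormedAddCommGroup W] [NormedSpace ℝ W]
    (alg : Submodule ℝ (Matrix (Fin n) (Fin n) ℝ)) : Submodule ℝ (Prolong n W) where
  carrier := {q | (∀ a b, q.1 a b = q.1 b a) ∧ (∀ a b i j, q.2.2.2 a b i j = -q.2.2.2 b a i j) ∧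
    ∀ a b, Matrix.of (q.2.2.2 a b) ∈ alg}
  add_mem' := by
    rintro q r ⟨h1, h2, h3⟩ ⟨k1, k2, k3⟩
    refine ⟨fun a b => ?_, fun a b i j => ?_, fun a b => alg.add_mem (h3 a b) (k3 a b)⟩
    · simp [h1 a b, k1 a b]
    · simp only [Prod.snd_add, Pi.add_apply]; rw [h2 a b, k2 a b]; ring
  zero_mem' := ⟨fun a b => rfl, fun a b i j => by simp, fun a b => alg.zero_mem⟩
  smul_mem' := by
    rintro r q ⟨h1, h2, h3⟩
    refine ⟨fun a b => ?_, fun a b i j => ?_, fun a b => alg.smul_mem r (h3 a b)⟩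
    · simp [h1 a b]
    · simp only [Prod.smul_snd, Pi.smul_apply, smul_eq_mul]; rw [h2 a b]; ring

theorem admissible_subset_prolongSpace (alg : Submodule ℝ (Matrix (Fin n) (Fin n) ℝ)) :
    admissible W alg ⊆ (prolongSpace W alg : Set (Prolong n W)) :=
  fun _ hq => ⟨hq.1.symm, hq.2⟩

theorem exists_clm_projection {X : Type*} [NormedAddCommGroup X] [NormedSpace ℝ X]
    [FiniteDimensional ℝ X] (V : Submodule ℝ X) :
    ∃ T : X →L[ℝ] X, (∀ x, T x ∈ V) ∧ ∀ x ∈ V, T x = x := by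
  obtain ⟨f, hf⟩ := Submodule.ClosedComplemented.of_finiteDimensional (𝕜 := ℝ) V
  exact ⟨V.subtypeL.comp f, fun x => (f x).2, fun x hx => by
    simpa using congrArg Subtype.val (hf ⟨x, hx⟩)⟩

/-- A function which is smooth on the admissible arguments extends to a function which is smooth
near each of them, without changing the values on the linear space containing them. -/
theorem exists_smooth_extension (alg : Submodule ℝ (Matrix (Fin n) (Fin n) ℝ))
    {ℓ : Prolong n W → ℝ} (hℓ : ContDiffOn ℝ ∞ ℓ (admissible W alg)) :
    ∃ L : Prolong n W → ℝ, (∀ q ∈ admissible W alg, ContDiffAt ℝ ∞ L q) ∧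
      ∀ q ∈ prolongSpace W alg, L q = ℓ q := by
  -- Only the metric and curvature slots are constrained. They are finite-dimensional, hence have
  -- continuous projections; the matter slots are left alone.
  let V₁ : Submodule ℝ (Fin 4 → Fin 4 → ℝ) :=
    (prolongSpace W alg).comap (LinearMap.inl ℝ _ _)
  let V₂ : Submodule ℝ (Fin 4 → Fin 4 → Fin n → Fin n → ℝ) :=
    (prolongSpace W alg).comap
      ((LinearMap.inr ℝ _ _).comp ((LinearMap.inr ℝ _ _).comp (LinearMap.inr ℝ _ _)))
  obtain ⟨T₁, hT₁, hT₁'⟩ := exists_clm_projection V₁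
  obtain ⟨T₂, hT₂, hT₂'⟩ := exists_clm_projection V₂
  let T : Prolong n W → Prolong n W := fun q => (T₁ q.1, q.2.1, q.2.2.1, T₂ q.2.2.2)
  have hT : ContDiff ℝ ∞ T := by simp only [T]; fun_prop
  have hfix : ∀ q ∈ prolongSpace W alg, T q = q := by
    rintro ⟨G, y, z, w⟩ ⟨h1, h2, h3⟩
    have e1 : T₁ G = G := hT₁' _ ⟨h1, fun a b i j => by simp, fun a b => alg.zero_mem⟩
    have e2 : T₂ w = w := hT₂' _ ⟨fun a b => rfl, h2, h3⟩
    simp only [T, e1, e2]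
  refine ⟨ℓ ∘ T, fun q hq => ?_, fun q hq => by simp [hfix q hq]⟩
  -- Near an admissible q the projected metric is symmetric and close to a Lorentzian one, hence
  -- Lorentzian; the projected curvature satisfies its linear constraints everywhere.
  have hmem : T ⁻¹' admissible W alg ∈ nhds q := by
    have h1 : Filter.Tendsto (fun q : Prolong n W => T₁ q.1) (nhds q) (nhds q.1) := by
      have : ContinuousAt (fun q : Prolong n W => T₁ q.1) q := by fun_prop
      have e : T₁ q.1 = q.1 :=
        congrArg Prod.fst (hfix q (admissible_subset_prolongSpace alg hq))
      rw [ContinuousAt, e] at this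
      exact this
    filter_upwards [h1.eventually (eventually_isLorentz hq.1)] with r hr
    exact ⟨hr (hT₁ r.1).1, (hT₂ r.2.2.2).2⟩
  have hTq : T q = q := hfix q (admissible_subset_prolongSpace alg hq)
  have := (hℓ (T q) (by rw [hTq]; exact hq)).comp (s := T ⁻¹' admissible W alg) q
    hT.contDiffAt.contDiffWithinAt (Set.mapsTo_preimage _ _)
  exact this.contDiffAt hmem

/-- The infinitesimal change of the arguments of a Lagrangian under the changes of frame. -/
noncomputable def infFrame (ρ : TensorType W) (X : Fin 4 → Fin 4 → ℝ) (q : Prolong n W) :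
    Prolong n W :=
  (fun a b => ∑ c, (X c a * q.1 c b + X c b * q.1 a c),
   fun i => -ρ.act X (q.2.1 i),
   fun a i => ∑ c, X c a • q.2.2.1 c i - ρ.act X (q.2.2.1 a i),
   fun a b i j => ∑ c, (X c a * q.2.2.2 c b i j + X c b * q.2.2.2 a c i j))

/-- The expression is a quadratic polynomial in t. The array K need not be symmetric, so the
computation covers the curvature slot as well as the metric. -/
theorem hasDerivAt_congr_line (X : Fin 4 → Fin 4 → ℝ) (K : Fin 4 → Fin 4 → ℝ) (a b : Fin 4) :
    HasDerivAt (fun t : ℝ => ∑ c, ∑ d,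
      (ContinuousLinearMap.id ℝ V4 + t • matEnd X) (stdVec a) c *
      (ContinuousLinearMap.id ℝ V4 + t • matEnd X) (stdVec b) d * K c d)
      (∑ c, (X c a * K c b + X c b * K a c)) 0 := by
  have h1 : ∀ (t : ℝ) (a c : Fin 4), (ContinuousLinearMap.id ℝ V4 + t • matEnd X) (stdVec a) c
      = (if c = a then 1 else 0) + t * X c a := by
    intro t a c
    simp [stdVec_apply, matEnd_stdVec]
  have h2 : (fun t : ℝ => ∑ c, ∑ d,
      (ContinuousLinearMap.id ℝ V4 + t • matEnd X) (stdVec a) c *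
      (ContinuousLinearMap.id ℝ V4 + t • matEnd X) (stdVec b) d * K c d)
      = fun t => K a b + t * (∑ c, (X c a * K c b + X c b * K a c))
        + t ^ 2 * ∑ c, ∑ d, X c a * X d b * K c d := by
    funext t
    simp only [h1, add_mul, mul_add, Finset.sum_add_distrib, ite_mul, mul_ite, one_mul, mul_one,
      zero_mul, mul_zero, Finset.sum_ite_eq', Finset.mem_univ, if_true, Finset.mul_sum,
      Finset.sum_ite_irrel, Finset.sum_const_zero]
    have e : ∀ c d, t * X c a * (t * X d b) * K c d = t ^ 2 * (X c a * X d b * K c d) := by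
      intros; ring
    simp only [e]
    simp only [mul_assoc t]
    ring
  rw [h2]
  have h3 := (((hasDerivAt_id (0 : ℝ)).mul_const (∑ c, (X c a * K c b + X c b * K a c))).const_add
    (K a b)).add ((hasDerivAt_pow 2 (0 : ℝ)).mul_const (∑ c, ∑ d, X c a * X d b * K c d))
  exact h3.congr_deriv (by simp)

theorem TensorType.hasDerivAt_inverse (ρ : TensorType W) (X : Fin 4 → Fin 4 → ℝ) (w : W) :
    HasDerivAt (fun t : ℝ => ρ.toFun (ContinuousLinearMap.id ℝ V4 + t • matEnd X).inverse w)
      (-ρ.act X w) 0 := by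
  have h1 := ρ.hasFDerivAt_one.comp_hasDerivAt_of_eq (0 : ℝ) (hasDerivAt_inverse_line (matEnd X))
    (by rw [id_add_zero_smul, ContinuousLinearMap.inverse_id])
  have h2 := h1.clm_apply (hasDerivAt_const (0 : ℝ) w)
  exact h2.congr_deriv (by simp [TensorType.act, TensorType.inf])

/-- Invariance is assumed only for orientation-preserving frame changes, so the curve 1 + tX must be
seen to stay among them for small t. -/
theorem eventually_det_pos (X : V4 →L[ℝ] V4) :
    ∀ᶠ t : ℝ in nhds 0, 0 < (ContinuousLinearMap.id ℝ V4 + t • X).det := by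
  have hc : ContinuousAt (fun t : ℝ => (ContinuousLinearMap.id ℝ V4 + t • X).det) 0 :=
    (ContinuousLinearMap.continuous_det.comp (by fun_prop :
      Continuous fun t : ℝ => ContinuousLinearMap.id ℝ V4 + t • X)).continuousAt
  refine hc.eventually (lt_mem_nhds ?_)
  beta_reduce
  rw [id_add_zero_smul]
  simp [ContinuousLinearMap.det]

/-- Invariance under the changes of frame, infinitesimally. -/
theorem fderiv_infFrame (ρ : TensorType W) {alg : Submodule ℝ (Matrix (Fin n) (Fin n) ℝ)}
    {ℓ L : Prolong n W → ℝ}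
    (hinv : ∀ A : V4 ≃L[ℝ] V4, 0 < LinearMap.det (A : V4 →ₗ[ℝ] V4) →
      ∀ q ∈ admissible W alg, ℓ (frameChange ρ A q) = ℓ q)
    (hL : ∀ q ∈ prolongSpace W alg, L q = ℓ q) {q : Prolong n W} (hq : q ∈ admissible W alg)
    (hd : DifferentiableAt ℝ L q) (X : Fin 4 → Fin 4 → ℝ) :
    fderiv ℝ L q (infFrame ρ X q) = 0 := by
  let A : ℝ → V4 →L[ℝ] V4 := fun t => ContinuousLinearMap.id ℝ V4 + t • matEnd X
  -- The orbit of q under 1 + tX. The total function `ContinuousLinearMap.inverse` defines it for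
  -- every t; it is a genuine frame change where 1 + tX is invertible.
  let γ : ℝ → Prolong n W := fun t =>
    (fun a b => ∑ c, ∑ d, A t (stdVec a) c * A t (stdVec b) d * q.1 c d,
     fun i => ρ.toFun (A t).inverse (q.2.1 i),
     fun a i => ∑ c, A t (stdVec a) c • ρ.toFun (A t).inverse (q.2.2.1 c i),
     fun a b i j => ∑ c, ∑ d, A t (stdVec a) c * A t (stdVec b) d * q.2.2.2 c d i j)
  have hA0 : A 0 = ContinuousLinearMap.id ℝ V4 := id_add_zero_smul _
  have hγ0 : γ 0 = q := by
    obtain ⟨G, y, z, w⟩ := q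
    simp [γ, hA0, stdVec_apply, ρ.map_one]
  have hγ : HasDerivAt γ (infFrame ρ X q) 0 := by
    refine HasDerivAt.prodMk ?_ (HasDerivAt.prodMk ?_ (HasDerivAt.prodMk ?_ ?_))
    · exact hasDerivAt_pi.2 fun a => hasDerivAt_pi.2 fun b => hasDerivAt_congr_line X q.1 a b
    · exact hasDerivAt_pi.2 fun i => ρ.hasDerivAt_inverse X (q.2.1 i)
    · refine hasDerivAt_pi.2 fun a => hasDerivAt_pi.2 fun i => ?_
      have h1 : ∀ c : Fin 4, HasDerivAt (fun t : ℝ => A t (stdVec a) c) (X c a) 0 := by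
        intro c
        have e : (fun t : ℝ => A t (stdVec a) c) = fun t => (stdVec a) c + t * X c a := by
          funext t
          simp [A, matEnd_stdVec]
        rw [e]
        simpa using ((hasDerivAt_id (0 : ℝ)).mul_const (X c a)).const_add ((stdVec a) c)
      have h2 := HasDerivAt.fun_sum (u := Finset.univ) fun c _ =>
        (h1 c).smul (ρ.hasDerivAt_inverse X (q.2.2.1 c i))
      refine h2.congr_deriv ?_
      simp only [hA0, id_add_zero_smul, ContinuousLinearMap.inverse_id, ρ.map_one,
        ContinuousLinearMap.id_apply, stdVec_apply, Finset.sum_add_distrib, ite_smul, zero_smul,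
        one_smul, Finset.sum_ite_eq', Finset.mem_univ, if_true]
      abel
    · exact hasDerivAt_pi.2 fun a => hasDerivAt_pi.2 fun b => hasDerivAt_pi.2 fun i =>
        hasDerivAt_pi.2 fun j => hasDerivAt_congr_line X (fun c d => q.2.2.2 c d i j) a b
  -- The linear constraints persist along the whole curve, so `L` may be replaced by `ℓ` there and
  -- the invariance of `ℓ` applies.
  have hV : ∀ t, γ t ∈ prolongSpace W alg := by
    intro t
    obtain ⟨h1, h2, h3⟩ := admissible_subset_prolongSpace alg hq
    refine ⟨fun a b => ?_, fun a b i j => ?_, fun a b => ?_⟩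
    · simp only [γ]
      rw [Finset.sum_comm]
      refine Finset.sum_congr rfl fun c _ => Finset.sum_congr rfl fun d _ => ?_
      rw [h1 d c]; ring
    · simp only [γ, ← Finset.sum_neg_distrib]
      rw [Finset.sum_comm]
      refine Finset.sum_congr rfl fun c _ => Finset.sum_congr rfl fun d _ => ?_
      rw [h2 d c]; ring
    · have e : Matrix.of ((γ t).2.2.2 a b) = ∑ c, ∑ d,
          (A t (stdVec a) c * A t (stdVec b) d) • Matrix.of (q.2.2.2 c d) := by
        ext i j
        simp [γ, Matrix.sum_apply]
      rw [e]
      exact alg.sum_mem fun c _ => alg.sum_mem fun d _ => alg.smul_mem _ (h3 c d)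
  have hconst : (fun t => L (γ t)) =ᶠ[nhds 0] fun _ => L q := by
    filter_upwards [eventually_line_invertible (matEnd X), eventually_det_pos (matEnd X)]
      with t ⟨C, hC⟩ hdet
    rw [hL _ (hV t), hL q (admissible_subset_prolongSpace alg hq), ← hinv C ?_ q hq]
    · have hAC : A t = C := hC.symm
      simp only [γ, hAC, ContinuousLinearMap.inverse_equiv]
      rfl
    · rw [← hC] at hdet
      exact hdet
  have h1 : HasDerivAt (fun t => L (γ t)) (fderiv ℝ L q (infFrame ρ X q)) 0 :=
    hd.hasFDerivAt.comp_hasDerivAt_of_eq (0 : ℝ) hγ hγ0.symm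
  exact h1.unique ((hasDerivAt_const _ _).congr_of_eventuallyEq hconst)

end Extension

section Variation

variable {W : Type*} [NormedAddCommGroup W] [NormedSpace ℝ W] {n : ℕ}

/-! ### First variation of the covariant prolongation -/

/-- The Christoffel symbols of the first kind. -/
noncomputable def lowerChristoffel (G : V4 → Fin 4 → Fin 4 → ℝ) (p : V4) (d a b : Fin 4) : ℝ :=
  (1 / 2) * (pd a (fun q => G q b d) p + pd b (fun q => G q a d) p - pd d (fun q => G q a b) p)

theorem christoffel_eq (G : V4 → Fin 4 → Fin 4 → ℝ) (p : V4) (c a b : Fin 4) :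
    christoffel G p c a b = ∑ d, invMetric (G p) c d * lowerChristoffel G p d a b := by
  simp only [christoffel, lowerChristoffel, Finset.mul_sum]
  exact Finset.sum_congr rfl fun d _ => by ring

theorem covDiff_eq (ρ : TensorType W) (G : V4 → Fin 4 → Fin 4 → ℝ) (φ : V4 → Fin n → W)
    (κ : V4 → Fin 4 → Fin n → Fin n → ℝ) (p : V4) (a : Fin 4) (i : Fin n) :
    covDiff ρ G φ κ p a i = pd a (fun q => φ q i) p - ∑ j, κ p a i j • φ p j
      + ρ.act (fun c b => christoffel G p c a b) (φ p i) := by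
  rw [ρ.act_apply, Finset.sum_comm]; rfl

/-- The variation of the Christoffel symbols when the metric varies by `h`. -/
noncomputable def dChristoffel (G h : V4 → Fin 4 → Fin 4 → ℝ) (p : V4) (c a b : Fin 4) : ℝ :=
  ∑ d, invMetric (G p) c d *
    (lowerChristoffel h p d a b - ∑ e, h p d e * christoffel G p e a b)

/-- The variation of the covariant differential of the matter field. -/
noncomputable def dCovDiff (ρ : TensorType W) (G : V4 → Fin 4 → Fin 4 → ℝ) (φ : V4 → Fin n → W)
    (κ : V4 → Fin 4 → Fin n → Fin n → ℝ) (h : V4 → Fin 4 → Fin 4 → ℝ) (δφ : V4 → Fin n → W)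
    (δκ : V4 → Fin 4 → Fin n → Fin n → ℝ) (p : V4) (a : Fin 4) (i : Fin n) : W :=
  pd a (fun q => δφ q i) p - ∑ j, (δκ p a i j • φ p j + κ p a i j • δφ p j)
    + (ρ.act (fun c b => dChristoffel G h p c a b) (φ p i)
      + ρ.act (fun c b => christoffel G p c a b) (δφ p i))

/-- The variation of the curvature. -/
noncomputable def dCurv (κ δκ : V4 → Fin 4 → Fin n → Fin n → ℝ) (p : V4) (a b : Fin 4)
    (i j : Fin n) : ℝ :=
  pd a (fun q => δκ q b i j) p - pd b (fun q => δκ q a i j) p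
    - ∑ h, ((δκ p a i h * κ p b h j + κ p a i h * δκ p b h j)
      - (δκ p b i h * κ p a h j + κ p b i h * δκ p a h j))

/-- The variation of the covariant prolongation. -/
noncomputable def dProlong (ρ : TensorType W) (G : V4 → Fin 4 → Fin 4 → ℝ) (φ : V4 → Fin n → W)
    (κ : V4 → Fin 4 → Fin n → Fin n → ℝ) (h : V4 → Fin 4 → Fin 4 → ℝ) (δφ : V4 → Fin n → W)
    (δκ : V4 → Fin 4 → Fin n → Fin n → ℝ) (p : V4) : Prolong n W :=
  (h p, δφ p, dCovDiff ρ G φ κ h δφ δκ p, dCurv κ δκ p)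

theorem lowerChristoffel_line {G h : V4 → Fin 4 → Fin 4 → ℝ} {p : V4}
    (hG : DifferentiableAt ℝ G p) (hh : DifferentiableAt ℝ h p) (ε : ℝ) (d a b : Fin 4) :
    lowerChristoffel (G + ε • h) p d a b
      = lowerChristoffel G p d a b + ε * lowerChristoffel h p d a b := by
  have e : ∀ x y z, pd x (fun q => (G + ε • h) q y z) p
      = pd x (fun q => G q y z) p + ε * pd x (fun q => h q y z) p := by
    intro x y z
    rw [← pd_const_mul (by fun_prop), ← pd_add (by fun_prop) (by fun_prop)]
    rfl
  simp only [lowerChristoffel, e]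
  ring

theorem hasDerivAt_add_mul (x y : ℝ) : HasDerivAt (fun ε : ℝ => x + ε * y) y 0 := by
  simpa using ((hasDerivAt_id (0 : ℝ)).mul_const y).const_add x

theorem hasDerivAt_add_smul {X : Type*} [NormedAddCommGroup X] [NormedSpace ℝ X] (x y : X) :
    HasDerivAt (fun ε : ℝ => x + ε • y) y 0 := by
  simpa using ((hasDerivAt_id (0 : ℝ)).smul_const y).const_add x

/-- Product rule for Γ^c_{ab} = g^{cd} Γ_{dab}. The symbols of the first kind are linear in the
metric, and the derivative -g⁻¹hg⁻¹ of the inverse recombines with Γ_{dab} into -g⁻¹hΓ. -/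
theorem hasDerivAt_christoffel {G h : V4 → Fin 4 → Fin 4 → ℝ} {p : V4}
    (hdet : (Matrix.of (G p)).det ≠ 0)
    (hG : DifferentiableAt ℝ G p) (hh : DifferentiableAt ℝ h p) (c a b : Fin 4) :
    HasDerivAt (fun ε : ℝ => christoffel (G + ε • h) p c a b) (dChristoffel G h p c a b) 0 := by
  simp only [christoffel_eq, lowerChristoffel_line hG hh]
  have h1 : ∀ d, HasDerivAt (fun ε : ℝ => invMetric ((G + ε • h) p) c d)
      (fderiv ℝ invMetric (G p) (h p) c d) 0 := fun d =>
    hasDerivAt_pi.1 (hasDerivAt_pi.1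
      (hasDerivAt_line (SmoothAt.diff (contDiffAt_invMetric hdet)) (h p)) c) d
  have h2 := HasDerivAt.fun_sum (u := Finset.univ) fun d _ =>
    (h1 d).mul (hasDerivAt_add_mul (lowerChristoffel G p d a b) (lowerChristoffel h p d a b))
  refine h2.congr_deriv ?_
  simp only [fderiv_invMetric hdet, dChristoffel, zero_smul, add_zero, zero_mul, mul_sub,
    Finset.sum_add_distrib, Finset.sum_sub_distrib, christoffel_eq, neg_mul,
    Finset.sum_neg_distrib, Finset.sum_mul, Finset.mul_sum]
  rw [neg_add_eq_sub]
  congr 1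
  rw [Finset.sum_comm]
  refine Finset.sum_congr rfl fun d _ => ?_
  rw [Finset.sum_comm]
  refine Finset.sum_congr rfl fun e _ => Finset.sum_congr rfl fun f _ => by ring

theorem TensorType.hasDerivAt_act (ρ : TensorType W) {m : ℝ → Fin 4 → Fin 4 → ℝ}
    {m' : Fin 4 → Fin 4 → ℝ} {w : ℝ → W} {w' : W}
    (hm : ∀ c b, HasDerivAt (fun ε => m ε c b) (m' c b) 0) (hw : HasDerivAt w w' 0) :
    HasDerivAt (fun ε => ρ.act (m ε) (w ε)) (ρ.act m' (w 0) + ρ.act (m 0) w') 0 := by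
  simp only [ρ.act_apply]
  have h1 := HasDerivAt.fun_sum (u := Finset.univ) fun c (_ : c ∈ Finset.univ) =>
    HasDerivAt.fun_sum (u := Finset.univ) fun b (_ : b ∈ Finset.univ) =>
      (hm c b).smul ((ρ.inf (elemEnd c b)).hasFDerivAt.comp_hasDerivAt (0 : ℝ) hw)
  refine h1.congr_deriv ?_
  simp only [Finset.sum_add_distrib, Function.comp]
  rw [add_comm]

theorem hasDerivAt_covDiff (ρ : TensorType W) {G h : V4 → Fin 4 → Fin 4 → ℝ}
    {φ δφ : V4 → Fin n → W} {κ δκ : V4 → Fin 4 → Fin n → Fin n → ℝ} {p : V4}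
    (hdet : (Matrix.of (G p)).det ≠ 0)
    (hG : DifferentiableAt ℝ G p) (hh : DifferentiableAt ℝ h p)
    (hφ : DifferentiableAt ℝ φ p) (hδφ : DifferentiableAt ℝ δφ p) (a : Fin 4) (i : Fin n) :
    HasDerivAt (fun ε : ℝ => covDiff ρ (G + ε • h) (φ + ε • δφ) (κ + ε • δκ) p a i)
      (dCovDiff ρ G φ κ h δφ δκ p a i) 0 := by
  simp only [covDiff_eq]
  have e : ∀ ε : ℝ, pd a (fun q => (φ + ε • δφ) q i) p
      = pd a (fun q => φ q i) p + ε • pd a (fun q => δφ q i) p := by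
    intro ε
    rw [← pd_const_smul _ (by fun_prop), ← pd_add (by fun_prop) (by fun_prop)]
    rfl
  simp only [e]
  have h1 := HasDerivAt.fun_sum (u := Finset.univ) fun j (_ : j ∈ Finset.univ) =>
    (hasDerivAt_add_mul (κ p a i j) (δκ p a i j)).smul (hasDerivAt_add_smul (φ p j) (δφ p j))
  have h2 := ρ.hasDerivAt_act (fun c b => hasDerivAt_christoffel hdet hG hh c a b)
    (hasDerivAt_add_smul (φ p i) (δφ p i))
  refine (((hasDerivAt_add_smul (pd a (fun q => φ q i) p) _).sub h1).add h2).congr_deriv ?_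
  simp only [dCovDiff, zero_smul, add_zero, zero_mul]
  simp only [add_comm]

theorem hasDerivAt_curv {κ δκ : V4 → Fin 4 → Fin n → Fin n → ℝ} {p : V4}
    (hκ : DifferentiableAt ℝ κ p) (hδκ : DifferentiableAt ℝ δκ p) (a b : Fin 4) (i j : Fin n) :
    HasDerivAt (fun ε : ℝ => curv (κ + ε • δκ) p a b i j) (dCurv κ δκ p a b i j) 0 := by
  have e : ∀ (ε : ℝ) a b, pd a (fun q => (κ + ε • δκ) q b i j) p
      = pd a (fun q => κ q b i j) p + ε * pd a (fun q => δκ q b i j) p := by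
    intro ε a b
    rw [← pd_const_mul (by fun_prop), ← pd_add (by fun_prop) (by fun_prop)]
    rfl
  simp only [curv, e]
  have h1 : ∀ a b : Fin 4, ∀ h, HasDerivAt (fun ε : ℝ => (κ + ε • δκ) p a i h *
      (κ + ε • δκ) p b h j) (δκ p a i h * κ p b h j + κ p a i h * δκ p b h j) 0 := by
    intro a b h
    refine ((hasDerivAt_add_mul (κ p a i h) (δκ p a i h)).mul
      (hasDerivAt_add_mul (κ p b h j) (δκ p b h j))).congr_deriv ?_
    simp
  have h2 := HasDerivAt.fun_sum (u := Finset.univ) fun h (_ : h ∈ Finset.univ) =>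
    (h1 a b h).sub (h1 b a h)
  exact ((hasDerivAt_add_mul _ _).sub (hasDerivAt_add_mul _ _)).sub h2

theorem hasDerivAt_prolong (ρ : TensorType W) {G h : V4 → Fin 4 → Fin 4 → ℝ}
    {φ δφ : V4 → Fin n → W} {κ δκ : V4 → Fin 4 → Fin n → Fin n → ℝ} {p : V4}
    (hdet : (Matrix.of (G p)).det ≠ 0)
    (hG : DifferentiableAt ℝ G p) (hh : DifferentiableAt ℝ h p)
    (hφ : DifferentiableAt ℝ φ p) (hδφ : DifferentiableAt ℝ δφ p)
    (hκ : DifferentiableAt ℝ κ p) (hδκ : DifferentiableAt ℝ δκ p) :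
    HasDerivAt (fun ε : ℝ => prolong ρ (G + ε • h) (φ + ε • δφ) (κ + ε • δκ) p)
      (dProlong ρ G φ κ h δφ δκ p) 0 := by
  refine HasDerivAt.prodMk (hasDerivAt_add_smul (G p) (h p))
    (HasDerivAt.prodMk (hasDerivAt_add_smul (φ p) (δφ p)) (HasDerivAt.prodMk ?_ ?_))
  · exact hasDerivAt_pi.2 fun a => hasDerivAt_pi.2 fun i =>
      hasDerivAt_covDiff ρ hdet hG hh hφ hδφ a i
  · exact hasDerivAt_pi.2 fun a => hasDerivAt_pi.2 fun b => hasDerivAt_pi.2 fun i =>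
      hasDerivAt_pi.2 fun j => hasDerivAt_curv hκ hδκ a b i j

theorem hasDerivAt_lagDensity (ρ : TensorType W) {L : Prolong n W → ℝ}
    {G h : V4 → Fin 4 → Fin 4 → ℝ}
    {φ δφ : V4 → Fin n → W} {κ δκ : V4 → Fin 4 → Fin n → Fin n → ℝ} {p : V4}
    (hL : DifferentiableAt ℝ L (prolong ρ G φ κ p))
    (hdet : (Matrix.of (G p)).det ≠ 0)
    (hG : DifferentiableAt ℝ G p) (hh : DifferentiableAt ℝ h p)
    (hφ : DifferentiableAt ℝ φ p) (hδφ : DifferentiableAt ℝ δφ p)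
    (hκ : DifferentiableAt ℝ κ p) (hδκ : DifferentiableAt ℝ δκ p) :
    HasDerivAt (fun ε : ℝ => lagDensity ρ L (G + ε • h) (φ + ε • δφ) (κ + ε • δκ) p)
      ((fderiv ℝ L (prolong ρ G φ κ p) (dProlong ρ G φ κ h δφ δκ p)
        + L (prolong ρ G φ κ p) * ((1 / 2) * ∑ a, ∑ b, invMetric (G p) a b * h p b a))
          * volDensity (G p)) 0 := by
  have h1 := hL.hasFDerivAt.comp_hasDerivAt_of_eq (0 : ℝ)
    (hasDerivAt_prolong ρ hdet hG hh hφ hδφ hκ hδκ) (by simp)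
  have h2 := hasDerivAt_line (SmoothAt.diff (contDiffAt_volDensity hdet)) (h p)
  rw [fderiv_volDensity hdet] at h2
  refine (h1.mul h2).congr_deriv ?_
  simp only [Function.comp, zero_smul, add_zero]
  ring

/-! ### Smoothness -/

variable {G h : V4 → Fin 4 → Fin 4 → ℝ} {φ δφ : V4 → Fin n → W}
  {κ δκ : V4 → Fin 4 → Fin n → Fin n → ℝ} {p : V4}

theorem contDiffAt_invMetric_comp (hdet : (Matrix.of (G p)).det ≠ 0) (hG : ContDiffAt ℝ ∞ G p)
    (a b : Fin 4) : ContDiffAt ℝ ∞ (fun q => invMetric (G q) a b) p :=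
  contDiffAt_pi.1 (contDiffAt_pi.1 ((contDiffAt_invMetric hdet).comp p hG) a) b

theorem contDiffAt_volDensity_comp (hdet : (Matrix.of (G p)).det ≠ 0)
    (hG : ContDiffAt ℝ ∞ G p) : ContDiffAt ℝ ∞ (fun q => volDensity (G q)) p :=
  (contDiffAt_volDensity hdet).comp p hG

theorem contDiffAt_lowerChristoffel (hG : ContDiffAt ℝ ∞ G p) (d a b : Fin 4) :
    ContDiffAt ℝ ∞ (fun q => lowerChristoffel G q d a b) p := by
  have h : ∀ x y z, ContDiffAt ℝ ∞ (fun q' => pd x (fun q => G q y z) q') p := fun x y z =>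
    SmoothAt.pd (f := fun q => G q y z) (by fun_prop) x
  exact contDiffAt_const.mul (((h a b d).add (h b a d)).sub (h d a b))

theorem contDiffAt_christoffel (hdet : (Matrix.of (G p)).det ≠ 0) (hG : ContDiffAt ℝ ∞ G p)
    (c a b : Fin 4) : ContDiffAt ℝ ∞ (fun q => christoffel G q c a b) p := by
  simp only [christoffel_eq]
  exact ContDiffAt.sum fun d _ =>
    (contDiffAt_invMetric_comp hdet hG c d).mul (contDiffAt_lowerChristoffel hG d a b)

theorem contDiffAt_dChristoffel (hdet : (Matrix.of (G p)).det ≠ 0) (hG : ContDiffAt ℝ ∞ G p)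
    (hh : ContDiffAt ℝ ∞ h p) (c a b : Fin 4) :
    ContDiffAt ℝ ∞ (fun q => dChristoffel G h q c a b) p := by
  simp only [dChristoffel]
  refine ContDiffAt.sum fun d _ => (contDiffAt_invMetric_comp hdet hG c d).mul
    ((contDiffAt_lowerChristoffel hh d a b).sub (ContDiffAt.sum fun e _ => ?_))
  exact ContDiffAt.mul (by fun_prop) (contDiffAt_christoffel hdet hG e a b)

theorem TensorType.contDiffAt_act (ρ : TensorType W) {m : V4 → Fin 4 → Fin 4 → ℝ} {w : V4 → W}
    (hm : ∀ c b, ContDiffAt ℝ ∞ (fun q => m q c b) p) (hw : ContDiffAt ℝ ∞ w p) :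
    ContDiffAt ℝ ∞ (fun q => ρ.act (m q) (w q)) p := by
  simp only [ρ.act_apply]
  exact ContDiffAt.sum fun c _ => ContDiffAt.sum fun b _ =>
    (hm c b).smul ((ρ.inf (elemEnd c b)).contDiff.contDiffAt.comp p hw)

theorem contDiffAt_covDiff (ρ : TensorType W) (hdet : (Matrix.of (G p)).det ≠ 0)
    (hG : ContDiffAt ℝ ∞ G p) (hφ : ContDiffAt ℝ ∞ φ p) (hκ : ContDiffAt ℝ ∞ κ p)
    (a : Fin 4) (i : Fin n) : ContDiffAt ℝ ∞ (fun q => covDiff ρ G φ κ q a i) p := by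
  simp only [covDiff_eq]
  refine ContDiffAt.add (ContDiffAt.sub ?_ (ContDiffAt.sum fun j _ => ?_)) ?_
  · exact SmoothAt.pd (f := fun q => φ q i) (by fun_prop) a
  · exact ContDiffAt.smul (by fun_prop) (by fun_prop)
  · exact ρ.contDiffAt_act (fun c b => contDiffAt_christoffel hdet hG c a b) (by fun_prop)

theorem contDiffAt_curv (hκ : ContDiffAt ℝ ∞ κ p) (a b : Fin 4) (i j : Fin n) :
    ContDiffAt ℝ ∞ (fun q => curv κ q a b i j) p := by
  have h : ∀ x y, ContDiffAt ℝ ∞ (fun q' => pd x (fun q => κ q y i j) q') p := fun x y =>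
    SmoothAt.pd (f := fun q => κ q y i j) (by fun_prop) x
  exact ((h a b).sub (h b a)).sub (ContDiffAt.sum fun k _ => by fun_prop)

theorem contDiffAt_prolong (ρ : TensorType W) (hdet : (Matrix.of (G p)).det ≠ 0)
    (hG : ContDiffAt ℝ ∞ G p) (hφ : ContDiffAt ℝ ∞ φ p) (hκ : ContDiffAt ℝ ∞ κ p) :
    ContDiffAt ℝ ∞ (prolong ρ G φ κ) p :=
  hG.prodMk (hφ.prodMk (ContDiffAt.prodMk
    (contDiffAt_pi.2 fun a => contDiffAt_pi.2 fun i => contDiffAt_covDiff ρ hdet hG hφ hκ a i)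
    (contDiffAt_pi.2 fun a => contDiffAt_pi.2 fun b => contDiffAt_pi.2 fun i =>
      contDiffAt_pi.2 fun j => contDiffAt_curv hκ a b i j)))

theorem contDiffAt_dProlong (ρ : TensorType W) (hdet : (Matrix.of (G p)).det ≠ 0)
    (hG : ContDiffAt ℝ ∞ G p) (hφ : ContDiffAt ℝ ∞ φ p) (hκ : ContDiffAt ℝ ∞ κ p)
    (hh : ContDiffAt ℝ ∞ h p) (hδφ : ContDiffAt ℝ ∞ δφ p) (hδκ : ContDiffAt ℝ ∞ δκ p) :
    ContDiffAt ℝ ∞ (dProlong ρ G φ κ h δφ δκ) p := by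
  refine hh.prodMk (hδφ.prodMk (ContDiffAt.prodMk
    (contDiffAt_pi.2 fun a => contDiffAt_pi.2 fun i => ?_)
    (contDiffAt_pi.2 fun a => contDiffAt_pi.2 fun b => contDiffAt_pi.2 fun i =>
      contDiffAt_pi.2 fun j => ?_)))
  · refine ContDiffAt.add (ContDiffAt.sub ?_ (ContDiffAt.sum fun j _ => by fun_prop))
      (ContDiffAt.add ?_ ?_)
    · exact SmoothAt.pd (f := fun q => δφ q i) (by fun_prop) a
    · exact ρ.contDiffAt_act (fun c b => contDiffAt_dChristoffel hdet hG hh c a b) (by fun_prop)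
    · exact ρ.contDiffAt_act (fun c b => contDiffAt_christoffel hdet hG c a b) (by fun_prop)
  · have h : ∀ x y, ContDiffAt ℝ ∞ (fun q' => pd x (fun q => δκ q y i j) q') p := fun x y =>
      SmoothAt.pd (f := fun q => δκ q y i j) (by fun_prop) x
    exact ((h a b).sub (h b a)).sub (ContDiffAt.sum fun k _ => by fun_prop)

theorem contDiffAt_fderiv_lagrangian (ρ : TensorType W) {L : Prolong n W → ℝ}
    (hL : ContDiffAt ℝ ∞ L (prolong ρ G φ κ p)) (hdet : (Matrix.of (G p)).det ≠ 0)
    (hG : ContDiffAt ℝ ∞ G p) (hφ : ContDiffAt ℝ ∞ φ p) (hκ : ContDiffAt ℝ ∞ κ p)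
    {v : V4 → Prolong n W} (hv : ContDiffAt ℝ ∞ v p) :
    ContDiffAt ℝ ∞ (fun q => fderiv ℝ L (prolong ρ G φ κ q) (v q)) p :=
  ((hL.fderiv_right (m := ∞) (by simp)).comp p
    (contDiffAt_prolong ρ hdet hG hφ hκ)).clm_apply hv

/-! ### Values of the covariant prolongation -/

/-- A continuous projection onto V fixes f near p and commutes with the derivative, so the
derivative lies in V. -/
theorem pd_mem_of_eventually_mem {X : Type*} [NormedAddCommGroup X] [NormedSpace ℝ X]
    [FiniteDimensional ℝ X] {V : Submodule ℝ X} {f : V4 → X} (hf : DifferentiableAt ℝ f p)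
    (h : ∀ᶠ q in nhds p, f q ∈ V) (a : Fin 4) : pd a f p ∈ V := by
  obtain ⟨T, hT, hT'⟩ := exists_clm_projection V
  have e : f =ᶠ[nhds p] fun q => T (f q) := h.mono fun q hq => (hT' _ hq).symm
  rw [pd_congr e, pd_clm T hf]
  exact hT _

theorem pd_matrix_mem {m : ℕ} {alg : Submodule ℝ (Matrix (Fin m) (Fin m) ℝ)}
    {f : V4 → Fin m → Fin m → ℝ} (hf : DifferentiableAt ℝ f p)
    (h : ∀ᶠ q in nhds p, Matrix.of (f q) ∈ alg) (a : Fin 4) : Matrix.of (pd a f p) ∈ alg :=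
  pd_mem_of_eventually_mem 
    (V := alg.comap (Matrix.ofLinearEquiv ℝ : (Fin m → Fin m → ℝ) ≃ₗ[ℝ] _).toLinearMap) hf h a

theorem curv_mem {alg : Submodule ℝ (Matrix (Fin n) (Fin n) ℝ)}
    (hlie : ∀ X ∈ alg, ∀ Y ∈ alg, X * Y - Y * X ∈ alg)
    (hκ : DifferentiableAt ℝ κ p) (h : ∀ᶠ q in nhds p, ∀ a, Matrix.of (κ q a) ∈ alg)
    (a b : Fin 4) : Matrix.of (curv κ p a b) ∈ alg := by
  have h0 := h.self_of_nhds
  have e : Matrix.of (curv κ p a b) = Matrix.of (pd a (fun q => κ q b) p)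
      - Matrix.of (pd b (fun q => κ q a) p)
      - (Matrix.of (κ p a) * Matrix.of (κ p b) - Matrix.of (κ p b) * Matrix.of (κ p a)) := by
    ext i j
    have e1 : ∀ x y, pd x (fun q => κ q y i j) p = pd x (fun q => κ q y) p i j := by
      intro x y
      rw [pd_apply (f := fun q => κ q y i) (by fun_prop),
        pd_apply (f := fun q => κ q y) (by fun_prop)]
    simp [curv, Matrix.mul_apply, e1]
  rw [e]
  exact alg.sub_mem (alg.sub_mem (pd_matrix_mem (by fun_prop) (h.mono fun q hq => hq b) a)
    (pd_matrix_mem (by fun_prop) (h.mono fun q hq => hq a) b)) (hlie _ (h0 a) _ (h0 b))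

/-- Only symmetry of the metric is required, so the result applies to G + ε h for every real ε,
whether or not that array is Lorentzian. -/
theorem prolong_mem_prolongSpace (ρ : TensorType W)
    {alg : Submodule ℝ (Matrix (Fin n) (Fin n) ℝ)}
    (hlie : ∀ X ∈ alg, ∀ Y ∈ alg, X * Y - Y * X ∈ alg) (hs : ∀ a b, G p a b = G p b a)
    (hκ : DifferentiableAt ℝ κ p) (h : ∀ᶠ q in nhds p, ∀ a, Matrix.of (κ q a) ∈ alg) :
    prolong ρ G φ κ p ∈ prolongSpace W alg := by
  refine ⟨hs, fun a b i j => ?_, curv_mem hlie hκ h⟩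
  simp only [prolong, curv, Finset.sum_sub_distrib]
  ring

end Variation

/-! ### Local fields, the Levi-Civita connection and the volume density -/

section Response

variable {W : Type*} [NormedAddCommGroup W] [NormedSpace ℝ W] {n : ℕ}

/-- Components on an open set of a Lorentz metric and of smooth fields, the coefficients of the
gauge field being in the Lie algebra `alg`. -/
structure SmoothFields (alg : Submodule ℝ (Matrix (Fin n) (Fin n) ℝ)) (D : Set V4)
    (G : V4 → Fin 4 → Fin 4 → ℝ) (φ : V4 → Fin n → W)
    (κ : V4 → Fin 4 → Fin n → Fin n → ℝ) : Prop where
  isOpen : IsOpen D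
  lie_mem : ∀ X ∈ alg, ∀ Y ∈ alg, X * Y - Y * X ∈ alg
  metric : ∀ p ∈ D, ContDiffAt ℝ ∞ G p
  matter : ∀ p ∈ D, ContDiffAt ℝ ∞ φ p
  conn : ∀ p ∈ D, ContDiffAt ℝ ∞ κ p
  lorentz : ∀ p ∈ D, IsLorentz (G p)
  conn_mem : ∀ p ∈ D, ∀ a, Matrix.of (κ p a) ∈ alg

/-- `L` extends the Lagrangian `ℓ` smoothly to a neighbourhood of the admissible arguments. -/
structure IsSmoothExtension (alg : Submodule ℝ (Matrix (Fin n) (Fin n) ℝ))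
    (ℓ L : Prolong n W → ℝ) : Prop where
  smooth : ∀ q ∈ admissible W alg, ContDiffAt ℝ ∞ L q
  eq : ∀ q ∈ prolongSpace W alg, L q = ℓ q

variable {alg : Submodule ℝ (Matrix (Fin n) (Fin n) ℝ)} {D : Set V4} {ρ : TensorType W}
  {ℓ L : Prolong n W → ℝ} {G h : V4 → Fin 4 → Fin 4 → ℝ} {φ δφ : V4 → Fin n → W}
  {κ δκ : V4 → Fin 4 → Fin n → Fin n → ℝ} {p : V4}

namespace SmoothFields

theorem det_ne_zero (hF : SmoothFields alg D G φ κ) (hp : p ∈ D) : (Matrix.of (G p)).det ≠ 0 :=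
  (hF.lorentz p hp).det_ne_zero

theorem symm (hF : SmoothFields alg D G φ κ) (hp : p ∈ D) (a b : Fin 4) : G p a b = G p b a :=
  (hF.lorentz p hp).symm a b

theorem eventually_conn_mem (hF : SmoothFields alg D G φ κ) (hp : p ∈ D) :
    ∀ᶠ q in nhds p, ∀ a, Matrix.of (κ q a) ∈ alg :=
  Filter.eventually_of_mem (hF.isOpen.mem_nhds hp) hF.conn_mem

theorem prolong_admissible (hF : SmoothFields alg D G φ κ) (ρ : TensorType W) (hp : p ∈ D) :
    prolong ρ G φ κ p ∈ admissible W alg :=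
  ⟨hF.lorentz p hp, (prolong_mem_prolongSpace ρ hF.lie_mem (hF.symm hp)
    (SmoothAt.diff (hF.conn p hp)) (hF.eventually_conn_mem hp)).2⟩

theorem prolong_mem (hF : SmoothFields alg D G φ κ) (ρ : TensorType W) (hp : p ∈ D) :
    prolong ρ G φ κ p ∈ prolongSpace W alg :=
  admissible_subset_prolongSpace alg (hF.prolong_admissible ρ hp)

theorem pd_metric_symm (hF : SmoothFields alg D G φ κ) (hp : p ∈ D) (d a b : Fin 4) :
    pd d (fun q => G q a b) p = pd d (fun q => G q b a) p :=
  pd_congr_of_isOpen hF.isOpen hp (fun _ hq => hF.symm hq a b) d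

theorem lowerChristoffel_symm (hF : SmoothFields alg D G φ κ) (hp : p ∈ D) (d a b : Fin 4) :
    lowerChristoffel G p d a b = lowerChristoffel G p d b a := by
  simp only [lowerChristoffel, hF.pd_metric_symm hp d a b]
  ring

theorem christoffel_symm (hF : SmoothFields alg D G φ κ) (hp : p ∈ D) (c a b : Fin 4) :
    christoffel G p c a b = christoffel G p c b a := by
  simp only [christoffel_eq, hF.lowerChristoffel_symm hp _ a b]

theorem metric_mul_christoffel (hF : SmoothFields alg D G φ κ) (hp : p ∈ D) (d a b : Fin 4) :
    ∑ c, G p d c * christoffel G p c a b = lowerChristoffel G p d a b := by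
  simp only [christoffel_eq, Finset.mul_sum]
  rw [Finset.sum_comm]
  simp only [← mul_assoc, ← Finset.sum_mul, mul_invMetric (hF.det_ne_zero hp)]
  simp

/-- In the trace, the two derivative terms other than ∂_c g_{ed} are exchanged by the symmetry of
the metric and cancel. -/
theorem sum_christoffel (hF : SmoothFields alg D G φ κ) (hp : p ∈ D) (c : Fin 4) :
    ∑ d, christoffel G p d d c
      = (1 / 2) * ∑ d, ∑ e, invMetric (G p) d e * pd c (fun q => G q e d) p := by
  have h1 : ∑ d, ∑ e, invMetric (G p) d e * pd d (fun q => G q c e) p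
      = ∑ d, ∑ e, invMetric (G p) d e * pd e (fun q => G q d c) p := by
    rw [Finset.sum_comm]
    refine Finset.sum_congr rfl fun d _ => Finset.sum_congr rfl fun e _ => ?_
    rw [invMetric_symm (hF.symm hp), hF.pd_metric_symm hp e c d]
  simp only [christoffel, mul_add, mul_sub, Finset.sum_add_distrib, Finset.sum_sub_distrib,
    ← Finset.mul_sum]
  rw [h1]
  simp only [hF.pd_metric_symm hp c]
  ring

/-- `fderiv_volDensity` and the chain rule produce the trace computed in `sum_christoffel`. This is
what turns ordinary divergences of densities into covariant divergences. -/
theorem pd_volDensity (hF : SmoothFields alg D G φ κ) (hp : p ∈ D) (c : Fin 4) :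
    pd c (fun q => volDensity (G q)) p = (∑ d, christoffel G p d d c) * volDensity (G p) := by
  have h1 := ((SmoothAt.diff (contDiffAt_volDensity (hF.det_ne_zero hp))).hasFDerivAt.comp p
    (SmoothAt.diff (hF.metric p hp)).hasFDerivAt).fderiv
  have hd : DifferentiableAt ℝ G p := SmoothAt.diff (hF.metric p hp)
  have e : ∀ a b, pd c (fun q => G q a b) p = fderiv ℝ G p (stdVec c) a b := by
    intro a b
    rw [pd_apply (f := fun q => G q a) (by fun_prop), pd_apply hd]
    rfl
  rw [hF.sum_christoffel hp]
  simp only [e]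
  rw [← fderiv_volDensity (hF.det_ne_zero hp)]
  simp only [pd]
  rw [show (fun q => volDensity (G q)) = volDensity ∘ G from rfl, h1]
  rfl

theorem contDiffAt_prolong (hF : SmoothFields alg D G φ κ) (ρ : TensorType W) (hp : p ∈ D) :
    ContDiffAt ℝ ∞ (prolong ρ G φ κ) p :=
  CovariantFields.contDiffAt_prolong ρ (hF.det_ne_zero hp) (hF.metric p hp) (hF.matter p hp)
    (hF.conn p hp)

theorem contDiffAt_volDensity (hF : SmoothFields alg D G φ κ) (hp : p ∈ D) :
    ContDiffAt ℝ ∞ (fun q => volDensity (G q)) p :=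
  contDiffAt_volDensity_comp (hF.det_ne_zero hp) (hF.metric p hp)

theorem contDiffAt_christoffel (hF : SmoothFields alg D G φ κ) (hp : p ∈ D) (c a b : Fin 4) :
    ContDiffAt ℝ ∞ (fun q => christoffel G q c a b) p :=
  CovariantFields.contDiffAt_christoffel (hF.det_ne_zero hp) (hF.metric p hp) c a b

theorem contDiffAt_invMetric (hF : SmoothFields alg D G φ κ) (hp : p ∈ D) (a b : Fin 4) :
    ContDiffAt ℝ ∞ (fun q => invMetric (G q) a b) p :=
  contDiffAt_invMetric_comp (hF.det_ne_zero hp) (hF.metric p hp) a b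

theorem contDiffAt_fderiv (hF : SmoothFields alg D G φ κ) (ρ : TensorType W)
    (hL : IsSmoothExtension alg ℓ L) (hp : p ∈ D) {v : V4 → Prolong n W}
    (hv : ContDiffAt ℝ ∞ v p) :
    ContDiffAt ℝ ∞ (fun q => fderiv ℝ L (prolong ρ G φ κ q) (v q)) p :=
  contDiffAt_fderiv_lagrangian ρ (hL.smooth _ (hF.prolong_admissible ρ hp)) (hF.det_ne_zero hp)
    (hF.metric p hp) (hF.matter p hp) (hF.conn p hp) hv

theorem contDiffAt_lagrangian (hF : SmoothFields alg D G φ κ) (ρ : TensorType W)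
    (hL : IsSmoothExtension alg ℓ L) (hp : p ∈ D) :
    ContDiffAt ℝ ∞ (fun q => L (prolong ρ G φ κ q)) p :=
  (hL.smooth _ (hF.prolong_admissible ρ hp)).comp p (hF.contDiffAt_prolong ρ hp)

end SmoothFields

/-! ### Partial derivatives of the Lagrangian -/

/-- The symmetric arrays with respect to which the derivatives of a Lagrangian are taken. -/
noncomputable def symUnit (a b c d : Fin 4) : ℝ :=
  (1 / 2) * ((if c = a ∧ d = b then 1 else 0) + (if c = b ∧ d = a then 1 else 0))

theorem symUnit_symm (a b c d : Fin 4) : symUnit a b c d = symUnit a b d c := by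
  simp only [symUnit, and_comm, add_comm]

theorem sum_symUnit {k : Fin 4 → Fin 4 → ℝ} (hk : ∀ a b, k a b = k b a) (c d : Fin 4) :
    ∑ a, ∑ b, k a b * symUnit a b c d = k c d := by
  simp only [symUnit, mul_add, Finset.sum_add_distrib, ite_and, mul_ite, mul_one, mul_zero,
    Finset.sum_ite_eq, Finset.mem_univ, if_true, Finset.sum_ite_irrel, Finset.sum_const_zero]
  rw [hk d c]; ring

/-- The symmetrised unit array is a direction inside `prolongSpace`, so `ℓ` and its extension agree
along the entire line. This symmetrisation is what makes the derivative independent of the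
extension. -/
theorem metricDeriv_eq (hL : IsSmoothExtension alg ℓ L) {q : Prolong n W}
    (hq : q ∈ admissible W alg) (a b : Fin 4) :
    metricDeriv ℓ q a b = fderiv ℝ L q (symUnit a b, 0) := by
  have h1 := hasDerivAt_line (SmoothAt.diff (hL.smooth q hq))
    ((symUnit a b, 0) : Prolong n W)
  rw [← h1.deriv, metricDeriv]
  congr 1
  funext ε
  have hm := admissible_subset_prolongSpace alg hq
  have : q + ε • ((symUnit a b, 0) : Prolong n W) ∈ prolongSpace W alg := by
    refine (prolongSpace W alg).add_mem hm ((prolongSpace W alg).smul_mem ε ?_)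
    exact ⟨symUnit_symm a b, fun a b i j => by simp, fun a b => alg.zero_mem⟩
  rw [hL.eq _ this]
  congr 1
  refine Prod.ext rfl ?_
  simp

theorem sum_metricDeriv (hL : IsSmoothExtension alg ℓ L) {q : Prolong n W}
    (hq : q ∈ admissible W alg) {k : Fin 4 → Fin 4 → ℝ} (hk : ∀ a b, k a b = k b a) :
    ∑ a, ∑ b, metricDeriv ℓ q a b * k a b = fderiv ℝ L q (k, 0) := by
  have e : ((k, 0) : Prolong n W) = ∑ a, ∑ b, k a b • ((symUnit a b, 0) : Prolong n W) := by
    refine Prod.ext ?_ ?_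
    · funext c d
      simp [Prod.fst_sum, Finset.sum_apply, sum_symUnit hk]
    · simp [Prod.snd_sum]
  rw [e]
  simp only [map_sum, map_smul, smul_eq_mul, metricDeriv_eq hL hq]
  exact Finset.sum_congr rfl fun a _ => Finset.sum_congr rfl fun b _ => mul_comm _ _

theorem spinMomentum_eq (hL : IsSmoothExtension alg ℓ L)
    (hq : prolong ρ G φ κ p ∈ admissible W alg) (a b c : Fin 4) :
    spinMomentum ρ ℓ G φ κ p a b c = fderiv ℝ L (prolong ρ G φ κ p)
      (0, 0, fun a' i => if a' = a then ρ.inf (elemEnd c b) (φ p i) else 0, 0) := by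
  have h1 := hasDerivAt_line (SmoothAt.diff (hL.smooth _ hq))
    ((0, 0, fun a' i => if a' = a then ρ.inf (elemEnd c b) (φ p i) else 0, 0) : Prolong n W)
  rw [← h1.deriv, spinMomentum]
  congr 1
  funext ε
  have hm := admissible_subset_prolongSpace alg hq
  have : prolong ρ G φ κ p + ε • ((0, 0, fun a' i =>
      if a' = a then ρ.inf (elemEnd c b) (φ p i) else 0, 0) : Prolong n W)
      ∈ prolongSpace W alg := by
    refine (prolongSpace W alg).add_mem hm ((prolongSpace W alg).smul_mem ε ?_)
    exact ⟨fun a b => rfl, fun a b i j => by simp, fun a b => alg.zero_mem⟩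
  rw [hL.eq _ this]
  congr 1
  simp only [prolong, Prod.smul_mk, Prod.mk_add_mk, smul_zero, add_zero]
  refine Prod.ext rfl (Prod.ext rfl (Prod.ext ?_ rfl))
  funext a' i
  simp [smul_ite]

/-- For K = δΓ this is the term of the chain rule by which the Lagrangian feels the variation of the
spacetime connection. It follows by expanding the direction in elementary endomorphisms. -/
theorem sum_spinMomentum (hL : IsSmoothExtension alg ℓ L)
    (hq : prolong ρ G φ κ p ∈ admissible W alg) (K : Fin 4 → Fin 4 → Fin 4 → ℝ) :
    ∑ a, ∑ b, ∑ c, spinMomentum ρ ℓ G φ κ p a b c * K c a b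
      = fderiv ℝ L (prolong ρ G φ κ p)
        (0, 0, fun a i => ρ.act (fun c b => K c a b) (φ p i), 0) := by
  have e : ((0, 0, fun a i => ρ.act (fun c b => K c a b) (φ p i), 0) : Prolong n W)
      = ∑ a, ∑ b, ∑ c, K c a b • ((0, 0, fun a' i =>
        if a' = a then ρ.inf (elemEnd c b) (φ p i) else 0, 0) : Prolong n W) := by
    refine Prod.ext ?_ (Prod.ext ?_ (Prod.ext ?_ ?_))
    · simp [Prod.fst_sum]
    · simp [Prod.fst_sum, Prod.snd_sum]
    · funext a i
      simp only [Prod.fst_sum, Prod.snd_sum, Finset.sum_apply, Prod.smul_mk, Pi.smul_apply,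
        smul_ite, smul_zero, Finset.sum_ite_irrel, Finset.sum_const_zero, Finset.sum_ite_eq,
        Finset.mem_univ, if_true, ρ.act_apply]
      rw [Finset.sum_comm]
    · simp [Prod.snd_sum]
  rw [e]
  simp only [map_sum, map_smul, smul_eq_mul, spinMomentum_eq hL hq]
  exact Finset.sum_congr rfl fun a _ => Finset.sum_congr rfl fun b _ =>
    Finset.sum_congr rfl fun c _ => mul_comm _ _

theorem SmoothFields.contDiffAt_spinMomentumUp (hF : SmoothFields alg D G φ κ)
    (hL : IsSmoothExtension alg ℓ L) (hp : p ∈ D) (a b d : Fin 4) :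
    ContDiffAt ℝ ∞ (fun q => spinMomentumUp ρ ℓ G φ κ q a b d) p := by
  refine ContDiffAt.sum fun c _ => ContDiffAt.mul ?_ (hF.contDiffAt_invMetric hp c d)
  have e : (fun q => spinMomentum ρ ℓ G φ κ q a b c) =ᶠ[nhds p] fun q =>
      fderiv ℝ L (prolong ρ G φ κ q)
        (0, 0, fun a' i => if a' = a then ρ.inf (elemEnd c b) (φ q i) else 0, 0) :=
    Filter.eventuallyEq_of_mem (hF.isOpen.mem_nhds hp) fun q hq =>
      spinMomentum_eq hL (hF.prolong_admissible ρ hq) a b c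
  refine ContDiffAt.congr_of_eventuallyEq (hF.contDiffAt_fderiv ρ hL hp ?_) e
  refine contDiffAt_const.prodMk (contDiffAt_const.prodMk (ContDiffAt.prodMk ?_ contDiffAt_const))
  refine contDiffAt_pi.2 fun a' => contDiffAt_pi.2 fun i => ?_
  have := hF.matter p hp
  split_ifs <;> fun_prop

theorem SmoothFields.contDiffAt_metricDeriv (hF : SmoothFields alg D G φ κ)
    (hL : IsSmoothExtension alg ℓ L) (hp : p ∈ D) (a b : Fin 4) :
    ContDiffAt ℝ ∞ (fun q => metricDeriv ℓ (prolong ρ G φ κ q) a b) p := by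
  refine ContDiffAt.congr_of_eventuallyEq (hF.contDiffAt_fderiv ρ hL hp
    (contDiffAt_const (c := ((symUnit a b, 0) : Prolong n W)))) ?_
  exact Filter.eventuallyEq_of_mem (hF.isOpen.mem_nhds hp) fun q hq =>
    metricDeriv_eq hL (hF.prolong_admissible ρ hq) a b

theorem SmoothFields.contDiffAt_lagrangian_expr (hF : SmoothFields alg D G φ κ)
    (hL : IsSmoothExtension alg ℓ L) (hp : p ∈ D) :
    ContDiffAt ℝ ∞ (fun q => ℓ (prolong ρ G φ κ q)) p :=
  (hF.contDiffAt_lagrangian ρ hL hp).congr_of_eventuallyEq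
    (Filter.eventuallyEq_of_mem (hF.isOpen.mem_nhds hp) fun _ hq =>
      (hL.eq _ (hF.prolong_mem ρ hq)).symm)

/-- The combination of the spin momentum contracted with the covariant derivative of the variation
of the metric. -/
noncomputable def spinCombination (ρ : TensorType W) (ℓ : Prolong n W → ℝ)
    (G : V4 → Fin 4 → Fin 4 → ℝ) (φ : V4 → Fin n → W)
    (κ : V4 → Fin 4 → Fin n → Fin n → ℝ) (p : V4) (c a b : Fin 4) : ℝ :=
  spinMomentumUp ρ ℓ G φ κ p c a b + spinMomentumUp ρ ℓ G φ κ p a c b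
    - spinMomentumUp ρ ℓ G φ κ p a b c

theorem connTerm_eq (p : V4) (a b : Fin 4) : connTerm ρ ℓ G φ κ p a b =
    (-1 / 4) * (divergence₃ G (spinCombination ρ ℓ G φ κ) p a b
      + divergence₃ G (spinCombination ρ ℓ G φ κ) p b a) := rfl

theorem SmoothFields.contDiffAt_spinCombination (hF : SmoothFields alg D G φ κ)
    (hL : IsSmoothExtension alg ℓ L) (hp : p ∈ D) (c a b : Fin 4) :
    ContDiffAt ℝ ∞ (fun q => spinCombination ρ ℓ G φ κ q c a b) p :=
  ((hF.contDiffAt_spinMomentumUp hL hp c a b).add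
    (hF.contDiffAt_spinMomentumUp hL hp a c b)).sub (hF.contDiffAt_spinMomentumUp hL hp a b c)

theorem SmoothFields.contDiffAt_divergence₃ (hF : SmoothFields alg D G φ κ)
    {X : V4 → Fin 4 → Fin 4 → Fin 4 → ℝ}
    (hX : ∀ c a b, ContDiffAt ℝ ∞ (fun q => X q c a b) p) (hp : p ∈ D) (a b : Fin 4) :
    ContDiffAt ℝ ∞ (fun q => divergence₃ G X q a b) p := by
  have hΓ := hF.contDiffAt_christoffel hp
  refine ContDiffAt.sum fun c _ => (SmoothAt.pd (hX c a b) c).add (ContDiffAt.sum fun d _ => ?_)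
  exact (((hΓ c c d).mul (hX d a b)).add ((hΓ a c d).mul (hX c d b))).add
    ((hΓ b c d).mul (hX c a d))

theorem SmoothFields.contDiffAt_stressEnergy (hF : SmoothFields alg D G φ κ)
    (hL : IsSmoothExtension alg ℓ L) (hp : p ∈ D) (a b : Fin 4) :
    ContDiffAt ℝ ∞ (fun q => stressEnergy ρ ℓ G φ κ q a b) p := by
  have hX := hF.contDiffAt_divergence₃ (hF.contDiffAt_spinCombination (ρ := ρ) hL hp) hp
  refine ((hF.contDiffAt_metricDeriv hL hp a b).add
    ((contDiffAt_const.mul (hF.contDiffAt_lagrangian_expr hL hp)).mul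
      (hF.contDiffAt_invMetric hp a b))).add ?_
  exact contDiffAt_const.mul ((hX a b).add (hX b a))

theorem metricDeriv_symm {W : Type*} (ℓ : Prolong n W → ℝ) (q : Prolong n W) (a b : Fin 4) :
    metricDeriv ℓ q a b = metricDeriv ℓ q b a := by
  simp only [metricDeriv, add_comm]

theorem SmoothFields.stressEnergy_symm (hF : SmoothFields alg D G φ κ) (hp : p ∈ D)
    (a b : Fin 4) : stressEnergy ρ ℓ G φ κ p a b = stressEnergy ρ ℓ G φ κ p b a := by
  simp only [stressEnergy, connTerm_eq]
  rw [metricDeriv_symm, invMetric_symm (hF.symm hp), add_comm (divergence₃ _ _ _ a b)]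

/-! ### The response to the deformations of the metric -/

/-- The components of the covariant derivative of a covariant tensor of rank 2. -/
noncomputable def covDeriv₂ (G h : V4 → Fin 4 → Fin 4 → ℝ) (p : V4) (c a b : Fin 4) : ℝ :=
  pd c (fun q => h q a b) p - ∑ e, christoffel G p e c a * h p e b
    - ∑ e, christoffel G p e c b * h p a e

/-- Of the six connection terms on the right, four cancel in pairs because Γ and h are symmetric;
the other two coincide and, with the factor ½, give h_{de} Γ^e_{ab}. -/
theorem SmoothFields.dChristoffel_eq (hF : SmoothFields alg D G φ κ) (hp : p ∈ D)
    (hs : ∀ q a b, h q a b = h q b a) (c a b : Fin 4) :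
    dChristoffel G h p c a b = ∑ d, invMetric (G p) c d *
      ((1 / 2) * (covDeriv₂ G h p a b d + covDeriv₂ G h p b a d - covDeriv₂ G h p d a b)) := by
  refine Finset.sum_congr rfl fun d _ => ?_
  congr 1
  have e1 : ∑ e, christoffel G p e b a * h p e d = ∑ e, h p d e * christoffel G p e a b :=
    Finset.sum_congr rfl fun e _ => by rw [hs p e d, hF.christoffel_symm hp e b a]; ring
  have e2 : ∑ e, christoffel G p e a b * h p e d = ∑ e, h p d e * christoffel G p e a b :=
    Finset.sum_congr rfl fun e _ => by rw [hs p e d]; ring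
  have e3 : ∑ e, christoffel G p e a d * h p b e = ∑ e, christoffel G p e d a * h p e b :=
    Finset.sum_congr rfl fun e _ => by rw [hs p e b, hF.christoffel_symm hp e a d]
  have e4 : ∑ e, christoffel G p e b d * h p a e = ∑ e, christoffel G p e d b * h p a e :=
    Finset.sum_congr rfl fun e _ => by rw [hF.christoffel_symm hp e b d]
  simp only [lowerChristoffel, covDeriv₂, e1, e2, e3, e4]
  ring

/-- Renaming the summed indices shifts the permutations from the three terms ∇h onto the spin
momentum, which is how the combination B^{cab} + B^{acb} - B^{abc} arises. -/
theorem SmoothFields.sum_spinMomentum_dChristoffel (hF : SmoothFields alg D G φ κ) (hp : p ∈ D)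
    (hs : ∀ q a b, h q a b = h q b a) :
    ∑ a, ∑ b, ∑ c, spinMomentum ρ ℓ G φ κ p a b c * dChristoffel G h p c a b
      = (1 / 2) * ∑ c, ∑ a, ∑ b, spinCombination ρ ℓ G φ κ p c a b * covDeriv₂ G h p c a b := by
  set B := spinMomentumUp ρ ℓ G φ κ p with hB
  set N := covDeriv₂ G h p with hN
  have h1 : ∀ a b, ∑ c, spinMomentum ρ ℓ G φ κ p a b c * dChristoffel G h p c a b
      = ∑ d, B a b d * ((1 / 2) * (N a b d + N b a d - N d a b)) := by
    intro a b
    simp only [hF.dChristoffel_eq hp hs, hB, spinMomentumUp, Finset.mul_sum, Finset.sum_mul]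
    rw [Finset.sum_comm]
    exact Finset.sum_congr rfl fun c _ => Finset.sum_congr rfl fun d _ => by rw [mul_assoc]
  have h2 : ∑ a, ∑ b, ∑ d, B a b d * N b a d = ∑ c, ∑ a, ∑ b, B a c b * N c a b :=
    Finset.sum_comm
  have h3 : ∑ a, ∑ b, ∑ d, B a b d * N d a b = ∑ c, ∑ a, ∑ b, B a b c * N c a b := by
    rw [Finset.sum_congr rfl fun a _ => Finset.sum_comm]
    exact Finset.sum_comm
  have e : ∀ a b d, B a b d * ((1 / 2) * (N a b d + N b a d - N d a b))
      = (1 / 2) * (B a b d * N a b d + B a b d * N b a d - B a b d * N d a b) := by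
    intros; ring
  have e' : ∀ c a b, spinCombination ρ ℓ G φ κ p c a b * N c a b
      = B c a b * N c a b + B a c b * N c a b - B a b c * N c a b := by
    intros; simp only [spinCombination, hB]; ring
  simp only [h1, e, e', ← Finset.mul_sum, Finset.sum_add_distrib, Finset.sum_sub_distrib, h2, h3]

/-- The Leibniz rule and the formula for the divergence of a vector density. -/
theorem SmoothFields.sum_pd_contraction (hF : SmoothFields alg D G φ κ) (hp : p ∈ D)
    {X : V4 → Fin 4 → Fin 4 → Fin 4 → ℝ}
    (hX : ∀ c a b, ContDiffAt ℝ ∞ (fun q => X q c a b) p) (hh : ContDiffAt ℝ ∞ h p) :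
    ∑ c, pd c (fun q => (∑ a, ∑ b, X q c a b * h q a b) * volDensity (G q)) p
      = ((∑ c, ∑ a, ∑ b, X p c a b * covDeriv₂ G h p c a b)
        + ∑ a, ∑ b, divergence₃ G X p a b * h p a b) * volDensity (G p) := by
  have hX' := fun c a b => SmoothAt.diff (hX c a b)
  have hh' : ∀ a b, DifferentiableAt ℝ (fun q => h q a b) p := fun a b => by
    have := SmoothAt.diff hh
    fun_prop
  have hXh : ∀ c a b, DifferentiableAt ℝ (fun q => X q c a b * h q a b) p := fun c a b =>
    (hX' c a b).mul (hh' a b)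
  have hv := SmoothAt.diff (hF.contDiffAt_volDensity hp)
  have e1 : ∀ c, pd c (fun q => (∑ a, ∑ b, X q c a b * h q a b) * volDensity (G q)) p
      = ((∑ a, ∑ b, (pd c (fun q => X q c a b) p * h p a b
          + X p c a b * pd c (fun q => h q a b) p))
        + (∑ a, ∑ b, X p c a b * h p a b) * ∑ d, christoffel G p d d c) * volDensity (G p) := by
    intro c
    rw [pd_mul (DifferentiableAt.fun_sum fun a _ => DifferentiableAt.fun_sum fun b _ =>
      hXh c a b) hv, hF.pd_volDensity hp,
      pd_sum fun a _ => DifferentiableAt.fun_sum fun b _ => hXh c a b]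
    have : ∀ a, pd c (fun q => ∑ b, X q c a b * h q a b) p
        = ∑ b, (pd c (fun q => X q c a b) p * h p a b
          + X p c a b * pd c (fun q => h q a b) p) := by
      intro a
      rw [pd_sum fun b _ => hXh c a b]
      exact Finset.sum_congr rfl fun b _ => pd_mul (hX' c a b) (hh' a b) c
    simp only [this]
    ring
  simp only [e1]
  rw [← Finset.sum_mul]
  congr 1
  have t1 : ∑ a, ∑ b, divergence₃ G X p a b * h p a b
      = ∑ c, ∑ a, ∑ b, pd c (fun q => X q c a b) p * h p a b
        + ∑ a, ∑ b, ∑ c, ∑ d, christoffel G p c c d * X p d a b * h p a b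
        + ∑ a, ∑ b, ∑ c, ∑ d, christoffel G p a c d * X p c d b * h p a b
        + ∑ a, ∑ b, ∑ c, ∑ d, christoffel G p b c d * X p c a d * h p a b := by
    simp only [divergence₃, Finset.sum_mul, add_mul, Finset.sum_add_distrib]
    have : ∑ a, ∑ b, ∑ c, pd c (fun q => X q c a b) p * h p a b
        = ∑ c, ∑ a, ∑ b, pd c (fun q => X q c a b) p * h p a b := by
      rw [Finset.sum_congr rfl fun a _ => Finset.sum_comm]
      rw [Finset.sum_comm]
    rw [this]
    ring
  have t2 : ∑ c, ∑ a, ∑ b, X p c a b * covDeriv₂ G h p c a b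
      = ∑ c, ∑ a, ∑ b, X p c a b * pd c (fun q => h q a b) p
        - ∑ c, ∑ a, ∑ b, ∑ e, X p c a b * (christoffel G p e c a * h p e b)
        - ∑ c, ∑ a, ∑ b, ∑ e, X p c a b * (christoffel G p e c b * h p a e) := by
    simp only [covDeriv₂, mul_sub, Finset.sum_sub_distrib, Finset.mul_sum]
  -- The connection terms on the last two indices of X cancel against those of ∇h (`t3`, `t4`); the
  -- one on the first index is the derivative of the volume density (`t5`). All three identities are
  -- relabellings of summed indices.
  have t3 : ∑ a, ∑ b, ∑ c, ∑ d, christoffel G p a c d * X p c d b * h p a b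
      = ∑ c, ∑ a, ∑ b, ∑ e, X p c a b * (christoffel G p e c a * h p e b) := by
    simp only [Fin.sum_univ_four]
    ring
  have t4 : ∑ a, ∑ b, ∑ c, ∑ d, christoffel G p b c d * X p c a d * h p a b
      = ∑ c, ∑ a, ∑ b, ∑ e, X p c a b * (christoffel G p e c b * h p a e) := by
    simp only [Fin.sum_univ_four]
    ring
  have t5 : ∑ a, ∑ b, ∑ c, ∑ d, christoffel G p c c d * X p d a b * h p a b
      = ∑ c, (∑ a, ∑ b, X p c a b * h p a b) * ∑ d, christoffel G p d d c := by
    simp only [Fin.sum_univ_four]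
    ring
  rw [t1, t2, t3, t4, t5]
  simp only [Finset.sum_add_distrib]
  ring

end Response

/-! ### First variation of the Lagrangian density and the metric response -/

section MetricResponse

variable {W : Type*} [NormedAddCommGroup W] [NormedSpace ℝ W] {n : ℕ}
variable {alg : Submodule ℝ (Matrix (Fin n) (Fin n) ℝ)} {D : Set V4} {ρ : TensorType W}
  {ℓ L : Prolong n W → ℝ} {G h : V4 → Fin 4 → Fin 4 → ℝ} {φ δφ : V4 → Fin n → W}
  {κ δκ : V4 → Fin 4 → Fin n → Fin n → ℝ} {p : V4}

/-- The Lagrangian density at a point depends only on the germs of the fields. -/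
theorem lagDensity_congr {G' : V4 → Fin 4 → Fin 4 → ℝ} {φ' : V4 → Fin n → W}
    {κ' : V4 → Fin 4 → Fin n → Fin n → ℝ} (hG : G =ᶠ[nhds p] G') (hφ : φ =ᶠ[nhds p] φ')
    (hκ : κ =ᶠ[nhds p] κ') : lagDensity ρ ℓ G φ κ p = lagDensity ρ ℓ G' φ' κ' p := by
  have eG : ∀ a b c, pd c (fun q => G q a b) p = pd c (fun q => G' q a b) p := fun a b c =>
    pd_congr (hG.mono fun q hq => by simp only [hq]) c
  have eφ : ∀ i a, pd a (fun q => φ q i) p = pd a (fun q => φ' q i) p := fun i a =>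
    pd_congr (hφ.mono fun q hq => by simp only [hq]) a
  have eκ : ∀ a b i j, pd a (fun q => κ q b i j) p = pd a (fun q => κ' q b i j) p :=
    fun a b i j => pd_congr (hκ.mono fun q hq => by simp only [hq]) a
  have e1 : covDiff ρ G φ κ p = covDiff ρ G' φ' κ' p := by
    funext a i
    simp only [covDiff, christoffel, eG, eφ, hG.eq_of_nhds, hφ.eq_of_nhds, hκ.eq_of_nhds]
  have e2 : curv κ p = curv κ' p := by
    funext a b i j
    simp only [curv, eκ, hκ.eq_of_nhds]
  simp only [lagDensity, prolong, e1, e2, hG.eq_of_nhds, hφ.eq_of_nhds]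

theorem add_smul_eventuallyEq {X : Type*} [NormedAddCommGroup X] [NormedSpace ℝ X]
    {f δ : V4 → X} (hδ : p ∉ tsupport δ) (ε : ℝ) : (f + ε • δ) =ᶠ[nhds p] f := by
  filter_upwards [eventually_eq_zero_of_notMem_tsupport hδ] with q hq
  simp [hq]

/-- The first variation of the Lagrangian density vanishes away from the variations. -/
theorem deriv_lagDensity_eq_zero (hh : p ∉ tsupport h) (hφ : p ∉ tsupport δφ)
    (hκ : p ∉ tsupport δκ) :
    deriv (fun ε : ℝ => lagDensity ρ ℓ (G + ε • h) (φ + ε • δφ) (κ + ε • δκ) p) 0 = 0 := by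
  have : (fun ε : ℝ => lagDensity ρ ℓ (G + ε • h) (φ + ε • δφ) (κ + ε • δκ) p)
      = fun _ => lagDensity ρ ℓ G φ κ p := by
    funext ε
    exact lagDensity_congr (add_smul_eventuallyEq hh ε) (add_smul_eventuallyEq hφ ε)
      (add_smul_eventuallyEq hκ ε)
  rw [this, deriv_const]

/-- The varied prolongation stays in `prolongSpace` for every ε, where the Lagrangian equals its
smooth extension; the chain rule for the extension then gives the derivative. -/
theorem SmoothFields.deriv_lagDensity (hF : SmoothFields alg D G φ κ)
    (hL : IsSmoothExtension alg ℓ L) (hp : p ∈ D)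
    (hh : ContDiffAt ℝ ∞ h p) (hδφ : ContDiffAt ℝ ∞ δφ p) (hδκ : ContDiffAt ℝ ∞ δκ p)
    (hs : ∀ a b, h p a b = h p b a) (hmem : ∀ᶠ q in nhds p, ∀ a, Matrix.of (δκ q a) ∈ alg) :
    deriv (fun ε : ℝ => lagDensity ρ ℓ (G + ε • h) (φ + ε • δφ) (κ + ε • δκ) p) 0
      = (fderiv ℝ L (prolong ρ G φ κ p) (dProlong ρ G φ κ h δφ δκ p)
        + L (prolong ρ G φ κ p) * ((1 / 2) * ∑ a, ∑ b, invMetric (G p) a b * h p b a))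
          * volDensity (G p) := by
  have e : (fun ε : ℝ => lagDensity ρ ℓ (G + ε • h) (φ + ε • δφ) (κ + ε • δκ) p)
      = fun ε : ℝ => lagDensity ρ L (G + ε • h) (φ + ε • δφ) (κ + ε • δκ) p := by
    funext ε
    simp only [lagDensity]
    rw [hL.eq]
    refine prolong_mem_prolongSpace ρ hF.lie_mem (fun a b => ?_) ?_ ?_
    · simp [hF.symm hp a b, hs a b]
    · exact (SmoothAt.diff (hF.conn p hp)).add ((SmoothAt.diff hδκ).const_smul ε)
    · filter_upwards [hF.eventually_conn_mem hp, hmem] with q h1 h2 a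
      exact alg.add_mem (h1 a) (alg.smul_mem ε (h2 a))
  rw [e]
  exact (hasDerivAt_lagDensity ρ (SmoothAt.diff (hL.smooth _ (hF.prolong_admissible ρ hp)))
    (hF.det_ne_zero hp) (SmoothAt.diff (hF.metric p hp)) (SmoothAt.diff hh)
    (SmoothAt.diff (hF.matter p hp)) (SmoothAt.diff hδφ) (SmoothAt.diff (hF.conn p hp))
    (SmoothAt.diff hδκ)).deriv

theorem dProlong_metric (ρ : TensorType W) (G h : V4 → Fin 4 → Fin 4 → ℝ) (φ : V4 → Fin n → W)
    (κ : V4 → Fin 4 → Fin n → Fin n → ℝ) (p : V4) :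
    dProlong ρ G φ κ h 0 0 p = ((h p, 0) : Prolong n W)
      + (0, 0, fun a i => ρ.act (fun c b => dChristoffel G h p c a b) (φ p i), 0) := by
  refine Prod.ext (by simp [dProlong]) (Prod.ext (by simp [dProlong]) (Prod.ext ?_ ?_))
  · funext a i
    simp [dProlong, dCovDiff, pd_zero]
  · funext a b i j
    simp [dProlong, dCurv, pd_zero]

/-- The first variation of the Lagrangian density when the metric varies is the contraction with
the stress-energy tensor, up to a divergence. -/
theorem SmoothFields.deriv_lagDensity_metric (hF : SmoothFields alg D G φ κ)
    (hL : IsSmoothExtension alg ℓ L) (hp : p ∈ D)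
    (hh : ContDiffAt ℝ ∞ h p) (hs : ∀ q a b, h q a b = h q b a) :
    deriv (fun ε : ℝ => lagDensity ρ ℓ (G + ε • h) φ κ p) 0
      = (∑ a, ∑ b, stressEnergy ρ ℓ G φ κ p a b * h p a b) * volDensity (G p)
        + (1 / 2) * ∑ c, pd c (fun q => (∑ a, ∑ b, spinCombination ρ ℓ G φ κ q c a b * h q a b)
          * volDensity (G q)) p := by
  have h1 := hF.deriv_lagDensity (ρ := ρ) (δφ := 0) (δκ := 0) hL hp hh contDiffAt_const
    contDiffAt_const (hs p) (Filter.Eventually.of_forall fun q a => alg.zero_mem)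
  simp only [smul_zero, add_zero] at h1
  have hq := hF.prolong_admissible ρ hp
  rw [h1, dProlong_metric, map_add, ← sum_metricDeriv hL hq (hs p), ← sum_spinMomentum hL hq,
    hF.sum_spinMomentum_dChristoffel hp hs, hL.eq _ (hF.prolong_mem ρ hp),
    hF.sum_pd_contraction hp (hF.contDiffAt_spinCombination hL hp) hh]
  have e1 : ∑ a, ∑ b, invMetric (G p) a b * h p b a = ∑ a, ∑ b, invMetric (G p) a b * h p a b :=
    Finset.sum_congr rfl fun a _ => Finset.sum_congr rfl fun b _ => by rw [hs p b a]
  -- Since h is symmetric, the two divergences in `connTerm` contract to the same number; thus the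
  -- coefficient -1/4 there amounts to the -1/2 left by the Leibniz rule.
  have e2 : ∑ a, ∑ b, divergence₃ G (spinCombination ρ ℓ G φ κ) p b a * h p a b
      = ∑ a, ∑ b, divergence₃ G (spinCombination ρ ℓ G φ κ) p a b * h p a b := by
    rw [Finset.sum_comm]
    exact Finset.sum_congr rfl fun a _ => Finset.sum_congr rfl fun b _ => by rw [hs p b a]
  have e3 : ∑ a, ∑ b, stressEnergy ρ ℓ G φ κ p a b * h p a b
      = ∑ a, ∑ b, metricDeriv ℓ (prolong ρ G φ κ p) a b * h p a b
        + (1 / 2) * ℓ (prolong ρ G φ κ p) * ∑ a, ∑ b, invMetric (G p) a b * h p a b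
        + (-1 / 4) * (∑ a, ∑ b, divergence₃ G (spinCombination ρ ℓ G φ κ) p a b * h p a b
          + ∑ a, ∑ b, divergence₃ G (spinCombination ρ ℓ G φ κ) p b a * h p a b) := by
    simp only [stressEnergy, connTerm_eq, Finset.mul_sum, ← Finset.sum_add_distrib]
    exact Finset.sum_congr rfl fun a _ => Finset.sum_congr rfl fun b _ => by ring
  rw [e3, e2, e1]
  ring

/-- Integration of an identity up to a divergence. -/
theorem integral_eq_of_divergence {Z : Type*} [Zero Z] {u : V4 → Z} {f g : V4 → ℝ}
    {V : Fin 4 → V4 → ℝ} (hu : HasCompactSupport u) (huD : tsupport u ⊆ D)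
    (hg : ∀ p ∈ D, ContDiffAt ℝ ∞ g p) (hV : ∀ c, ∀ p ∈ D, ContDiffAt ℝ ∞ (V c) p)
    (hf0 : ∀ p, p ∉ tsupport u → f p = 0) (hg0 : ∀ p, p ∉ tsupport u → g p = 0)
    (hV0 : ∀ c p, p ∉ tsupport u → V c p = 0)
    (h : ∀ p ∈ D, f p = g p + ∑ c, pd c (V c) p) : ∫ p, f p = ∫ p, g p := by
  have hVs : ∀ c, tsupport (V c) ⊆ tsupport u := fun c => tsupport_subset_of_eq_zero (hV0 c)
  have hVc : ∀ c, HasCompactSupport (V c) := fun c => hasCompactSupport_of_eq_zero hu (hV0 c)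
  have hVd : ∀ c, ContDiff ℝ ∞ (V c) := fun c =>
    contDiff_of_tsupport_subset (hV c) ((hVs c).trans huD)
  have hpd0 : ∀ c p, p ∉ tsupport u → pd c (V c) p = 0 := fun c p hp =>
    pd_eq_zero_of_notMem_tsupport (fun hn => hp (hVs c hn)) c
  -- Off the support of u all terms vanish, so the identity known on D holds on the whole coordinate
  -- space.
  have e : ∀ p, f p = g p + ∑ c, pd c (V c) p := by
    intro p
    by_cases hp : p ∈ tsupport u
    · exact h p (huD hp)
    · simp [hf0 p hp, hg0 p hp, hpd0 _ p hp]
  have hi : ∀ c, Integrable (pd c (V c)) := fun c =>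
    integrable_of_smooth (fun p hp => SmoothAt.pd (hV c p hp) c) hu huD (hpd0 c)
  simp only [e]
  rw [integral_add (integrable_of_smooth hg hu huD hg0) (integrable_finsetSum _ fun c _ => hi c),
    integral_finsetSum _ fun c _ => hi c]
  simp [integral_pd_eq_zero (hVd _) (hVc _)]

/-- Integration of the pointwise identity `SmoothFields.deriv_lagDensity_metric`: the vector density
under the divergence is linear in h, hence compactly supported in D. The ε-derivative already stands
under the integral sign, so nothing has to be interchanged. -/
theorem SmoothFields.isMetricResponse (hF : SmoothFields alg D G φ κ)
    (hL : IsSmoothExtension alg ℓ L) :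
    IsMetricResponse ρ ℓ G φ κ D (stressEnergy ρ ℓ G φ κ) := by
  refine ⟨fun p hp => hF.stressEnergy_symm hp, fun h hh hc hD hs => ?_⟩
  have hh' : ∀ (a b : Fin 4) p, ContDiffAt ℝ ∞ (fun q => h q a b) p := fun a b p => by
    have := hh.contDiffAt (x := p)
    fun_prop
  have h0 : ∀ p, p ∉ tsupport h → ∀ a b, h p a b = 0 := fun p hp a b => by
    rw [image_eq_zero_of_notMem_tsupport hp]; rfl
  refine integral_eq_of_divergence (V := fun c q => (1 / 2) * ((∑ a, ∑ b,
    spinCombination ρ ℓ G φ κ q c a b * h q a b) * volDensity (G q))) hc hD ?_ ?_ ?_ ?_ ?_ ?_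
  · intro p hp
    exact (ContDiffAt.sum fun a _ => ContDiffAt.sum fun b _ =>
      (hF.contDiffAt_stressEnergy hL hp a b).mul (hh' a b p)).mul (hF.contDiffAt_volDensity hp)
  · intro c p hp
    exact contDiffAt_const.mul ((ContDiffAt.sum fun a _ => ContDiffAt.sum fun b _ =>
      (hF.contDiffAt_spinCombination hL hp c a b).mul (hh' a b p)).mul
        (hF.contDiffAt_volDensity hp))
  · intro p hp
    have := deriv_lagDensity_eq_zero (ρ := ρ) (ℓ := ℓ) (G := G) (φ := φ) (κ := κ) (δφ := 0)
      (δκ := 0) hp (by simp [tsupport]) (by simp [tsupport])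
    simpa only [smul_zero, add_zero] using this
  · intro p hp
    simp [h0 p hp]
  · intro c p hp
    simp [h0 p hp]
  · intro p hp
    rw [hF.deriv_lagDensity_metric hL hp hh.contDiffAt hs, Finset.mul_sum]
    congr 1
    refine Finset.sum_congr rfl fun c _ => (pd_const_mul ?_ _ c).symm
    exact SmoothAt.diff ((ContDiffAt.sum fun a _ => ContDiffAt.sum fun b _ =>
      (hF.contDiffAt_spinCombination hL hp c a b).mul (hh' a b p)).mul
        (hF.contDiffAt_volDensity hp))

end MetricResponse

section LieDerivative

variable {W : Type*} [NormedAddCommGroup W] [NormedSpace ℝ W] {n : ℕ}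
variable {alg : Submodule ℝ (Matrix (Fin n) (Fin n) ℝ)} {D : Set V4} {ρ : TensorType W}
  {ℓ L : Prolong n W → ℝ} {G h : V4 → Fin 4 → Fin 4 → ℝ} {φ δφ : V4 → Fin n → W}
  {κ δκ : V4 → Fin 4 → Fin n → Fin n → ℝ} {ξ : V4 → Fin 4 → ℝ} {p : V4}

/-! ### Lie derivatives of the fields -/

/-- The matrix `∂_a ξ^c` of the partial derivatives of a vector field. -/
noncomputable def jac (ξ : V4 → Fin 4 → ℝ) (p : V4) (c a : Fin 4) : ℝ := pd a (fun q => ξ q c) p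

/-- The components of the Lie derivative of a covariant tensor of rank 2. -/
noncomputable def lieMetric (ξ : V4 → Fin 4 → ℝ) (G : V4 → Fin 4 → Fin 4 → ℝ) (p : V4)
    (a b : Fin 4) : ℝ :=
  ∑ d, ξ p d * pd d (fun q => G q a b) p + ∑ c, (jac ξ p c a * G p c b + jac ξ p c b * G p a c)

/-- The components of the Lie derivative of the matter field. -/
noncomputable def lieMatter (ρ : TensorType W) (ξ : V4 → Fin 4 → ℝ) (φ : V4 → Fin n → W) (p : V4)
    (i : Fin n) : W :=
  ∑ d, ξ p d • pd d (fun q => φ q i) p - ρ.act (jac ξ p) (φ p i)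

/-- The components of the Lie derivative of the gauge field. -/
noncomputable def lieConn (ξ : V4 → Fin 4 → ℝ) (κ : V4 → Fin 4 → Fin n → Fin n → ℝ) (p : V4)
    (b : Fin 4) (i j : Fin n) : ℝ :=
  ∑ d, ξ p d * pd d (fun q => κ q b i j) p + ∑ c, jac ξ p c b * κ p c i j

theorem contDiffAt_jac (hξ : ContDiffAt ℝ ∞ ξ p) (c a : Fin 4) :
    ContDiffAt ℝ ∞ (fun q => jac ξ q c a) p :=
  SmoothAt.pd (f := fun q => ξ q c) (by fun_prop) a

theorem pd_jac_symm (hξ : ContDiffAt ℝ ∞ ξ p) (c a b : Fin 4) :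
    pd a (fun q => jac ξ q c b) p = pd b (fun q => jac ξ q c a) p :=
  pd_comm (f := fun q => ξ q c) (by fun_prop) a b

theorem contDiffAt_lieMetric (hξ : ContDiffAt ℝ ∞ ξ p) (hG : ContDiffAt ℝ ∞ G p) :
    ContDiffAt ℝ ∞ (lieMetric ξ G) p := by
  refine contDiffAt_pi.2 fun a => contDiffAt_pi.2 fun b => ?_
  have h1 : ∀ d, ContDiffAt ℝ ∞ (fun q' => pd d (fun q => G q a b) q') p := fun d =>
    SmoothAt.pd (f := fun q => G q a b) (by fun_prop) d
  have h2 := contDiffAt_jac hξ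
  exact (ContDiffAt.sum fun d _ => by fun_prop).add (ContDiffAt.sum fun c _ => by fun_prop)

theorem contDiffAt_lieMatter (hξ : ContDiffAt ℝ ∞ ξ p) (hφ : ContDiffAt ℝ ∞ φ p) :
    ContDiffAt ℝ ∞ (lieMatter ρ ξ φ) p := by
  refine contDiffAt_pi.2 fun i => ?_
  have h1 : ∀ d, ContDiffAt ℝ ∞ (fun q' => pd d (fun q => φ q i) q') p := fun d =>
    SmoothAt.pd (f := fun q => φ q i) (by fun_prop) d
  exact (ContDiffAt.sum fun d _ => by fun_prop).sub
    (ρ.contDiffAt_act (contDiffAt_jac hξ) (by fun_prop))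

theorem contDiffAt_lieConn (hξ : ContDiffAt ℝ ∞ ξ p) (hκ : ContDiffAt ℝ ∞ κ p) :
    ContDiffAt ℝ ∞ (lieConn ξ κ) p := by
  refine contDiffAt_pi.2 fun b => contDiffAt_pi.2 fun i => contDiffAt_pi.2 fun j => ?_
  have h1 : ∀ d, ContDiffAt ℝ ∞ (fun q' => pd d (fun q => κ q b i j) q') p := fun d =>
    SmoothAt.pd (f := fun q => κ q b i j) (by fun_prop) d
  have h2 := contDiffAt_jac hξ
  exact (ContDiffAt.sum fun d _ => by fun_prop).add (ContDiffAt.sum fun c _ => by fun_prop)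

theorem pd_sum_mul {f g : Fin 4 → V4 → ℝ} (hf : ∀ d, DifferentiableAt ℝ (f d) p)
    (hg : ∀ d, DifferentiableAt ℝ (g d) p) (a : Fin 4) :
    pd a (fun q => ∑ d, f d q * g d q) p
      = ∑ d, (pd a (f d) p * g d p + f d p * pd a (g d) p) := by
  rw [pd_sum fun d _ => (hf d).fun_mul (hg d)]
  exact Finset.sum_congr rfl fun d _ => pd_mul (hf d) (hg d) a

theorem pd_lieMetric (hξ : ContDiffAt ℝ ∞ ξ p) (hG : ContDiffAt ℝ ∞ G p) (x y z : Fin 4) :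
    pd x (fun q => lieMetric ξ G q y z) p = ∑ e,
      (jac ξ p e x * pd e (fun q => G q y z) p
        + ξ p e * pd x (fun q' => pd e (fun q => G q y z) q') p
        + (pd x (fun q => jac ξ q e y) p * G p e z + jac ξ p e y * pd x (fun q => G q e z) p
        + (pd x (fun q => jac ξ q e z) p * G p y e
          + jac ξ p e z * pd x (fun q => G q y e) p))) := by
  have hG' : ∀ y z, DifferentiableAt ℝ (fun q => G q y z) p := fun y z => by
    have := SmoothAt.diff hG
    fun_prop
  have hξ' : ∀ e, DifferentiableAt ℝ (fun q => ξ q e) p := fun e => by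
    have := SmoothAt.diff hξ
    fun_prop
  have hJ := fun c a => SmoothAt.diff (contDiffAt_jac hξ c a)
  have hp : ∀ e, DifferentiableAt ℝ (fun q' => pd e (fun q => G q y z) q') p := fun e =>
    SmoothAt.diff (SmoothAt.pd (f := fun q => G q y z) (by fun_prop) e)
  have h1 : ∀ e, DifferentiableAt ℝ (fun q => jac ξ q e y * G q e z) p := fun e =>
    (hJ e y).fun_mul (hG' e z)
  have h2 : ∀ e, DifferentiableAt ℝ (fun q => jac ξ q e z * G q y e) p := fun e =>
    (hJ e z).fun_mul (hG' y e)
  have e1 : (fun q => lieMetric ξ G q y z) = fun q' =>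
      ∑ d, ξ q' d * pd d (fun q => G q y z) q'
        + (∑ c, jac ξ q' c y * G q' c z + ∑ c, jac ξ q' c z * G q' y c) := by
    funext q
    simp only [lieMetric, Finset.sum_add_distrib]
  rw [e1, pd_add (DifferentiableAt.fun_sum fun d _ => (hξ' d).fun_mul (hp d))
    ((DifferentiableAt.fun_sum fun d _ => h1 d).fun_add
      (DifferentiableAt.fun_sum fun d _ => h2 d)),
    pd_add (DifferentiableAt.fun_sum fun d _ => h1 d) (DifferentiableAt.fun_sum fun d _ => h2 d),
    pd_sum_mul hξ' hp, pd_sum_mul (fun c => hJ c y) (fun c => hG' c z),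
    pd_sum_mul (fun c => hJ c z) (fun c => hG' y c)]
  simp only [Finset.sum_add_distrib]
  rfl

/-- The variation of the Christoffel symbols of the first kind under a Lie derivative. -/
theorem SmoothFields.lowerChristoffel_lieMetric (hF : SmoothFields alg D G φ κ) (hp : p ∈ D)
    (hξ : ContDiffAt ℝ ∞ ξ p) (d a b : Fin 4) :
    lowerChristoffel (lieMetric ξ G) p d a b = ∑ e,
      (ξ p e * pd e (fun q => lowerChristoffel G q d a b) p
        + jac ξ p e a * lowerChristoffel G p d e b + jac ξ p e b * lowerChristoffel G p d a e
        + jac ξ p e d * lowerChristoffel G p e a b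
        + G p d e * pd a (fun q => jac ξ q e b) p) := by
  have hG := hF.metric p hp
  have hpd : ∀ x y z, ContDiffAt ℝ ∞ (fun q' => pd x (fun q => G q y z) q') p := fun x y z =>
    SmoothAt.pd (f := fun q => G q y z) (by fun_prop) x
  have e1 : ∀ e, pd e (fun q => lowerChristoffel G q d a b) p
      = (1 / 2) * (pd a (fun q' => pd e (fun q => G q b d) q') p
        + pd b (fun q' => pd e (fun q => G q a d) q') p
        - pd d (fun q' => pd e (fun q => G q a b) q') p) := by
    intro e
    have c1 := fun x y z => pd_comm (f := fun q => G q y z) (p := p) (by fun_prop) x e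
    rw [c1 a, c1 b, c1 d, ← pd_add (SmoothAt.diff (hpd _ _ _)) (SmoothAt.diff (hpd _ _ _)),
      ← pd_sub ((SmoothAt.diff (hpd _ _ _)).fun_add (SmoothAt.diff (hpd _ _ _)))
        (SmoothAt.diff (hpd _ _ _)), ← pd_const_mul]
    · rfl
    · exact ((SmoothAt.diff (hpd _ _ _)).fun_add (SmoothAt.diff (hpd _ _ _))).fun_sub
        (SmoothAt.diff (hpd _ _ _))
  rw [lowerChristoffel]
  simp only [pd_lieMetric hξ hG, e1]
  rw [← Finset.sum_add_distrib, ← Finset.sum_sub_distrib, Finset.mul_sum]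
  refine Finset.sum_congr rfl fun e _ => ?_
  -- Of the six terms with second derivatives of ξ, four cancel in pairs by the symmetry of ∂∂ξ and
  -- of the metric, and two merge into G_{de} ∂_a∂_b ξ^e.
  rw [pd_jac_symm hξ e a d, pd_jac_symm hξ e b d, pd_jac_symm hξ e b a, hF.symm hp b e,
    hF.symm hp a e, hF.symm hp d e]
  simp only [lowerChristoffel]
  ring

/-- The variation of the Christoffel symbols under a Lie derivative. -/
theorem SmoothFields.dChristoffel_lieMetric (hF : SmoothFields alg D G φ κ) (hp : p ∈ D)
    (hξ : ContDiffAt ℝ ∞ ξ p) (c a b : Fin 4) :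
    dChristoffel G (lieMetric ξ G) p c a b
      = ∑ e, ξ p e * pd e (fun q => christoffel G q c a b) p
        + ∑ e, jac ξ p e a * christoffel G p c e b
        + ∑ e, (christoffel G p c a e * jac ξ p e b - jac ξ p c e * christoffel G p e a b)
        + pd a (fun q => jac ξ q c b) p := by
  set R : Fin 4 → ℝ := fun c => ∑ e, ξ p e * pd e (fun q => christoffel G q c a b) p
        + ∑ e, jac ξ p e a * christoffel G p c e b
        + ∑ e, (christoffel G p c a e * jac ξ p e b - jac ξ p c e * christoffel G p e a b)
        + pd a (fun q => jac ξ q c b) p with hR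
  have hG := hF.metric p hp
  -- The claimed value `R` is checked with its index lowered. There ∂Γ_{dab} is obtained by
  -- differentiating G Γ = Γ_{dab}, so the inverse metric is never differentiated; contraction with
  -- it afterwards recovers `R`.
  have key : ∀ d, lowerChristoffel (lieMetric ξ G) p d a b
      - ∑ e, lieMetric ξ G p d e * christoffel G p e a b = ∑ c, G p d c * R c := by
    intro d
    have e1 : ∀ f, pd f (fun q => lowerChristoffel G q d a b) p
        = ∑ c, (pd f (fun q => G q d c) p * christoffel G p c a b
          + G p d c * pd f (fun q => christoffel G q c a b) p) := by
      intro f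
      rw [← pd_sum_mul (fun c => SmoothAt.diff (by fun_prop))
        (fun c => SmoothAt.diff (hF.contDiffAt_christoffel hp c a b))]
      exact pd_congr_of_isOpen hF.isOpen hp
        (fun q hq => (hF.metric_mul_christoffel hq d a b).symm) f
    rw [hF.lowerChristoffel_lieMetric hp hξ]
    simp only [e1, hR, ← hF.metric_mul_christoffel hp, lieMetric, Fin.sum_univ_four]
    ring
  rw [dChristoffel]
  simp only [key, Finset.mul_sum, ← mul_assoc]
  rw [Finset.sum_comm]
  simp only [← Finset.sum_mul, invMetric_mul (hF.det_ne_zero hp)]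
  simp [hR]

theorem TensorType.act_add (ρ : TensorType W) (m m' : Fin 4 → Fin 4 → ℝ) (w : W) :
    ρ.act (fun c b => m c b + m' c b) w = ρ.act m w + ρ.act m' w := by
  simp only [ρ.act_apply, add_smul, Finset.sum_add_distrib]

theorem TensorType.act_sum (ρ : TensorType W) (r : Fin 4 → ℝ) (m : Fin 4 → Fin 4 → Fin 4 → ℝ)
    (w : W) : ρ.act (fun c b => ∑ e, r e * m e c b) w = ∑ e, r e • ρ.act (m e) w := by
  simp only [ρ.act_apply, Finset.sum_smul, Finset.smul_sum, mul_smul]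
  rw [Finset.sum_congr rfl fun c _ => Finset.sum_comm, Finset.sum_comm]

theorem TensorType.pd_act (ρ : TensorType W) {m : V4 → Fin 4 → Fin 4 → ℝ} {w : V4 → W}
    (hm : ∀ c b, DifferentiableAt ℝ (fun q => m q c b) p) (hw : DifferentiableAt ℝ w p)
    (a : Fin 4) : pd a (fun q => ρ.act (m q) (w q)) p
      = ρ.act (fun c b => pd a (fun q => m q c b) p) (w p) + ρ.act (m p) (pd a w p) := by
  simp only [ρ.act_apply]
  have h1 : ∀ c b, DifferentiableAt ℝ (fun q => m q c b • ρ.inf (elemEnd c b) (w q)) p :=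
    fun c b => (hm c b).fun_smul ((ρ.inf (elemEnd c b)).differentiableAt.comp p hw)
  rw [pd_sum fun c _ => DifferentiableAt.fun_sum fun b _ => h1 c b, ← Finset.sum_add_distrib]
  refine Finset.sum_congr rfl fun c _ => ?_
  rw [pd_sum fun b _ => h1 c b, ← Finset.sum_add_distrib]
  refine Finset.sum_congr rfl fun b _ => ?_
  rw [pd_smul (g := fun q => ρ.inf (elemEnd c b) (w q)) (hm c b)
    ((ρ.inf (elemEnd c b)).differentiableAt.comp p hw), pd_clm _ hw]

/-- Two cancellations make ∇ natural. The inhomogeneous term ∂∂ξ in the variation of Γ cancels the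
one from differentiating dρ(∂ξ)φ, and the matrix commutator of Γ_a with ∂ξ becomes a commutator of
operators on W by `TensorType.act_lie`. The gauge index is inert, κ behaving as a matrix of 1-forms.
-/
theorem SmoothFields.dCovDiff_lie (hF : SmoothFields alg D G φ κ) (hp : p ∈ D)
    (hξ : ContDiffAt ℝ ∞ ξ p) (a : Fin 4) (i : Fin n) :
    dCovDiff ρ G φ κ (lieMetric ξ G) (lieMatter ρ ξ φ) (lieConn ξ κ) p a i
      = ∑ d, ξ p d • pd d (fun q => covDiff ρ G φ κ q a i) p
        + (∑ c, jac ξ p c a • covDiff ρ G φ κ p c i - ρ.act (jac ξ p) (covDiff ρ G φ κ p a i)) := by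
  have hφ := hF.matter p hp
  have hκ := hF.conn p hp
  have hξ' : ∀ e, DifferentiableAt ℝ (fun q => ξ q e) p := fun e => by
    have := SmoothAt.diff hξ
    fun_prop
  have hφ' : ∀ i, DifferentiableAt ℝ (fun q => φ q i) p := fun i => by
    have := SmoothAt.diff hφ
    fun_prop
  have hκ' : ∀ a i j, DifferentiableAt ℝ (fun q => κ q a i j) p := fun a i j => by
    have := SmoothAt.diff hκ
    fun_prop
  have hpd : ∀ d i, DifferentiableAt ℝ (fun q' => pd d (fun q => φ q i) q') p := fun d i =>
    SmoothAt.diff (SmoothAt.pd (f := fun q => φ q i) (by fun_prop) d)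
  have hJ := fun c a => SmoothAt.diff (contDiffAt_jac hξ c a)
  have hΓ := fun c a b => SmoothAt.diff (hF.contDiffAt_christoffel hp c a b)
  have hJφ : ∀ i, DifferentiableAt ℝ (fun q => ρ.act (jac ξ q) (φ q i)) p := fun i =>
    SmoothAt.diff (ρ.contDiffAt_act (contDiffAt_jac hξ) (by fun_prop))
  have hΓφ : ∀ i a, DifferentiableAt ℝ
      (fun q => ρ.act (fun c b => christoffel G q c a b) (φ q i)) p := fun i a =>
    SmoothAt.diff (ρ.contDiffAt_act (fun c b => hF.contDiffAt_christoffel hp c a b) (by fun_prop))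
  -- the derivative of the Lie derivative of the matter field
  have e1 : pd a (fun q => lieMatter ρ ξ φ q i) p
      = ∑ d, (jac ξ p d a • pd d (fun q => φ q i) p
          + ξ p d • pd d (fun q' => pd a (fun q => φ q i) q') p)
        - (ρ.act (fun c b => pd a (fun q => jac ξ q c b) p) (φ p i)
          + ρ.act (jac ξ p) (pd a (fun q => φ q i) p)) := by
    have h1 : ∀ d, DifferentiableAt ℝ (fun q' => ξ q' d • pd d (fun q => φ q i) q') p := fun d =>
      (hξ' d).fun_smul (hpd d i)
    rw [← ρ.pd_act hJ (hφ' i)]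
    have h2 : ∀ d, pd a (fun q' => ξ q' d • pd d (fun q => φ q i) q') p
        = jac ξ p d a • pd d (fun q => φ q i) p
          + ξ p d • pd d (fun q' => pd a (fun q => φ q i) q') p := by
      intro d
      rw [pd_smul (hξ' d) (hpd d i), pd_comm (f := fun q => φ q i) (by fun_prop) a d]
      rfl
    simp only [← h2]
    rw [← pd_sum fun d _ => h1 d,
      ← pd_sub (DifferentiableAt.fun_sum fun d _ => h1 d) (hJφ i)]
    rfl
  have e2 : ∀ d, pd d (fun q => covDiff ρ G φ κ q a i) p
      = pd d (fun q' => pd a (fun q => φ q i) q') p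
        - ∑ j, (pd d (fun q => κ q a i j) p • φ p j + κ p a i j • pd d (fun q => φ q j) p)
        + (ρ.act (fun c b => pd d (fun q => christoffel G q c a b) p) (φ p i)
          + ρ.act (fun c b => christoffel G p c a b) (pd d (fun q => φ q i) p)) := by
    intro d
    have h1 : ∀ j, DifferentiableAt ℝ (fun q => κ q a i j • φ q j) p := fun j =>
      (hκ' a i j).fun_smul (hφ' j)
    simp only [covDiff_eq]
    rw [pd_add ((hpd a i).fun_sub (DifferentiableAt.fun_sum fun j _ => h1 j)) (hΓφ i a),
      pd_sub (hpd a i) (DifferentiableAt.fun_sum fun j _ => h1 j), pd_sum fun j _ => h1 j,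
      ρ.pd_act (fun c b => hΓ c a b) (hφ' i)]
    simp only [pd_smul (hκ' _ _ _) (hφ' _)]
  have e3 : ρ.act (fun c b => dChristoffel G (lieMetric ξ G) p c a b) (φ p i)
      = ∑ e, ξ p e • ρ.act (fun c b => pd e (fun q => christoffel G q c a b) p) (φ p i)
        + ∑ e, jac ξ p e a • ρ.act (fun c b => christoffel G p c e b) (φ p i)
        + (ρ.act (fun c b => christoffel G p c a b) (ρ.act (jac ξ p) (φ p i))
          - ρ.act (jac ξ p) (ρ.act (fun c b => christoffel G p c a b) (φ p i)))
        + ρ.act (fun c b => pd a (fun q => jac ξ q c b) p) (φ p i) := by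
    simp only [hF.dChristoffel_lieMetric hp hξ]
    rw [ρ.act_add, ρ.act_add, ρ.act_add, ρ.act_sum, ρ.act_sum, ← ρ.act_lie]
  have e4 : ∑ j, (lieConn ξ κ p a i j • φ p j + κ p a i j • lieMatter ρ ξ φ p j)
      = ∑ d, ξ p d • ∑ j, (pd d (fun q => κ q a i j) p • φ p j
          + κ p a i j • pd d (fun q => φ q j) p)
        + ∑ c, jac ξ p c a • ∑ j, κ p c i j • φ p j
        - ρ.act (jac ξ p) (∑ j, κ p a i j • φ p j) := by
    simp only [map_sum, map_smul, Finset.smul_sum, lieConn, lieMatter, smul_sub, add_smul,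
      Finset.sum_smul, smul_add, Finset.sum_add_distrib, Finset.sum_sub_distrib, smul_smul,
      mul_comm (κ p a i _)]
    rw [Finset.sum_comm (f := fun d j => (ξ p d * pd d (fun q => κ q a i j) p) • φ p j),
      Finset.sum_comm (f := fun d j => (ξ p d * κ p a i j) • pd d (fun q => φ q j) p),
      Finset.sum_comm (f := fun c j => (jac ξ p c a * κ p c i j) • φ p j)]
    abel
  rw [dCovDiff, e1, e3, e4]
  simp only [e2]
  simp only [covDiff_eq, lieMatter, map_add, map_sub, map_sum, map_smul, smul_add, smul_sub,
    Finset.sum_add_distrib, Finset.sum_sub_distrib]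
  abel

/-- In a fixed gauge κ is a matrix of 1-forms, and Lie derivatives commute with the exterior
derivative and obey the Leibniz rule on the quadratic term. In coordinates, the second derivatives
of ξ disappear on antisymmetrisation in a, b. -/
theorem SmoothFields.dCurv_lie (hF : SmoothFields alg D G φ κ) (hp : p ∈ D)
    (hξ : ContDiffAt ℝ ∞ ξ p) (a b : Fin 4) (i j : Fin n) :
    dCurv κ (lieConn ξ κ) p a b i j
      = ∑ d, ξ p d * pd d (fun q => curv κ q a b i j) p
        + ∑ c, (jac ξ p c a * curv κ p c b i j + jac ξ p c b * curv κ p a c i j) := by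
  have hκ := hF.conn p hp
  have hξ' : ∀ e, DifferentiableAt ℝ (fun q => ξ q e) p := fun e => by
    have := SmoothAt.diff hξ
    fun_prop
  have hκ' : ∀ a i j, DifferentiableAt ℝ (fun q => κ q a i j) p := fun a i j => by
    have := SmoothAt.diff hκ
    fun_prop
  have hpd : ∀ d a, DifferentiableAt ℝ (fun q' => pd d (fun q => κ q a i j) q') p := fun d a =>
    SmoothAt.diff (SmoothAt.pd (f := fun q => κ q a i j) (by fun_prop) d)
  have hJ := fun c a => SmoothAt.diff (contDiffAt_jac hξ c a)
  have e1 : ∀ a b, pd a (fun q => lieConn ξ κ q b i j) p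
      = ∑ d, (jac ξ p d a * pd d (fun q => κ q b i j) p
          + ξ p d * pd d (fun q' => pd a (fun q => κ q b i j) q') p
        + (pd a (fun q => jac ξ q d b) p * κ p d i j
          + jac ξ p d b * pd a (fun q => κ q d i j) p)) := by
    intro a b
    have h1 : ∀ d, pd d (fun q' => pd a (fun q => κ q b i j) q') p
        = pd a (fun q' => pd d (fun q => κ q b i j) q') p := fun d =>
      pd_comm (f := fun q => κ q b i j) (by fun_prop) d a
    simp only [h1]
    rw [Finset.sum_add_distrib]
    have h2 := pd_sum_mul hξ' (fun d => hpd d b) a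
    have h3 := pd_sum_mul (fun c => hJ c b) (fun c => hκ' c i j) a
    simp only [jac] at h2 h3 ⊢
    rw [← h2, ← h3, ← pd_add]
    · rfl
    · exact DifferentiableAt.fun_sum fun d _ => (hξ' d).fun_mul (hpd d b)
    · exact DifferentiableAt.fun_sum fun c _ => (hJ c b).fun_mul (hκ' c i j)
  have e2 : ∀ d, pd d (fun q => curv κ q a b i j) p
      = pd d (fun q' => pd a (fun q => κ q b i j) q') p
        - pd d (fun q' => pd b (fun q => κ q a i j) q') p
        - ∑ h, ((pd d (fun q => κ q a i h) p * κ p b h j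
            + κ p a i h * pd d (fun q => κ q b h j) p)
          - (pd d (fun q => κ q b i h) p * κ p a h j
            + κ p b i h * pd d (fun q => κ q a h j) p)) := by
    intro d
    have h1 : ∀ a b h, DifferentiableAt ℝ (fun q => κ q a i h * κ q b h j) p := fun a b h =>
      (hκ' a i h).fun_mul (hκ' b h j)
    simp only [curv]
    rw [pd_sub ((hpd a b).fun_sub (hpd b a))
      (DifferentiableAt.fun_sum fun h _ => (h1 a b h).fun_sub (h1 b a h)),
      pd_sub (hpd a b) (hpd b a), pd_sum fun h _ => (h1 a b h).fun_sub (h1 b a h)]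
    simp only [pd_sub (h1 _ _ _) (h1 _ _ _), pd_mul (hκ' _ _ _) (hκ' _ _ _)]
  have e3 : ∑ h, ((lieConn ξ κ p a i h * κ p b h j + κ p a i h * lieConn ξ κ p b h j)
        - (lieConn ξ κ p b i h * κ p a h j + κ p b i h * lieConn ξ κ p a h j))
      = ∑ d, (ξ p d * ∑ h, ((pd d (fun q => κ q a i h) p * κ p b h j
            + κ p a i h * pd d (fun q => κ q b h j) p)
          - (pd d (fun q => κ q b i h) p * κ p a h j
            + κ p b i h * pd d (fun q => κ q a h j) p))
        + (jac ξ p d a * ∑ h, (κ p d i h * κ p b h j - κ p b i h * κ p d h j)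
          + jac ξ p d b * ∑ h, (κ p a i h * κ p d h j - κ p d i h * κ p a h j))) := by
    simp only [Finset.mul_sum, ← Finset.sum_add_distrib]
    rw [Finset.sum_comm]
    refine Finset.sum_congr rfl fun h _ => ?_
    simp only [lieConn, Fin.sum_univ_four]
    ring
  rw [dCurv, e1, e1, e3]
  simp only [e2, ← Finset.sum_add_distrib, ← Finset.sum_sub_distrib]
  refine Finset.sum_congr rfl fun d _ => ?_
  rw [pd_jac_symm hξ d b a]
  simp only [curv]
  ring

/-- The covariant prolongation is natural: its variation when the metric and the fields vary by
their Lie derivatives is its own Lie derivative. -/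
theorem SmoothFields.dProlong_lie (hF : SmoothFields alg D G φ κ) (hp : p ∈ D)
    (hξ : ContDiffAt ℝ ∞ ξ p) :
    dProlong ρ G φ κ (lieMetric ξ G) (lieMatter ρ ξ φ) (lieConn ξ κ) p
      = ∑ d, ξ p d • pd d (prolong ρ G φ κ) p + infFrame ρ (jac ξ p) (prolong ρ G φ κ p) := by
  have hP := SmoothAt.diff (hF.contDiffAt_prolong ρ hp)
  have hG := SmoothAt.diff (hF.metric p hp)
  have hφ := SmoothAt.diff (hF.matter p hp)
  refine Prod.ext ?_ (Prod.ext ?_ (Prod.ext ?_ ?_))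
  · funext a b
    have e : ∀ d, (pd d (prolong ρ G φ κ) p).1 a b = pd d (fun q => G q a b) p := by
      intro d
      exact (pd_clm ((ContinuousLinearMap.proj (R := ℝ) (φ := fun _ : Fin 4 => ℝ) b).comp
        ((ContinuousLinearMap.proj (R := ℝ) (φ := fun _ : Fin 4 => Fin 4 → ℝ) a).comp
          (ContinuousLinearMap.fst ℝ _ _))) hP d).symm
    simp only [dProlong, infFrame, lieMetric, Prod.fst_add, Prod.fst_sum, Prod.smul_fst,
      Pi.add_apply, Finset.sum_apply, Pi.smul_apply, smul_eq_mul, e]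
    rfl
  · funext i
    have e : ∀ d, (pd d (prolong ρ G φ κ) p).2.1 i = pd d (fun q => φ q i) p := by
      intro d
      exact (pd_clm ((ContinuousLinearMap.proj (R := ℝ) (φ := fun _ : Fin n => W) i).comp
        ((ContinuousLinearMap.fst ℝ _ _).comp (ContinuousLinearMap.snd ℝ _ _))) hP d).symm
    simp only [dProlong, infFrame, lieMatter, Prod.fst_add, Prod.fst_sum, Prod.smul_fst,
      Prod.snd_add, Prod.snd_sum, Prod.smul_snd,
      Pi.add_apply, Finset.sum_apply, Pi.smul_apply, e, sub_eq_add_neg]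
    rfl
  · funext a i
    have e : ∀ d, (pd d (prolong ρ G φ κ) p).2.2.1 a i
        = pd d (fun q => covDiff ρ G φ κ q a i) p := by
      intro d
      exact (pd_clm ((ContinuousLinearMap.proj (R := ℝ) (φ := fun _ : Fin n => W) i).comp
        ((ContinuousLinearMap.proj (R := ℝ) (φ := fun _ : Fin 4 => Fin n → W) a).comp
          ((ContinuousLinearMap.fst ℝ _ _).comp ((ContinuousLinearMap.snd ℝ _ _).comp
            (ContinuousLinearMap.snd ℝ _ _))))) hP d).symm
    have := hF.dCovDiff_lie (ρ := ρ) hp hξ a i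
    simp only [infFrame, Prod.fst_add, Prod.fst_sum, Prod.smul_fst,
      Prod.snd_add, Prod.snd_sum, Prod.smul_snd,
      Pi.add_apply, Finset.sum_apply, Pi.smul_apply, e]
    exact this
  · funext a b i j
    have e : ∀ d, (pd d (prolong ρ G φ κ) p).2.2.2 a b i j
        = pd d (fun q => curv κ q a b i j) p := by
      intro d
      exact (pd_clm ((ContinuousLinearMap.proj (R := ℝ) (φ := fun _ : Fin n => ℝ) j).comp
        ((ContinuousLinearMap.proj (R := ℝ) (φ := fun _ : Fin n => Fin n → ℝ) i).comp
          ((ContinuousLinearMap.proj (R := ℝ) (φ := fun _ : Fin 4 => Fin n → Fin n → ℝ) b).comp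
            ((ContinuousLinearMap.proj (R := ℝ)
                (φ := fun _ : Fin 4 => Fin 4 → Fin n → Fin n → ℝ) a).comp
              ((ContinuousLinearMap.snd ℝ _ _).comp ((ContinuousLinearMap.snd ℝ _ _).comp
                (ContinuousLinearMap.snd ℝ _ _))))))) hP d).symm
    have := hF.dCurv_lie hp hξ a b i j
    simp only [infFrame, Prod.snd_add, Prod.snd_sum, Prod.smul_snd,
      Pi.add_apply, Finset.sum_apply, Pi.smul_apply, smul_eq_mul, e]
    exact this

end LieDerivative

section Conservation

variable {W : Type*} [NormedAddCommGroup W] [NormedSpace ℝ W] {n : ℕ}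
variable {alg : Submodule ℝ (Matrix (Fin n) (Fin n) ℝ)} {D : Set V4} {ρ : TensorType W}
  {ℓ L : Prolong n W → ℝ} {G h : V4 → Fin 4 → Fin 4 → ℝ} {φ δφ : V4 → Fin n → W}
  {κ δκ : V4 → Fin 4 → Fin n → Fin n → ℝ} {ξ : V4 → Fin 4 → ℝ} {p : V4}

/-! ### Conservation of the stress-energy tensor -/

/-- Both sides are the covariant divergence of ξ: each of the two Jacobian terms of the Lie
derivative contracts to the trace of ∂ξ, and the transport term gives the contracted Christoffel
symbols by `sum_christoffel`. -/
theorem SmoothFields.trace_lieMetric (hF : SmoothFields alg D G φ κ) (hp : p ∈ D) :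
    (1 / 2) * ∑ a, ∑ b, invMetric (G p) a b * lieMetric ξ G p b a
      = ∑ c, (ξ p c * ∑ d, christoffel G p d d c + jac ξ p c c) := by
  have h1 : ∀ c, ∑ d, christoffel G p d d c
      = (1 / 2) * ∑ a, ∑ b, invMetric (G p) a b * pd c (fun q => G q b a) p :=
    hF.sum_christoffel hp
  have h2 : ∑ a, ∑ b, invMetric (G p) a b * ∑ c, jac ξ p c b * G p c a = ∑ c, jac ξ p c c := by
    have : ∀ b c, ∑ a, invMetric (G p) a b * G p c a = if c = b then 1 else 0 := by
      intro b c
      rw [← mul_invMetric (hF.det_ne_zero hp) c b]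
      exact Finset.sum_congr rfl fun a _ => mul_comm _ _
    rw [Finset.sum_comm]
    have e : ∀ b, ∑ a, invMetric (G p) a b * ∑ c, jac ξ p c b * G p c a
        = ∑ c, jac ξ p c b * ∑ a, invMetric (G p) a b * G p c a := by
      intro b
      simp only [Finset.mul_sum]
      rw [Finset.sum_comm]
      exact Finset.sum_congr rfl fun c _ => Finset.sum_congr rfl fun a _ => by ring
    simp only [e, this]
    simp
  have h3 : ∑ a, ∑ b, invMetric (G p) a b * ∑ c, jac ξ p c a * G p b c = ∑ c, jac ξ p c c := by
    have e : ∀ a, ∑ b, invMetric (G p) a b * ∑ c, jac ξ p c a * G p b c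
        = ∑ c, jac ξ p c a * ∑ b, invMetric (G p) a b * G p b c := by
      intro a
      simp only [Finset.mul_sum]
      rw [Finset.sum_comm]
      exact Finset.sum_congr rfl fun c _ => Finset.sum_congr rfl fun b _ => by ring
    simp only [e, invMetric_mul (hF.det_ne_zero hp)]
    simp
  have h4 : ∑ a, ∑ b, invMetric (G p) a b * ∑ d, ξ p d * pd d (fun q => G q b a) p
      = 2 * ∑ c, ξ p c * ∑ d, christoffel G p d d c := by
    simp only [h1, Finset.mul_sum]
    rw [Finset.sum_congr rfl fun a _ => Finset.sum_comm, Finset.sum_comm]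
    exact Finset.sum_congr rfl fun c _ => Finset.sum_congr rfl fun a _ =>
      Finset.sum_congr rfl fun b _ => by ring
  simp only [lieMetric, mul_add, Finset.sum_add_distrib]
  rw [h2, h3, h4]
  ring

/-- The total variation of the Lagrangian density when the metric and the fields vary by their
Lie derivatives is a divergence. -/
theorem SmoothFields.variation_lie (hF : SmoothFields alg D G φ κ)
    (hL : IsSmoothExtension alg ℓ L)
    (hinv : ∀ A : V4 ≃L[ℝ] V4, 0 < LinearMap.det (A : V4 →ₗ[ℝ] V4) →
      ∀ q ∈ admissible W alg, ℓ (frameChange ρ A q) = ℓ q)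
    (hp : p ∈ D) (hξ : ContDiffAt ℝ ∞ ξ p) :
    (fderiv ℝ L (prolong ρ G φ κ p)
        (dProlong ρ G φ κ (lieMetric ξ G) (lieMatter ρ ξ φ) (lieConn ξ κ) p)
      + L (prolong ρ G φ κ p)
        * ((1 / 2) * ∑ a, ∑ b, invMetric (G p) a b * lieMetric ξ G p b a)) * volDensity (G p)
      = ∑ d, pd d (fun q => ξ q d * (L (prolong ρ G φ κ q) * volDensity (G q))) p := by
  have hq := hF.prolong_admissible ρ hp
  have hLd := SmoothAt.diff (hL.smooth _ hq)
  have hP := SmoothAt.diff (hF.contDiffAt_prolong ρ hp)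
  have hLP := SmoothAt.diff (hF.contDiffAt_lagrangian ρ hL hp)
  have hv := SmoothAt.diff (hF.contDiffAt_volDensity hp)
  have hξ' : ∀ e, DifferentiableAt ℝ (fun q => ξ q e) p := fun e => by
    have := SmoothAt.diff hξ
    fun_prop
  have e1 : ∀ d, fderiv ℝ L (prolong ρ G φ κ p) (pd d (prolong ρ G φ κ) p)
      = pd d (fun q => L (prolong ρ G φ κ q)) p := by
    intro d
    have := (hLd.hasFDerivAt.comp p hP.hasFDerivAt).fderiv
    simp only [pd]
    rw [show (fun q => L (prolong ρ G φ κ q)) = L ∘ prolong ρ G φ κ from rfl, this]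
    rfl
  -- The frame-change part is annihilated by invariance. What remains is ξ^d ∂_d L + L div ξ, times
  -- the density, which the Leibniz rule recognises as a divergence.
  rw [hF.dProlong_lie hp hξ, map_add, fderiv_infFrame ρ hinv hL.eq hq hLd,
    hF.trace_lieMetric hp]
  simp only [map_sum, map_smul, e1, smul_eq_mul, add_zero]
  rw [Finset.mul_sum, ← Finset.sum_add_distrib, Finset.sum_mul]
  refine Finset.sum_congr rfl fun d _ => ?_
  rw [pd_mul (hξ' d) (hLP.fun_mul hv), pd_mul hLP hv, hF.pd_volDensity hp]
  simp only [jac]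
  ring

/-- Up to a divergence, the contraction of a symmetric tensor with the Lie derivative of the metric
is the contraction of its divergence with the vector field. -/
theorem SmoothFields.contraction_lieMetric (hF : SmoothFields alg D G φ κ) (hp : p ∈ D)
    {T : V4 → Fin 4 → Fin 4 → ℝ} (hT : ∀ a b, ContDiffAt ℝ ∞ (fun q => T q a b) p)
    (hTs : ∀ a b, T p a b = T p b a) (hξ : ContDiffAt ℝ ∞ ξ p) :
    (∑ a, ∑ b, T p a b * lieMetric ξ G p a b) * volDensity (G p)
      = -2 * ((∑ c, (∑ b, divergence₂ G T p b * G p b c) * ξ p c) * volDensity (G p))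
        + ∑ a, pd a (fun q => 2 * ((∑ c, (∑ b, T q a b * G q b c) * ξ q c)
          * volDensity (G q))) p := by
  have hv := SmoothAt.diff (hF.contDiffAt_volDensity hp)
  have hG := SmoothAt.diff (hF.metric p hp)
  have hξ' : ∀ e, DifferentiableAt ℝ (fun q => ξ q e) p := fun e => by
    have := SmoothAt.diff hξ
    fun_prop
  have hG' : ∀ b c, DifferentiableAt ℝ (fun q => G q b c) p := fun b c => by fun_prop
  have hT' := fun a b => SmoothAt.diff (hT a b)
  have hTG : ∀ a c, DifferentiableAt ℝ (fun q => ∑ b, T q a b * G q b c) p := fun a c =>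
    DifferentiableAt.fun_sum fun b _ => (hT' a b).fun_mul (hG' b c)
  have hU : ∀ a, DifferentiableAt ℝ (fun q => ∑ c, (∑ b, T q a b * G q b c) * ξ q c) p := fun a =>
    DifferentiableAt.fun_sum fun c _ => (hTG a c).fun_mul (hξ' c)
  have e1 : ∀ a, pd a (fun q => 2 * ((∑ c, (∑ b, T q a b * G q b c) * ξ q c)
          * volDensity (G q))) p
      = 2 * ((∑ c, ((∑ b, (pd a (fun q => T q a b) p * G p b c
            + T p a b * pd a (fun q => G q b c) p)) * ξ p c
          + (∑ b, T p a b * G p b c) * jac ξ p c a))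
        + (∑ c, (∑ b, T p a b * G p b c) * ξ p c) * ∑ d, christoffel G p d d a)
          * volDensity (G p) := by
    intro a
    rw [pd_const_mul ((hU a).fun_mul hv), pd_mul (hU a) hv, hF.pd_volDensity hp,
      pd_sum_mul (fun c => hTG a c) hξ']
    simp only [pd_sum_mul (fun b => hT' a b) (fun b => hG' b _)]
    simp only [jac]
    ring
  simp only [e1]
  rw [← Finset.sum_mul, ← mul_assoc, ← add_mul]
  congr 1
  have lower : ∀ c a e, ∑ b, christoffel G p b a e * G p b c = lowerChristoffel G p c a e := by
    intro c a e
    rw [← hF.metric_mul_christoffel hp]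
    exact Finset.sum_congr rfl fun b _ => by rw [hF.symm hp c b, mul_comm]
  -- the first term with the Jacobian
  have s1 : ∑ a, ∑ b, T p a b * ∑ c, jac ξ p c a * G p c b
      = ∑ a, ∑ c, (∑ b, T p a b * G p b c) * jac ξ p c a := by
    refine Finset.sum_congr rfl fun a _ => ?_
    simp only [Finset.mul_sum, Finset.sum_mul]
    rw [Finset.sum_comm]
    exact Finset.sum_congr rfl fun c _ => Finset.sum_congr rfl fun b _ => by
      rw [hF.symm hp c b]; ring
  have s2 : ∑ a, ∑ b, T p a b * ∑ c, jac ξ p c b * G p a c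
      = ∑ a, ∑ b, T p a b * ∑ c, jac ξ p c a * G p c b := by
    rw [Finset.sum_comm]
    refine Finset.sum_congr rfl fun b _ => Finset.sum_congr rfl fun a _ => ?_
    rw [hTs a b]
    congr 1
    exact Finset.sum_congr rfl fun c _ => by rw [hF.symm hp a c]
  have s3 : ∑ a, ∑ b, T p a b * ∑ d, ξ p d * pd d (fun q => G q a b) p
      = ∑ d, ξ p d * ∑ a, ∑ b, T p a b * pd d (fun q => G q a b) p := by
    simp only [Finset.mul_sum]
    rw [Finset.sum_congr rfl fun a _ => Finset.sum_comm, Finset.sum_comm]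
    exact Finset.sum_congr rfl fun c _ => Finset.sum_congr rfl fun a _ =>
      Finset.sum_congr rfl fun b _ => by ring
  have s4 : ∑ c, (∑ b, divergence₂ G T p b * G p b c) * ξ p c
      = ∑ a, ∑ c, (∑ b, pd a (fun q => T q a b) p * G p b c) * ξ p c
        + ∑ a, (∑ c, (∑ b, T p a b * G p b c) * ξ p c) * ∑ d, christoffel G p d d a
        + ∑ c, (∑ a, ∑ e, T p a e * lowerChristoffel G p c a e) * ξ p c := by
    have t1 : ∀ c, ∑ a, ∑ e, T p a e * lowerChristoffel G p c a e
        = ∑ b, (∑ a, ∑ e, christoffel G p b a e * T p a e) * G p b c := by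
      intro c
      simp only [← lower, Finset.mul_sum, Finset.sum_mul]
      rw [Finset.sum_congr rfl fun a _ => Finset.sum_comm, Finset.sum_comm]
      exact Finset.sum_congr rfl fun b _ => Finset.sum_congr rfl fun a _ =>
        Finset.sum_congr rfl fun e _ => by ring
    have t2 : ∑ a, (∑ c, (∑ b, T p a b * G p b c) * ξ p c) * ∑ d, christoffel G p d d a
        = ∑ c, (∑ b, (∑ d, ∑ a, christoffel G p d d a * T p a b) * G p b c) * ξ p c := by
      simp only [Fin.sum_univ_four]
      ring
    have t3 : ∑ a, ∑ c, (∑ b, pd a (fun q => T q a b) p * G p b c) * ξ p c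
        = ∑ c, (∑ b, (∑ a, pd a (fun q => T q a b) p) * G p b c) * ξ p c := by
      rw [Finset.sum_comm]
      simp only [← Finset.sum_mul]
      refine Finset.sum_congr rfl fun c _ => ?_
      congr 1
      rw [Finset.sum_comm]
      simp only [Finset.sum_mul]
    rw [t2, t3]
    simp only [t1, ← Finset.sum_add_distrib, ← add_mul]
    simp only [divergence₂, Finset.sum_add_distrib, add_assoc]
  -- Against a symmetric T, two of the three derivatives in Γ_{cae} coincide. The third yields -½
  -- T^{ae} ∂_c g_{ae}, the counterpart of the transport term in the Lie derivative of the metric.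
  have s5 : ∀ c, ∑ a, ∑ e, T p a e * lowerChristoffel G p c a e
      = ∑ a, ∑ e, T p a e * pd a (fun q => G q e c) p
        - (1 / 2) * ∑ a, ∑ e, T p a e * pd c (fun q => G q a e) p := by
    intro c
    have t1 : ∑ a, ∑ e, T p a e * pd e (fun q => G q a c) p
        = ∑ a, ∑ e, T p a e * pd a (fun q => G q e c) p := by
      rw [Finset.sum_comm]
      exact Finset.sum_congr rfl fun a _ => Finset.sum_congr rfl fun e _ => by rw [hTs e a]
    have t2 : ∑ a, ∑ e, T p a e * lowerChristoffel G p c a e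
        = (1 / 2) * (∑ a, ∑ e, T p a e * pd a (fun q => G q e c) p
          + ∑ a, ∑ e, T p a e * pd e (fun q => G q a c) p
          - ∑ a, ∑ e, T p a e * pd c (fun q => G q a e) p) := by
      simp only [lowerChristoffel, ← Finset.sum_add_distrib, ← Finset.sum_sub_distrib,
        Finset.mul_sum]
      exact Finset.sum_congr rfl fun a _ => Finset.sum_congr rfl fun e _ => by ring
    rw [t2, t1]
    ring
  have s6 : ∑ a, ∑ c, (∑ b, T p a b * pd a (fun q => G q b c) p) * ξ p c
      = ∑ c, (∑ a, ∑ e, T p a e * pd a (fun q => G q e c) p) * ξ p c := by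
    rw [Finset.sum_comm]
    simp only [Finset.sum_mul]
  have s7 : ∑ c, (∑ a, ∑ e, T p a e * lowerChristoffel G p c a e) * ξ p c
      = ∑ c, (∑ a, ∑ e, T p a e * pd a (fun q => G q e c) p) * ξ p c
        - (1 / 2) * ∑ d, ξ p d * ∑ a, ∑ b, T p a b * pd d (fun q => G q a b) p := by
    simp only [s5, sub_mul, Finset.sum_sub_distrib]
    congr 1
    rw [Finset.mul_sum]
    exact Finset.sum_congr rfl fun c _ => by ring
  simp only [lieMetric, mul_add, add_mul, Finset.sum_add_distrib, ← Finset.mul_sum, s1, s2, s3,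
    s4, s6, s7]
  ring

theorem contDiffAt_integrand (hF : SmoothFields alg D G φ κ) (hL : IsSmoothExtension alg ℓ L)
    (hp : p ∈ D) (hh : ContDiffAt ℝ ∞ h p) (hδφ : ContDiffAt ℝ ∞ δφ p)
    (hδκ : ContDiffAt ℝ ∞ δκ p) :
    ContDiffAt ℝ ∞ (fun p => (fderiv ℝ L (prolong ρ G φ κ p) (dProlong ρ G φ κ h δφ δκ p)
        + L (prolong ρ G φ κ p) * ((1 / 2) * ∑ a, ∑ b, invMetric (G p) a b * h p b a))
          * volDensity (G p)) p := by
  have h1 := hF.contDiffAt_fderiv ρ hL hp (contDiffAt_dProlong ρ (hF.det_ne_zero hp)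
    (hF.metric p hp) (hF.matter p hp) (hF.conn p hp) hh hδφ hδκ)
  have h2 := hF.contDiffAt_lagrangian ρ hL hp
  have h3 := hF.contDiffAt_volDensity hp
  have h4 := hF.contDiffAt_invMetric hp
  have h5 : ContDiffAt ℝ ∞ (fun q => ∑ a, ∑ b, invMetric (G q) a b * h q b a) p :=
    ContDiffAt.sum fun a _ => ContDiffAt.sum fun b _ => (h4 a b).mul (by fun_prop)
  exact (h1.add (h2.mul (contDiffAt_const.mul h5))).mul h3

theorem SmoothFields.integrable_deriv_lagDensity (hF : SmoothFields alg D G φ κ)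
    (hL : IsSmoothExtension alg ℓ L) {Z : Type*} [Zero Z] {u : V4 → Z}
    (hu : HasCompactSupport u) (huD : tsupport u ⊆ D)
    (hh : ContDiff ℝ ∞ h) (hδφ : ContDiff ℝ ∞ δφ) (hδκ : ContDiff ℝ ∞ δκ)
    (hhu : tsupport h ⊆ tsupport u) (hφu : tsupport δφ ⊆ tsupport u)
    (hκu : tsupport δκ ⊆ tsupport u) (hs : ∀ p a b, h p a b = h p b a)
    (hmem : ∀ p a, Matrix.of (δκ p a) ∈ alg) :
    Integrable fun p =>
      deriv (fun ε : ℝ => lagDensity ρ ℓ (G + ε • h) (φ + ε • δφ) (κ + ε • δκ) p) 0 := by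
  refine integrable_of_smooth (D := D) (fun p hp => ?_) hu huD fun p hp =>
    deriv_lagDensity_eq_zero (fun hn => hp (hhu hn)) (fun hn => hp (hφu hn))
      (fun hn => hp (hκu hn))
  refine (contDiffAt_integrand (ρ := ρ) hF hL hp hh.contDiffAt hδφ.contDiffAt
    hδκ.contDiffAt).congr_of_eventuallyEq ?_
  exact Filter.eventuallyEq_of_mem (hF.isOpen.mem_nhds hp) fun q hq =>
    hF.deriv_lagDensity hL hq hh.contDiffAt hδφ.contDiffAt hδκ.contDiffAt (hs q)
      (Filter.Eventually.of_forall hmem)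

/-- Linearity in the variations, which separates the effect of the metric from that of the fields in
the total variation. -/
theorem dProlong_add (ρ : TensorType W) (G h : V4 → Fin 4 → Fin 4 → ℝ) (φ δφ : V4 → Fin n → W)
    (κ δκ : V4 → Fin 4 → Fin n → Fin n → ℝ) (p : V4) :
    dProlong ρ G φ κ h 0 0 p + dProlong ρ G φ κ 0 δφ δκ p = dProlong ρ G φ κ h δφ δκ p := by
  have e0 : ∀ c a b, dChristoffel G 0 p c a b = 0 := fun c a b => by
    simp [dChristoffel, lowerChristoffel, pd_zero]
  have e1 : ρ.act (fun _ _ => 0) = 0 := by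
    ext w; simp [ρ.act_apply]
  refine Prod.ext (by simp [dProlong]) (Prod.ext (by simp [dProlong]) (Prod.ext ?_ ?_))
  · funext a i
    simp [dProlong, dCovDiff, pd_zero, e0, e1]
    abel
  · funext a b i j
    simp [dProlong, dCurv, pd_zero]

theorem notMem_tsupport_zero {X : Type*} [Zero X] (p : V4) : p ∉ tsupport (0 : V4 → X) := by
  simp [tsupport]

/-- Lie derivatives are local in ξ, so they inherit its compact support and can serve as variations.
-/
theorem lie_eq_zero (hp : p ∉ tsupport ξ) :
    lieMetric ξ G p = 0 ∧ lieMatter ρ ξ φ p = 0 ∧ lieConn ξ κ p = 0 := by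
  have h0 : ξ p = 0 := image_eq_zero_of_notMem_tsupport hp
  have hj : jac ξ p = fun _ _ => 0 := by
    funext c a
    have : (fun q => ξ q c) =ᶠ[nhds p] fun _ => 0 :=
      (eventually_eq_zero_of_notMem_tsupport hp).mono fun q hq => by simp [hq]
    rw [jac, pd_congr this, pd_zero]
  refine ⟨?_, ?_, ?_⟩
  · funext a b; simp [lieMetric, h0, hj]
  · funext i; simp [lieMatter, h0, hj, ρ.act_apply]
  · funext b i j; simp [lieConn, h0, hj]

theorem SmoothFields.lieMetric_symm (hF : SmoothFields alg D G φ κ) (hp : p ∈ D) (a b : Fin 4) :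
    lieMetric ξ G p a b = lieMetric ξ G p b a := by
  simp only [lieMetric, hF.pd_metric_symm hp _ a b]
  congr 1
  refine Finset.sum_congr rfl fun c _ => ?_
  rw [hF.symm hp a c, hF.symm hp b c]
  ring

/-- The coefficients of κ stay in a linear subspace, hence so do their derivatives and their
combinations. This is what makes the fixed-gauge Lie derivative of κ an admissible variation in the
condition of criticality. -/
theorem SmoothFields.lieConn_mem (hF : SmoothFields alg D G φ κ) (hp : p ∈ D) (b : Fin 4) :
    Matrix.of (lieConn ξ κ p b) ∈ alg := by
  have hκ := SmoothAt.diff (hF.conn p hp)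
  have e : Matrix.of (lieConn ξ κ p b) = ∑ d, ξ p d • Matrix.of (pd d (fun q => κ q b) p)
      + ∑ c, jac ξ p c b • Matrix.of (κ p c) := by
    ext i j
    have e1 : ∀ d, pd d (fun q => κ q b i j) p = pd d (fun q => κ q b) p i j := by
      intro d
      rw [pd_apply (f := fun q => κ q b i) (by fun_prop),
        pd_apply (f := fun q => κ q b) (by fun_prop)]
    simp [lieConn, e1, Matrix.sum_apply]
  rw [e]
  exact alg.add_mem (alg.sum_mem fun d _ => alg.smul_mem _ (pd_matrix_mem (by fun_prop)
    ((hF.eventually_conn_mem hp).mono fun q hq => hq b) d))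
    (alg.sum_mem fun c _ => alg.smul_mem _ (hF.conn_mem p hp c))

/-- For critical fields, the divergence of the stress-energy tensor is orthogonal to the compactly
supported vector fields. -/
theorem SmoothFields.integral_divergence_eq_zero (hF : SmoothFields alg D G φ κ)
    (hL : IsSmoothExtension alg ℓ L)
    (hinv : ∀ A : V4 ≃L[ℝ] V4, 0 < LinearMap.det (A : V4 →ₗ[ℝ] V4) →
      ∀ q ∈ admissible W alg, ℓ (frameChange ρ A q) = ℓ q)
    (hcrit : ∀ (δφ : V4 → Fin n → W) (δκ : V4 → Fin 4 → Fin n → Fin n → ℝ),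
      ContDiff ℝ ∞ δφ → ContDiff ℝ ∞ δκ → HasCompactSupport δφ → HasCompactSupport δκ →
      tsupport δφ ⊆ D → tsupport δκ ⊆ D → (∀ p a, Matrix.of (δκ p a) ∈ alg) →
      ∫ p, deriv (fun ε : ℝ => lagDensity ρ ℓ G (φ + ε • δφ) (κ + ε • δκ) p) 0 = 0)
    (hξ : ContDiff ℝ ∞ ξ) (hc : HasCompactSupport ξ) (hD : tsupport ξ ⊆ D) :
    ∫ p, (∑ c, (∑ b, divergence₂ G (stressEnergy ρ ℓ G φ κ) p b * G p b c) * ξ p c)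
      * volDensity (G p) = 0 := by
  have z := fun p (hp : p ∉ tsupport ξ) => lie_eq_zero (ρ := ρ) (G := G) (φ := φ) (κ := κ) hp
  have sG : tsupport (lieMetric ξ G) ⊆ tsupport ξ :=
    tsupport_subset_of_eq_zero fun p hp => (z p hp).1
  have sφ : tsupport (lieMatter ρ ξ φ) ⊆ tsupport ξ :=
    tsupport_subset_of_eq_zero fun p hp => (z p hp).2.1
  have sκ : tsupport (lieConn ξ κ) ⊆ tsupport ξ :=
    tsupport_subset_of_eq_zero fun p hp => (z p hp).2.2
  have cG := hasCompactSupport_of_eq_zero hc fun p hp => (z p hp).1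
  have cφ := hasCompactSupport_of_eq_zero hc fun p hp => (z p hp).2.1
  have cκ := hasCompactSupport_of_eq_zero hc fun p hp => (z p hp).2.2
  have dG : ContDiff ℝ ∞ (lieMetric ξ G) := contDiff_of_tsupport_subset
    (fun p hp => contDiffAt_lieMetric hξ.contDiffAt (hF.metric p hp)) (sG.trans hD)
  have dφ : ContDiff ℝ ∞ (lieMatter ρ ξ φ) := contDiff_of_tsupport_subset
    (fun p hp => contDiffAt_lieMatter hξ.contDiffAt (hF.matter p hp)) (sφ.trans hD)
  have dκ : ContDiff ℝ ∞ (lieConn ξ κ) := contDiff_of_tsupport_subset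
    (fun p hp => contDiffAt_lieConn hξ.contDiffAt (hF.conn p hp)) (sκ.trans hD)
  have symG : ∀ p a b, lieMetric ξ G p a b = lieMetric ξ G p b a := by
    intro p a b
    by_cases hp : p ∈ tsupport ξ
    · exact hF.lieMetric_symm (hD hp) a b
    · rw [(z p hp).1]; rfl
  have memκ : ∀ p a, Matrix.of (lieConn ξ κ p a) ∈ alg := by
    intro p a
    by_cases hp : p ∈ tsupport ξ
    · exact hF.lieConn_mem (hD hp) a
    · rw [(z p hp).2.2]; exact alg.zero_mem
  have hξc : ∀ (c : Fin 4) p, ContDiffAt ℝ ∞ (fun q => ξ q c) p := fun c p => by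
    have := hξ.contDiffAt (x := p)
    fun_prop
  have z0 : ∀ p, p ∉ tsupport ξ → ∀ c, ξ p c = 0 := fun p hp c => by
    rw [image_eq_zero_of_notMem_tsupport hp]; rfl
  -- the variation of the fields does not contribute
  have i1 := hcrit _ _ dφ dκ cφ cκ (sφ.trans hD) (sκ.trans hD) memκ
  -- the total variation vanishes
  have i2 : ∫ p, (deriv (fun ε : ℝ => lagDensity ρ ℓ (G + ε • lieMetric ξ G) φ κ p) 0
      + deriv (fun ε : ℝ => lagDensity ρ ℓ G (φ + ε • lieMatter ρ ξ φ)
        (κ + ε • lieConn ξ κ) p) 0) = 0 := by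
    have h1 := integral_eq_of_divergence (u := ξ) (D := D) (g := fun _ => 0)
      (f := fun p => deriv (fun ε : ℝ => lagDensity ρ ℓ (G + ε • lieMetric ξ G) φ κ p) 0
        + deriv (fun ε : ℝ => lagDensity ρ ℓ G (φ + ε • lieMatter ρ ξ φ)
        (κ + ε • lieConn ξ κ) p) 0)
      (V := fun d q => ξ q d * (L (prolong ρ G φ κ q) * volDensity (G q))) hc hD
      (fun _ _ => contDiffAt_const)
      (fun c p hp => (hξc c p).mul ((hF.contDiffAt_lagrangian ρ hL hp).mul
        (hF.contDiffAt_volDensity hp))) ?_ (fun _ _ => rfl)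
      (fun c p hp => by simp [z0 p hp]) ?_
    · simpa using h1
    · intro p hp
      have h2 := deriv_lagDensity_eq_zero (ρ := ρ) (ℓ := ℓ) (G := G) (φ := φ) (κ := κ)
        (h := lieMetric ξ G) (δφ := 0) (δκ := 0) (fun hn => hp (sG hn)) (notMem_tsupport_zero p) (notMem_tsupport_zero p)
      have h3 := deriv_lagDensity_eq_zero (ρ := ρ) (ℓ := ℓ) (G := G) (φ := φ) (κ := κ)
        (h := 0) (notMem_tsupport_zero p) (fun hn => hp (sφ hn)) (fun hn => hp (sκ hn))
      simp only [smul_zero, add_zero] at h2 h3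
      rw [h2, h3, add_zero]
    · intro p hp
      have h2 := hF.deriv_lagDensity (ρ := ρ) (δφ := 0) (δκ := 0) hL hp dG.contDiffAt
        contDiffAt_const contDiffAt_const (symG p)
        (Filter.Eventually.of_forall fun q a => alg.zero_mem)
      have h3 := hF.deriv_lagDensity (ρ := ρ) (h := 0) hL hp contDiffAt_const dφ.contDiffAt
        dκ.contDiffAt (fun a b => rfl) (Filter.Eventually.of_forall memκ)
      simp only [smul_zero, add_zero] at h2 h3
      rw [h2, h3, zero_add, ← hF.variation_lie hL hinv hp hξ.contDiffAt,
        ← dProlong_add ρ G (lieMetric ξ G) φ (lieMatter ρ ξ φ) κ (lieConn ξ κ) p, map_add]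
      simp only [Pi.zero_apply, mul_zero, Finset.sum_const_zero]
      ring
  have j1 : Integrable fun p =>
      deriv (fun ε : ℝ => lagDensity ρ ℓ (G + ε • lieMetric ξ G) φ κ p) 0 := by
    have := hF.integrable_deriv_lagDensity (ρ := ρ) (δφ := 0) (δκ := 0) hL hc hD dG contDiff_const
      contDiff_const sG (fun p hp => (notMem_tsupport_zero p hp).elim) (fun p hp => (notMem_tsupport_zero p hp).elim) symG
      (fun _ _ => alg.zero_mem)
    simpa only [smul_zero, add_zero] using this
  have j2 : Integrable fun p => deriv (fun ε : ℝ => lagDensity ρ ℓ G (φ + ε • lieMatter ρ ξ φ)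
      (κ + ε • lieConn ξ κ) p) 0 := by
    have := hF.integrable_deriv_lagDensity (ρ := ρ) (h := 0) hL hc hD contDiff_const dφ dκ
      (fun p hp => (notMem_tsupport_zero p hp).elim) sφ sκ (fun _ _ _ => by simp) memκ
    simpa only [smul_zero, add_zero] using this
  -- With the field part gone, the metric part alone integrates to zero; it is the integral of
  -- T^{ab} (L_ξ g)_{ab} √|g|.
  rw [integral_add j1 j2, i1, add_zero,
    (hF.isMetricResponse (ρ := ρ) hL).2 _ dG cG (sG.trans hD) symG] at i2
  have hT := fun p (hp : p ∈ D) a b => hF.contDiffAt_stressEnergy (ρ := ρ) hL hp a b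
  have hdiv : ∀ p ∈ D, ∀ b, ContDiffAt ℝ ∞
      (fun q => divergence₂ G (stressEnergy ρ ℓ G φ κ) q b) p := by
    intro p hp b
    have hΓ := hF.contDiffAt_christoffel hp
    exact ContDiffAt.sum fun a _ => (SmoothAt.pd (hT p hp a b) a).add (ContDiffAt.sum fun c _ =>
      ((hΓ a a c).mul (hT p hp c b)).add ((hΓ b a c).mul (hT p hp a c)))
  have hGc : ∀ p ∈ D, ∀ b c, ContDiffAt ℝ ∞ (fun q => G q b c) p := fun p hp b c => by
    have := hF.metric p hp
    fun_prop
  -- Integration by parts moves the derivatives from ξ to T, leaving the factor -2.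
  have i3 := integral_eq_of_divergence (u := ξ) (D := D)
    (f := fun p => (∑ a, ∑ b, stressEnergy ρ ℓ G φ κ p a b * lieMetric ξ G p a b)
      * volDensity (G p))
    (g := fun p => -2 * ((∑ c, (∑ b, divergence₂ G (stressEnergy ρ ℓ G φ κ) p b * G p b c) * ξ p c)
      * volDensity (G p)))
    (V := fun a q => 2 * ((∑ c, (∑ b, stressEnergy ρ ℓ G φ κ q a b * G q b c) * ξ q c)
          * volDensity (G q))) hc hD
    (fun p hp => contDiffAt_const.mul ((ContDiffAt.sum fun c _ => (ContDiffAt.sum fun b _ =>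
      (hdiv p hp b).mul (hGc p hp b c)).mul (hξc c p)).mul (hF.contDiffAt_volDensity hp)))
    (fun a p hp => contDiffAt_const.mul ((ContDiffAt.sum fun c _ => (ContDiffAt.sum fun b _ =>
      (hT p hp a b).mul (hGc p hp b c)).mul (hξc c p)).mul (hF.contDiffAt_volDensity hp)))
    (fun p hp => by simp [(z p hp).1]) (fun p hp => by simp [z0 p hp])
    (fun a p hp => by simp [z0 p hp])
    (fun p hp => hF.contraction_lieMetric hp (hT p hp) (hF.stressEnergy_symm hp) hξ.contDiffAt)
  rw [i2, integral_const_mul] at i3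
  linarith

/-- Fundamental lemma of the calculus of variations, applied to each component of the divergence
with its index lowered; non-degeneracy of the metric then raises the index back. -/
theorem SmoothFields.divergence_eq_zero (hF : SmoothFields alg D G φ κ)
    (hL : IsSmoothExtension alg ℓ L)
    (hinv : ∀ A : V4 ≃L[ℝ] V4, 0 < LinearMap.det (A : V4 →ₗ[ℝ] V4) →
      ∀ q ∈ admissible W alg, ℓ (frameChange ρ A q) = ℓ q)
    (hcrit : ∀ (δφ : V4 → Fin n → W) (δκ : V4 → Fin 4 → Fin n → Fin n → ℝ),
      ContDiff ℝ ∞ δφ → ContDiff ℝ ∞ δκ → HasCompactSupport δφ → HasCompactSupport δκ →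
      tsupport δφ ⊆ D → tsupport δκ ⊆ D → (∀ p a, Matrix.of (δκ p a) ∈ alg) →
      ∫ p, deriv (fun ε : ℝ => lagDensity ρ ℓ G (φ + ε • δφ) (κ + ε • δκ) p) 0 = 0)
    (hp : p ∈ D) (b : Fin 4) : divergence₂ G (stressEnergy ρ ℓ G φ κ) p b = 0 := by
  set v : V4 → Fin 4 → ℝ := fun p b => divergence₂ G (stressEnergy ρ ℓ G φ κ) p b with hv
  have hT := fun p (hp : p ∈ D) a b => hF.contDiffAt_stressEnergy (ρ := ρ) hL hp a b
  have low : ∀ c, ∀ q ∈ D, ∑ b, v q b * G q b c = 0 := by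
    intro c q hq
    have hcont : ContinuousOn (fun q => (∑ b, v q b * G q b c) * volDensity (G q)) D := by
      intro q hq
      refine ContinuousAt.continuousWithinAt (ContDiffAt.continuousAt (𝕜 := ℝ) (n := ∞) ?_)
      have hΓ := hF.contDiffAt_christoffel hq
      have hG := hF.metric q hq
      refine (ContDiffAt.sum fun b _ => ContDiffAt.mul ?_ (by fun_prop)).mul
        (hF.contDiffAt_volDensity hq)
      exact ContDiffAt.sum fun a _ => (SmoothAt.pd (hT q hq a b) a).add
        (ContDiffAt.sum fun c _ => ((hΓ a a c).mul (hT q hq c b)).add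
          ((hΓ b a c).mul (hT q hq a c)))
    -- The test vector field is f times the c-th coordinate vector, f being an arbitrary test
    -- function. Vanishing almost everywhere becomes vanishing everywhere on D by continuity, and
    -- the positive density can be divided out.
    have hae := hF.isOpen.ae_eq_zero_of_integral_contDiff_smul_eq_zero (μ := volume)
      (hcont.locallyIntegrableOn hF.isOpen.measurableSet) (fun f hf hfc hfD => by
        have hi : ContDiff ℝ ∞ (fun q c' => if c' = c then f q else 0 : V4 → Fin 4 → ℝ) := by
          refine contDiff_pi.2 fun c' => ?_
          split_ifs
          · exact hf
          · exact contDiff_const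
        have hz : ∀ q, q ∉ tsupport f → (fun c' : Fin 4 => if c' = c then f q else 0) = 0 := by
          intro q hq
          funext c'
          simp [image_eq_zero_of_notMem_tsupport hq]
        have h1 := hF.integral_divergence_eq_zero hL hinv hcrit hi
          (hasCompactSupport_of_eq_zero hfc hz) ((tsupport_subset_of_eq_zero hz).trans hfD)
        rw [← h1]
        congr 1
        funext q
        simp [hv]
        ring)
    have heq := Measure.eqOn_open_of_ae_eq (μ := (volume : Measure V4))
      (g := fun _ => (0 : ℝ)) ((ae_restrict_iff' hF.isOpen.measurableSet).2 hae) hF.isOpen hcont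
      continuousOn_const hq
    exact (mul_eq_zero.1 heq).resolve_right (volDensity_pos (hF.det_ne_zero hq)).ne'
  have h1 : ∑ c, (∑ b', v p b' * G p b' c) * invMetric (G p) c b = v p b := by
    simp only [Finset.sum_mul, mul_assoc]
    rw [Finset.sum_comm]
    simp only [← Finset.mul_sum, mul_invMetric (hF.det_ne_zero hp)]
    simp
  change v p b = 0
  rw [← h1]
  simp [low _ p hp]

end Conservation

/-! ### From the manifold to components in a chart and a gauge -/

section Global

variable {W : Type*} [NormedAddCommGroup W] [NormedSpace ℝ W] {n : ℕ}

theorem isOpen_localDom {n : ℕ} {M : Type*} [TopologicalSpace M] [ChartedSpace V4 M]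
    {E : M → Type*} [∀ x, AddCommGroup (E x)] [∀ x, Module ℝ (E x)]
    [∀ x, TopologicalSpace (E x)] [TopologicalSpace (TotalSpace (Fin n → ℝ) E)]
    [FiberBundle (Fin n → ℝ) E]
    (c : OpenPartialHomeomorph M V4) (s : Gauge n E) :
    IsOpen (localDom c s) :=
  c.symm.isOpen_inter_preimage s.isOpen_dom

theorem smoothFields_components {M : Type*} [TopologicalSpace M] [ChartedSpace V4 M]
    [IsManifold (𝓡 4) ∞ M]
    {E : M → Type*} [∀ x, AddCommGroup (E x)] [∀ x, Module ℝ (E x)]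
    [∀ x, TopologicalSpace (E x)] [TopologicalSpace (TotalSpace (Fin n → ℝ) E)]
    [∀ x, IsTopologicalAddGroup (E x)] [∀ x, ContinuousSMul ℝ (E x)]
    [FiberBundle (Fin n → ℝ) E]
    {O : OrientedAtlas M} (g : LorentzMetric O) {ρ : TensorType W}
    {S : GaugeStructure n E} (F : FieldPair O ρ S) {c : OpenPartialHomeomorph M V4}
    (hc : c ∈ O.charts) {s : Gauge n E} (hs : s ∈ S.gauges) :
    SmoothFields S.alg (localDom c s) (metricComp g.val c) (matterComp ρ F.matter c s)
      (connComp F.conn c s) where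
  isOpen := isOpen_localDom c s
  lie_mem := S.lie_mem
  metric _ hp := (g.smooth c hc).contDiffAt (c.open_target.mem_nhds hp.1)
  matter _ hp := (F.smooth_matter c hc s hs).contDiffAt ((isOpen_localDom c s).mem_nhds hp)
  conn _ hp := (F.smooth_conn c hc s hs).contDiffAt ((isOpen_localDom c s).mem_nhds hp)
  lorentz p hp := g.lorentz c hc p hp.1
  conn_mem := F.conn_mem c hc s hs

end Global

end CovariantFields

open CovariantFields
-- The charts and the adapted gauges each cover the manifold, so the component statements on the
-- sets `localDom c s` amount to statements everywhere on it.
theorem theorem3 {M : Type*} [TopologicalSpace M] [ChartedSpace V4 M] [IsManifold (𝓡 4) ∞ M]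
    {n : ℕ} {E : M → Type*} [∀ x, AddCommGroup (E x)] [∀ x, Module ℝ (E x)]
    [∀ x, TopologicalSpace (E x)] [∀ x, IsTopologicalAddGroup (E x)]
    [∀ x, ContinuousSMul ℝ (E x)] [TopologicalSpace (TotalSpace (Fin n → ℝ) E)]
    [FiberBundle (Fin n → ℝ) E] [VectorBundle ℝ (Fin n → ℝ) E]
    [ContMDiffVectorBundle ∞ (Fin n → ℝ) E (𝓡 4)]
    {W : Type*} [NormedAddCommGroup W] [NormedSpace ℝ W] [FiniteDimensional ℝ W]
    (O : OrientedAtlas M) (g : LorentzMetric O) (ρ : TensorType W) (S : GaugeStructure n E)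
    (Λ : NaturalLagrangian ρ S) (F : FieldPair O ρ S)
    (c : OpenPartialHomeomorph M V4) (hc : c ∈ O.charts) (s : Gauge n E) (hs : s ∈ S.gauges) :
    IsMetricResponse ρ (Λ.expr s) (metricComp g.val c) (matterComp ρ F.matter c s)
      (connComp F.conn c s) (localDom c s) (stressEnergyTensor g Λ F c s) ∧
    (IsCritical g Λ F →
      ∀ p ∈ localDom c s, ∀ b : Fin 4,
        divergence₂ (metricComp g.val c) (stressEnergyTensor g Λ F c s) p b = 0) := by
  have hF := smoothFields_components g F hc hs
  obtain ⟨L, hL, hL'⟩ := exists_smooth_extension S.alg (Λ.smooth s hs)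
  have hext : IsSmoothExtension S.alg (Λ.expr s) L := ⟨hL, hL'⟩
  -- Criticality is used only for variations supported in the domain of this same chart and gauge.
  exact ⟨hF.isMetricResponse hext, fun hcrit p hp b =>
    hF.divergence_eq_zero hext (Λ.frame_inv s hs) (hcrit c hc s hs) hp b⟩
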